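/- **Setting.** Let $q$ be a prime power, $\mathcal F=\mathbb F_q$, let $\varphi\in\mathcal F[t]$ be a primitive polynomial of degree $m\ge 1$ (monic, irreducible, and $t$ generates the multiplicative group of $R=\mathcal F[t]/\langle\varphi\rangle\cong\mathbb F_{q^m}$), and put $n=9m$. Consider the subgroups of $SL_3(R)$ $$K_1=\left\{\begin{pmatrix}1&at&ct^2\\0&1&bt\\0&0&1\end{pmatrix}\right\},\quad K_2=\left\{\begin{pmatrix}1&0&0\\ct^2&1&at\\bt&0&1\end{pmatrix}\right\},\quad K_3=\left\{\begin{pmatrix}1&at&0\\0&1&0\\bt&ct^2&1\end{pmatrix}\right\}\qquad(a,b,c\in\mathcal F),$$ let $G$ be the group they generate, and let $X_n$ be the coset complex of $(G;K_1,K_2,K_3)$: its set $X_n(2)$ of triangles consists of the triples of cosets $(g_1K_1,g_2K_2,g_3K_3)$, $g_i\in G$, with non-empty intersection. For $\alpha\in\mathcal F$ let $h_1(\alpha),h_2(\alpha),h_3(\alpha)$ be the matrices with $1$'s on the diagonal, the entry $\alpha t$ at position $(3,1)$, $(1,2)$, $(2,3)$ respectively, and $0$ elsewhere. Let $\iota:G\to\mathcal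 F^{n}$ list the coefficients of the nine matrix entries (as polynomials in $t$ of degree less than $m$), and let $\bar X_n=\iota(G)$. For $d\ge 0$ let $RS(q,d)\subseteq\mathcal F^{\mathcal F}$ be the code of evaluations of univariate polynomials of degree at most $d$, and define the HDX local Reed–Solomon code $$C_{n,d}=\{f:\bar X_n\to\mathcal F \;:\; (\alpha\mapsto f(\iota(g\,h_i(\alpha))))\in RS(q,d)\ \text{ for all } g\in G,\ i=1,2,3\}.$$ A code $C\subseteq\mathcal F^N$ is $(Q,\varepsilon,\rho)$-locally testable, for $\varepsilon>0$ and $\rho$ strictly increasing with $\rho(0)=0$, if there is a randomized tester that makes at most $Q$ queries, always accepts codewords, and is such that every word $f$ rejected with probability $p\le\varepsilon$ has relative Hamming distance at most $\rho(p)$ from $C$. **Theorem.** There are absolute constants $A>0$ and $q_0$, and for every prime power $q$ there are constants $c_q,\delta_q,\varepsilon_q,\kappa_q>0$ depending only on $q$, such that for every primitive $\varphi$ of degree $m$ over $\mathbb F_q$ and $n=9m$ the following holds for all $d<q$. 1. *Rate.* $\dim C_{n,d}$ is at least the dimension of the Reed–Muller code of polynomials in $n/3$ variables over $\mathbb F_q$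 of total degree at most $d$. If $d>\frac23q$, then $\dim C_{n,d}\ge c_q\,|X_n(2)|$. 2. *Distance.* If $d<q-A\sqrt q$, any two distinct codewords of $C_{n,d}$ have relative Hamming distance at least $\delta_q$. 3. *LDPC and local testability.* $C_{n,d}$ is the set of words satisfying a set of linear parity checks, each involving exactly $d+2$ coordinates. If $q\ge q_0$ is prime and $d<q/4$, then $C_{n,d}$ is $(d+2,\varepsilon_q,\rho)$-locally testable with $\rho(p)=\kappa_q\,p$. 4. *Multiplication.* For all $d_1,d_2\ge 0$, $w_1\in C_{n,d_1}$ and $w_2\in C_{n,d_2}$, the coordinate-wise product $w_1\odot w_2$ is in $C_{n,d_1+d_2}$. 5. *Symmetry.* There is a group of permutations of $\bar X_n$ that is transitive and preserves each code $C_{n,d}$. -/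

import Mathlib

open Polynomial

universe u

namespace HDXCode

/-! ### Codes, distance, local testability -/

/-- The relative Hamming distance of two words. -/
noncomputable def relDist {ι F : Type*} (f g : ι → F) : ℝ :=
  (Nat.card {i : ι // f i ≠ g i} : ℝ) / (Nat.card ι : ℝ)

/-- A deterministic (non-adaptive) test: it reads the given word at the coordinates in `queries`,
at most `Q` of them, and decides from the symbols read whether to accept. -/
structure QueryTest (ι F : Type*) (Q : ℕ) where
  queries : Finset ι
  card_le : queries.card ≤ Q
  accept : (queries → F) → Prop

/-- The probability that the randomized tester `T` (a probability distribution over deterministic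
tests) rejects the word `f`. -/
noncomputable def rejectProb {ι F : Type*} {Q : ℕ} (T : PMF (QueryTest ι F Q)) (f : ι → F) :
    NNReal :=
  (T.toOuterMeasure {τ | ¬ τ.accept fun i => f i}).toNNReal

/-- `C` is a `(Q, ε, ρ)`-locally testable code: there is a randomized tester making at most `Q`
queries that always accepts codewords and such that every word which is rejected with
probability `p ≤ ε` is at relative distance at most `ρ p` from `C`. -/
def IsLocallyTestable {ι F : Type*} (C : Set (ι → F)) (Q : ℕ) (ε : ℝ) (ρ : NNReal → NNReal) :
    Prop :=
  0 < ε ∧ StrictMono ρ ∧ ρ 0 = 0 ∧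
    ∃ T : PMF (QueryTest ι F Q),
      (∀ f ∈ C, rejectProb T f = 0) ∧
      ∀ f : ι → F, (rejectProb T f : ℝ) ≤ ε →
        ∃ w ∈ C, relDist f w ≤ (ρ (rejectProb T f) : ℝ)

/-- The Reed–Solomon code `RS(q, d)`: evaluations on all of `F` of polynomials of degree at
most `d`. -/
noncomputable def reedSolomon (F : Type u) [Field F] (d : ℕ) : Submodule F (F → F) :=
  (degreeLE F (d : WithBot ℕ)).map (LinearMap.pi fun a : F => leval a)

/-- The Reed–Muller code: evaluations on `F ^ k` of polynomials in `k` variables of total degree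
at most `d`. -/
noncomputable def reedMuller (F : Type u) [Field F] (k d : ℕ) :
    Submodule F ((Fin k → F) → F) :=
  (MvPolynomial.restrictTotalDegree (Fin k) F d).map
    (LinearMap.pi fun x : Fin k → F => (MvPolynomial.aeval x).toLinearMap)

/-! ### The coset complex -/

/-- A primitive polynomial over a finite field: monic, irreducible, and the class `t` of the
variable generates the multiplicative group of the field `F[t] / φ`. -/
structure IsPrimitivePoly {F : Type u} [Field F] (φ : F[X]) : Prop where
  monic : φ.Monic
  irreducible : Irreducible φ
  orderOf_root : orderOf (AdjoinRoot.root φ) = Nat.card F ^ φ.natDegree - 1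

/-- The group `SL₃(R)` for `R = F[t] / φ`. -/
abbrev SL3 {F : Type u} [Field F] (φ : F[X]) : Type u :=
  Matrix.SpecialLinearGroup (Fin 3) (AdjoinRoot φ)

/-- The three unipotent groups of `3 × 3` matrices over `R = F[t] / φ`; here `a, b, c` range
over `F` and `t` is the class of the variable. -/
noncomputable def K {F : Type u} [Field F] (φ : F[X]) : Fin 3 → Set (SL3 φ) :=
  let t : AdjoinRoot φ := AdjoinRoot.root φ
  ![{g | ∃ a b c : F, (g : Matrix (Fin 3) (Fin 3) (AdjoinRoot φ)) =
        !![1, a • t, c • t ^ 2; 0, 1, b • t; 0, 0, 1]},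
    {g | ∃ a b c : F, (g : Matrix (Fin 3) (Fin 3) (AdjoinRoot φ)) =
        !![1, 0, 0; c • t ^ 2, 1, a • t; b • t, 0, 1]},
    {g | ∃ a b c : F, (g : Matrix (Fin 3) (Fin 3) (AdjoinRoot φ)) =
        !![1, a • t, 0; 0, 1, 0; b • t, c • t ^ 2, 1]}]

/-- The group generated by the three unipotent groups. -/
noncomputable def G {F : Type u} [Field F] (φ : F[X]) : Subgroup (SL3 φ) :=
  Subgroup.closure (⋃ i, K φ i)

/-- The triangles of the coset complex of `G` and its subgroups `K 0, K 1, K 2`: triples of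
cosets `g₀ K 0, g₁ K 1, g₂ K 2` with a common element. -/
def triangles {F : Type u} [Field F] (φ : F[X]) : Set (Fin 3 → Set (SL3 φ)) :=
  {v | (∀ i, ∃ g ∈ G φ, v i = (fun k => g * k) '' K φ i) ∧ (⋂ i, v i).Nonempty}

/-- The elements `h i α` of the groups `H i`, where `H i` is the intersection of the two groups
`K j` with `j ≠ i`. The triangles that contain an edge of type `i` correspond to the elements
`g * h i α`, `α ∈ F`, of a coset of `H i`. -/
noncomputable def h {F : Type u} [Field F] (φ : F[X]) (i : Fin 3) (α : F) : SL3 φ :=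
  let t : AdjoinRoot φ := AdjoinRoot.root φ
  (![⟨!![1, 0, 0; 0, 1, 0; α • t, 0, 1], by simp [Matrix.det_fin_three]⟩,
    ⟨!![1, α • t, 0; 0, 1, 0; 0, 0, 1], by simp [Matrix.det_fin_three]⟩,
    ⟨!![1, 0, 0; 0, 1, α • t; 0, 0, 1], by simp [Matrix.det_fin_three]⟩] : Fin 3 → SL3 φ) i

theorem h_mem {F : Type u} [Field F] (φ : F[X]) (i : Fin 3) (α : F) : h φ i α ∈ G φ := by
  apply Subgroup.subset_closure
  rw [Set.mem_iUnion]
  fin_cases i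
  · exact ⟨1, 0, α, 0, by simp [h]⟩
  · exact ⟨0, α, 0, 0, by simp [h]⟩
  · exact ⟨0, 0, α, 0, by simp [h]⟩

/-! ### The embedding into a vector space and the code -/

/-- The embedding of `3 × 3` matrices over `R = F[t] / φ` into `F ^ n`, `n = 9 * deg φ`, that
lists the coefficients of the reduced representatives of the nine entries. -/
noncomputable def embed {F : Type u} [Field F] {φ : F[X]} (hφ : φ.Monic) (g : SL3 φ) :
    Fin 3 × Fin 3 × Fin φ.natDegree → F :=
  fun x => (AdjoinRoot.modByMonicHom hφ (g x.1 x.2.1)).coeff x.2.2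

/-- The set of points in `F ^ n` that carries the code: the image of `G`. -/
def points {F : Type u} [Field F] {φ : F[X]} (hφ : φ.Monic) :
    Set (Fin 3 × Fin 3 × Fin φ.natDegree → F) :=
  embed hφ '' (G φ : Set (SL3 φ))

/-- The line of type `i` through the point of `g`. -/
noncomputable def line {F : Type u} [Field F] {φ : F[X]} (hφ : φ.Monic) (i : Fin 3) (g : G φ)
    (α : F) : points hφ :=
  ⟨embed hφ (g * h φ i α), g * h φ i α, mul_mem g.2 (h_mem φ i α), rfl⟩

/-- The HDX local Reed–Solomon code with degree `d i` on the lines of type `i`: all functions on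
the point set whose restriction to each line of type `i` is in the Reed–Solomon code of degree
`d i`. -/
noncomputable def code₃ {F : Type u} [Field F] {φ : F[X]} (hφ : φ.Monic) (d : Fin 3 → ℕ) :
    Submodule F (points hφ → F) :=
  ⨅ (i : Fin 3) (g : G φ), (reedSolomon F (d i)).comap (LinearMap.funLeft F F (line hφ i g))

/-- The HDX local Reed–Solomon code with all degrees equal to `d`. -/
noncomputable def code {F : Type u} [Field F] {φ : F[X]} (hφ : φ.Monic) (d : ℕ) :
    Submodule F (points hφ → F) :=
  code₃ hφ fun _ => d

end HDXCode

set_option maxSynthPendingDepth 3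

namespace HDXCode

/-! ### Univariate Reed–Solomon codes: moments, distance, divided differences -/

section ReedSolomon

variable {F : Type u} [Field F]

/-! The code consists of the functions on the group that have low degree along the cosets of three
one-parameter subgroups, any two of which generate a Heisenberg group. Distance and testability use
only these relations, abstracted in `HeisenbergTriple`.

Expansion. Inside one Heisenberg coset, the lines of the two families are the points (b, c) and the
lines c = ab + e of an affine plane without vertical lines, and the elements of the coset are the
incidences. Hence functions of the two kinds are orthogonal up to the factor 1/√q once coset
averages are removed (`sum_coset_sq_le`). Only constants are invariant under all three subgroups, so
a trickling-down argument (`IsLocallyExpanding.inner_le_of_mem`) makes cosets of different types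
nearly independent in the whole group, with a constant that does not depend on the size of the
group.

Distance. A nonzero codeword meets every coset in its support along a fraction of lines of order
1/√q (`four_mul_expansion_le_sqrt`). If the support were sparse, global expansion would leave room
for too few lines. This gives `card_le_sum_support`.

Testability. The local statement `exists_isRowRS_isColRS_near` is of Polishchuk–Spielman type: if a
function that is good on rows is close to one that is good on columns, both agree on most lines with
a function that is good on both. One multiplies by a polynomial E that vanishes at the
disagreements. The product is a polynomial Q, because low degree on rows and columns of the
Heisenberg group forces low degree in the central direction (`center_mem_reedSolomon`) and hence in
all coordinates. A dimension count (`card_mul_natDegree_le`) on planes through columns, applied in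
both directions, shows that E divides Q. Globally, one starts with a local word on each type of
coset and minimizes the number of lines on which these words disagree. At a local minimum the local
statement makes bad lines sparse in every coset that few transverse bad lines hit. Every point of
disagreement lies on two bad lines, so expansion leaves no bad line
(`IsLocallyMinimal.badness_eq_zero`), and the three words merge into a codeword.

Rate. For d > 2q/3 one counts constraints. For the Reed–Muller bound, polynomials in the first row
of the matrix are codewords, since matrix entries are affine along lines. They are determined by
their values, because the group contains all transvections and moves the first row to every nonzero
vector. The only exception, q = 2 and m = 2, is treated directly.

The parity checks are divided differences along lines, products are taken line by line, and left
translations permute the lines. -/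

theorem natDegree_lt_of_degree_lt_of_pos {P : F[X]} {n : ℕ} (hn : 0 < n) (h : P.degree < n) :
    P.natDegree < n := by
  by_cases hP : P = 0
  · simpa [hP] using hn
  · exact (natDegree_lt_iff_degree_lt hP).2 h

theorem mem_reedSolomon_iff {d : ℕ} {g : F → F} :
    g ∈ reedSolomon F d ↔ ∃ P : F[X], P.natDegree ≤ d ∧ ∀ x, g x = P.eval x := by
  unfold reedSolomon
  rw [Submodule.mem_map]
  constructor
  · rintro ⟨P, hP, rfl⟩
    exact ⟨P, natDegree_le_iff_degree_le.2 (mem_degreeLE.1 hP), fun x => rfl⟩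
  · rintro ⟨P, hP, h⟩
    exact ⟨P, mem_degreeLE.2 (natDegree_le_iff_degree_le.1 hP), funext fun x => (h x).symm⟩

theorem mul_mem_reedSolomon {d d' : ℕ} {g g' : F → F} (h : g ∈ reedSolomon F d)
    (h' : g' ∈ reedSolomon F d') : (fun x => g x * g' x) ∈ reedSolomon F (d + d') := by
  obtain ⟨P, hP, hg⟩ := mem_reedSolomon_iff.1 h
  obtain ⟨P', hP', hg'⟩ := mem_reedSolomon_iff.1 h'
  refine mem_reedSolomon_iff.2 ⟨P * P', natDegree_mul_le.trans (add_le_add hP hP'), fun x => ?_⟩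
  rw [hg, hg', eval_mul]

theorem comp_add_mem_reedSolomon {d : ℕ} {g : F → F} (h : g ∈ reedSolomon F d) (β : F) :
    (fun x => g (β + x)) ∈ reedSolomon F d := by
  obtain ⟨P, hP, hg⟩ := mem_reedSolomon_iff.1 h
  refine mem_reedSolomon_iff.2 ⟨P.comp (C β + X), ?_, fun x => ?_⟩
  · rw [natDegree_comp, add_comm, natDegree_X_add_C, mul_one]
    exact hP
  · rw [hg, eval_comp]
    simp

variable [Fintype F]

theorem sum_eval_eq_zero_of_natDegree {P : F[X]} (hP : P.natDegree + 2 ≤ Fintype.card F) :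
    ∑ x : F, P.eval x = 0 := by
  simp_rw [eval_eq_sum_range]
  rw [Finset.sum_comm]
  refine Finset.sum_eq_zero fun i hi => ?_
  rw [← Finset.mul_sum, FiniteField.sum_pow_lt_card_sub_one, mul_zero]
  rw [Finset.mem_range] at hi
  omega

theorem sum_eq_zero_of_mem_reedSolomon {d : ℕ} {g : F → F} (h : g ∈ reedSolomon F d)
    (hd : d + 2 ≤ Fintype.card F) : ∑ x, g x = 0 := by
  obtain ⟨P, hP, hg⟩ := mem_reedSolomon_iff.1 h
  simp_rw [hg]
  exact sum_eval_eq_zero_of_natDegree (by omega)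

theorem exists_natDegree_lt_eval_eq (g : F → F) :
    ∃ P : F[X], P.natDegree + 1 ≤ Fintype.card F ∧ ∀ x, g x = P.eval x := by
  classical
  refine ⟨Lagrange.interpolate Finset.univ id g, ?_, fun x => ?_⟩
  · have := Lagrange.degree_interpolate_lt (s := Finset.univ) (v := id) g (Set.injOn_id _)
    have hc : 0 < (Finset.univ : Finset F).card := Finset.card_pos.2 Finset.univ_nonempty
    have h2 := natDegree_lt_of_degree_lt_of_pos hc this
    rwa [Finset.card_univ] at h2
  · exact (Lagrange.eval_interpolate_at_node (v := id) g (Set.injOn_id _)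
      (Finset.mem_univ x)).symm

theorem sum_pow_card_sub_one : ∑ x : F, x ^ (Fintype.card F - 1) = -1 := by
  classical
  have h1 : ∀ x : F, x ^ (Fintype.card F - 1) = 1 - if x = 0 then 1 else 0 := by
    intro x
    split_ifs with h
    · have := Fintype.one_lt_card (α := F)
      rw [h, zero_pow (by omega), sub_self]
    · rw [FiniteField.pow_card_sub_one_eq_one x h, sub_zero]
  simp_rw [h1]
  simp

/-- A function whose low moments vanish has low degree. -/
theorem mem_reedSolomon_of_moments {d : ℕ} {g : F → F}
    (h : ∀ k, k + d + 2 ≤ Fintype.card F → ∑ x, x ^ k * g x = 0) : g ∈ reedSolomon F d := by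
  obtain ⟨P, hP, hg⟩ := exists_natDegree_lt_eval_eq g
  refine mem_reedSolomon_iff.2 ⟨P, ?_, hg⟩
  by_contra! hlt
  -- This exponent lifts the leading monomial to `x ^ (q - 1)`, which sums to -1, while all lower
  -- powers sum to zero. So the moment is minus the leading coefficient.
  have hk := h (Fintype.card F - 1 - P.natDegree) (by omega)
  simp_rw [hg] at hk
  have hP0 : P ≠ 0 := by
    rintro rfl
    simp at hlt
  have e1 : ∀ x : F, x ^ (Fintype.card F - 1 - P.natDegree) * P.eval x =
      ∑ i ∈ Finset.range (P.natDegree + 1),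
        P.coeff i * x ^ (Fintype.card F - 1 - P.natDegree + i) := by
    intro x
    rw [eval_eq_sum_range, Finset.mul_sum]
    refine Finset.sum_congr rfl fun i _ => ?_
    ring
  simp_rw [e1] at hk
  rw [Finset.sum_comm, Finset.sum_range_succ, Finset.sum_eq_zero, zero_add, ← Finset.mul_sum,
    show Fintype.card F - 1 - P.natDegree + P.natDegree = Fintype.card F - 1 by omega,
    sum_pow_card_sub_one] at hk
  · apply hP0
    rw [← leadingCoeff_eq_zero, leadingCoeff]
    linear_combination -hk
  · intro i hi
    rw [Finset.mem_range] at hi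
    rw [← Finset.mul_sum, FiniteField.sum_pow_lt_card_sub_one, mul_zero]
    omega

theorem mem_reedSolomon_of_card_le {d : ℕ} (hd : Fintype.card F ≤ d + 1) (g : F → F) :
    g ∈ reedSolomon F d :=
  mem_reedSolomon_of_moments fun k hk => by omega

/-- Distinct Reed–Solomon words agree in at most `d` points. -/
theorem card_le_add_card_ne [DecidableEq F] {d : ℕ} {g g' : F → F} (h : g ∈ reedSolomon F d)
    (h' : g' ∈ reedSolomon F d) {x₀ : F} (hne : g x₀ ≠ g' x₀) :
    Fintype.card F ≤ d + (Finset.univ.filter fun x => g x ≠ g' x).card := by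
  obtain ⟨P, hP, hg⟩ := mem_reedSolomon_iff.1 (sub_mem h h')
  have hP0 : P ≠ 0 := by
    rintro rfl
    have := hg x₀
    simp only [Pi.sub_apply, eval_zero, sub_eq_zero] at this
    exact hne this
  have h1 : (Finset.univ.filter fun x => g x = g' x) ⊆ P.roots.toFinset := by
    intro x hx
    rw [Finset.mem_filter] at hx
    rw [Multiset.mem_toFinset, mem_roots hP0, IsRoot.def, ← hg, Pi.sub_apply, hx.2, sub_self]
  have h2 := (Finset.card_le_card h1).trans
    ((Multiset.toFinset_card_le _).trans ((card_roots' P).trans hP))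
  have h3 := Finset.card_filter_add_card_filter_not (s := (Finset.univ : Finset F))
    (fun x => g x = g' x)
  rw [Finset.card_univ] at h3
  simp only [ne_eq]
  omega

/-- Membership in the Reed–Solomon code is tested by the divided differences on all sets of
`d + 2` points. -/
theorem mem_reedSolomon_iff_divided_differences [DecidableEq F] {d : ℕ} {g : F → F} :
    g ∈ reedSolomon F d ↔ ∀ s : Finset F, s.card = d + 2 →
      ∑ x ∈ s, Lagrange.nodalWeight s id x * g x = 0 := by
  have key : ∀ (s : Finset F), s.card = d + 2 → ∀ P : F[X], P.degree < s.card →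
      P.coeff (d + 1) = ∑ x ∈ s, Lagrange.nodalWeight s id x * P.eval x := by
    intro s hs P hP
    have := Lagrange.coeff_eq_sum (s := s) (v := id) (Set.injOn_id _) (P := P) hP
    rw [hs, Nat.add_sub_assoc (by norm_num)] at this
    rw [this]
    refine Finset.sum_congr rfl fun x hx => ?_
    rw [Lagrange.nodalWeight, Finset.prod_inv_distrib, div_eq_mul_inv, mul_comm]
    rfl
  constructor
  · intro h s hs
    obtain ⟨P, hP, hg⟩ := mem_reedSolomon_iff.1 h
    simp_rw [hg]
    rw [← key s hs P, coeff_eq_zero_of_natDegree_lt (by omega)]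
    rw [hs]
    exact (degree_le_of_natDegree_le hP).trans_lt (by exact_mod_cast (by omega : d < d + 2))
  · intro h
    -- Here no set of `d + 2` points exists, the condition is empty, and the code is everything.
    by_cases hd : Fintype.card F ≤ d + 1
    · exact mem_reedSolomon_of_card_le hd g
    push Not at hd
    obtain ⟨s₀, hs₀⟩ := Finset.exists_subset_card_eq (s := (Finset.univ : Finset F))
      (n := d + 1) (by rw [Finset.card_univ]; omega)
    refine mem_reedSolomon_iff.2 ⟨Lagrange.interpolate s₀ id g, ?_, fun x => ?_⟩
    · have := Lagrange.degree_interpolate_lt (s := s₀) (v := id) g (Set.injOn_id _)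
      rw [hs₀.2] at this
      exact Nat.lt_succ_iff.1 (natDegree_lt_of_degree_lt_of_pos (by omega) this)
    · by_cases hx : x ∈ s₀
      · exact (Lagrange.eval_interpolate_at_node (v := id) g (Set.injOn_id _) hx).symm
      · have hs : (insert x s₀).card = d + 2 := by rw [Finset.card_insert_of_notMem hx, hs₀.2]
        set s := insert x s₀
        -- The coefficient of `X ^ (d + 1)` in the interpolant on `d + 2` points is the divided
        -- difference, which vanishes. The interpolant is therefore already determined by the points
        -- of `s₀`.
        have hI : Lagrange.interpolate s id g = Lagrange.interpolate s₀ id g := by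
          have h1 : (Lagrange.interpolate s id g).degree < s.card :=
            Lagrange.degree_interpolate_lt _ (Set.injOn_id _)
          have h2 := key s hs _ h1
          have h3 : ∑ x ∈ s, Lagrange.nodalWeight s id x *
              (Lagrange.interpolate s id g).eval x = 0 := by
            rw [← h s hs]
            refine Finset.sum_congr rfl fun y hy => ?_
            rw [show (Lagrange.interpolate s id g).eval y = g y from
              Lagrange.eval_interpolate_at_node (v := id) g (Set.injOn_id _) hy]
          rw [h3] at h2
          refine Lagrange.eq_interpolate_of_eval_eq (v := id) g (Set.injOn_id _) ?_ fun y hy =>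
            Lagrange.eval_interpolate_at_node (v := id) g (Set.injOn_id _)
              (Finset.mem_insert_of_mem hy)
          rw [hs₀.2]
          rw [hs] at h1
          rw [degree_lt_iff_coeff_zero] at h1 ⊢
          intro m hm
          rcases hm.eq_or_lt with rfl | hm
          · exact h2
          · exact h1 m hm
        rw [← hI]
        exact (Lagrange.eval_interpolate_at_node (v := id) g (Set.injOn_id _)
          (Finset.mem_insert_self x s₀)).symm

end ReedSolomon

/-! ### The Heisenberg group: degree in the central direction -/

section LocalCode

variable {F : Type u} [Field F]

/-- Functions on the Heisenberg group that have degree at most `d` on the cosets of the first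
one-parameter subgroup. -/
def IsRowRS (d : ℕ) (f : F → F → F → F) : Prop :=
  ∀ b c, (fun a => f a b c) ∈ reedSolomon F d

/-- Functions on the Heisenberg group that have degree at most `d` on the cosets of the second
one-parameter subgroup. -/
def IsColRS (d : ℕ) (f : F → F → F → F) : Prop :=
  ∀ a e, (fun b => f a b (a * b + e)) ∈ reedSolomon F d

/-- The involution that exchanges the two one-parameter subgroups. -/
def flip₃ (f : F → F → F → F) : F → F → F → F :=
  fun a b c => f b a (a * b - c)

theorem flip₃_flip₃ (f : F → F → F → F) : flip₃ (flip₃ f) = f := by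
  funext a b c
  simp only [flip₃]
  congr 1
  ring

theorem IsColRS.flip {d : ℕ} {f : F → F → F → F} (h : IsColRS d f) : IsRowRS d (flip₃ f) := by
  intro b c
  have h1 := h b (-c)
  simpa only [flip₃, mul_comm b, ← sub_eq_add_neg] using h1

theorem IsRowRS.flip {d : ℕ} {f : F → F → F → F} (h : IsRowRS d f) : IsColRS d (flip₃ f) := by
  intro a e
  have h1 := h a (-e)
  have h2 : (fun b => flip₃ f a b (a * b + e)) = fun b => f b a (-e) := by
    funext b
    simp only [flip₃]
    congr 1
    ring
  rw [h2]
  exact h1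

/-- `X` and `X - 1` are coprime. Reducing `U` modulo `(X - 1) ^ v` makes the degree of `X ^ u * U`
at most `u + v - 1 ≤ s`, and the bound on `V` then follows from the identity. -/
theorem exists_bezout_X_pow {u v s k : ℕ} (huv : u + v ≤ s + 1) (hu : u ≤ s) (hv : v ≤ s)
    (hk : k ≤ s) : ∃ U V : F[X], X ^ k = X ^ u * U + (X - 1) ^ v * V ∧
      U.natDegree + u ≤ s ∧ V.natDegree + v ≤ s := by
  have hcop : IsCoprime (X ^ u : F[X]) ((X - 1) ^ v) := by
    apply IsCoprime.pow
    exact ⟨1, -1, by ring⟩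
  obtain ⟨a, b, hab⟩ := hcop
  have hmon : ((X - 1 : F[X]) ^ v).Monic := by
    have := monic_X_sub_C (1 : F)
    rw [C_1] at this
    exact this.pow v
  have hdeg : ((X - 1 : F[X]) ^ v).natDegree = v := by
    have := natDegree_X_sub_C (1 : F)
    rw [C_1] at this
    rw [natDegree_pow, this, mul_one]
  have hU : ((X ^ k * a) %ₘ (X - 1) ^ v).natDegree + u ≤ s := by
    rcases Nat.eq_zero_or_pos v with rfl | hv0
    · simpa using hu
    · have := natDegree_modByMonic_lt (X ^ k * a) hmon (fun h => by
        rw [h, natDegree_one] at hdeg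
        omega)
      rw [hdeg] at this
      omega
  have hid : (X ^ k : F[X]) = X ^ u * ((X ^ k * a) %ₘ (X - 1) ^ v) +
      (X - 1) ^ v * (X ^ k * b + X ^ u * ((X ^ k * a) /ₘ (X - 1) ^ v)) := by
    have := modByMonic_add_div (X ^ k * a) ((X - 1) ^ v)
    calc (X ^ k : F[X]) = X ^ k * (a * X ^ u + b * (X - 1) ^ v) := by rw [hab, mul_one]
      _ = X ^ u * (X ^ k * a) + (X - 1) ^ v * (X ^ k * b) := by ring
      _ = _ := by
        nth_rewrite 1 [← this]
        ring
  refine ⟨_, _, hid, hU, ?_⟩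
  set V := X ^ k * b + X ^ u * ((X ^ k * a) /ₘ (X - 1) ^ v)
  by_cases hV : V = 0
  · simpa [hV] using hv
  · have h1 : (X - 1) ^ v * V = X ^ k - X ^ u * ((X ^ k * a) %ₘ (X - 1) ^ v) :=
      eq_sub_of_add_eq' hid.symm
    have h2 := hmon.natDegree_mul' hV
    rw [hdeg, h1] at h2
    have h3 : (X ^ k - X ^ u * ((X ^ k * a) %ₘ (X - 1) ^ v)).natDegree ≤ s := by
      refine (natDegree_sub_le _ _).trans (max_le ?_ ?_)
      · simpa using hk
      · refine natDegree_mul_le.trans ?_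
        rw [natDegree_X_pow]
        omega
    omega

/-- The value at `(x, y)` of the homogenization of degree `n` of `P`. -/
noncomputable def homEval (P : F[X]) (n : ℕ) (x y : F) : F :=
  MvPolynomial.eval ![x, y] (P.homogenize n)

theorem homEval_eq_sum (P : F[X]) (n : ℕ) (x y : F) :
    homEval P n x y = ∑ ij ∈ Finset.HasAntidiagonal.antidiagonal n, P.coeff ij.1 * (x ^ ij.1 * y ^ ij.2) := by
  simp only [homEval, homogenize, map_sum, MvPolynomial.eval_monomial]
  refine Finset.sum_congr rfl fun ij _ => ?_
  rw [Finsupp.prod_fintype _ _ (by simp)]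
  simp [Fin.prod_univ_two]

theorem homEval_mul {P Q : F[X]} {m n : ℕ} (hP : P.natDegree ≤ m) (hQ : Q.natDegree ≤ n)
    (x y : F) : homEval (P * Q) (m + n) x y = homEval P m x y * homEval Q n x y := by
  rw [homEval, homogenize_mul P Q hP hQ, map_mul]
  rfl

theorem homEval_X_pow {m n : ℕ} (h : m ≤ n) (x y : F) :
    homEval (X ^ m : F[X]) n x y = x ^ m * y ^ (n - m) := by
  rw [homEval, homogenize_X_pow h]
  simp

theorem homEval_X_sub_one_pow (v : ℕ) (x y : F) :
    homEval ((X - 1) ^ v : F[X]) v x y = (x - y) ^ v := by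
  have h1 : (X - 1 : F[X]).natDegree ≤ 1 := by
    have := natDegree_X_sub_C_le (1 : F)
    rwa [C_1] at this
  induction v with
  | zero => simp [homEval]
  | succ v ih =>
    have h2 : ((X - 1 : F[X]) ^ v).natDegree ≤ v := by
      have := natDegree_pow_le_of_le v h1
      omega
    rw [pow_succ, homEval_mul h2 h1, ih, pow_succ]
    congr 1
    rw [homEval_eq_sum, Finset.Nat.antidiagonal_succ]
    simp [coeff_one, coeff_X]
    ring

/-- Meant for `x = c` and `y = a * b`: then `x` is constant on rows and `x - y` is constant on
columns, so each summand carries a power that costs no degree along one of the families. -/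
theorem exists_bezout_homEval {u v s k : ℕ} (huv : u + v ≤ s + 1) (hu : u ≤ s) (hv : v ≤ s)
    (hk : k ≤ s) : ∃ U V : F[X], ∀ x y : F, x ^ k * y ^ (s - k) =
      x ^ u * homEval U (s - u) x y + (x - y) ^ v * homEval V (s - v) x y := by
  obtain ⟨U, V, h, hU, hV⟩ := exists_bezout_X_pow (F := F) huv hu hv hk
  refine ⟨U, V, fun x y => ?_⟩
  have h1 : (X - 1 : F[X]).natDegree ≤ 1 := by
    have := natDegree_X_sub_C_le (1 : F)
    rwa [C_1] at this
  have h2 : ((X - 1 : F[X]) ^ v).natDegree ≤ v := by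
    have := natDegree_pow_le_of_le v h1
    omega
  have e1 := homEval_mul (P := X ^ u) (Q := U) (m := u) (n := s - u) (by simp) (by omega) x y
  have e2 := homEval_mul (P := (X - 1) ^ v) (Q := V) (m := v) (n := s - v) h2 (by omega) x y
  rw [homEval_X_pow le_rfl, Nat.sub_self, pow_zero, mul_one, Nat.add_sub_cancel' hu] at e1
  rw [homEval_X_sub_one_pow, Nat.add_sub_cancel' hv] at e2
  rw [← e1, ← e2, ← homEval_X_pow hk, h]
  simp only [homEval, homogenize_add, map_add]

theorem mul_pow_mem_reedSolomon {i j n : ℕ} (h : i + j ≤ n) (κ a e : F) :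
    (fun b => κ * ((a * b + e) ^ i * (a * b) ^ j)) ∈ reedSolomon F n := by
  refine mem_reedSolomon_iff.2 ⟨C κ * ((C a * X + C e) ^ i * (C a * X) ^ j), ?_, fun x => ?_⟩
  · refine (natDegree_C_mul_le _ _).trans (natDegree_mul_le.trans (le_trans ?_ h))
    have h1 : (C a * X + C e).natDegree ≤ 1 := natDegree_linear_le
    have h2 : (C a * X).natDegree ≤ 1 := (natDegree_C_mul_le _ _).trans natDegree_X_le
    have h3 := natDegree_pow_le_of_le i h1
    have h4 := natDegree_pow_le_of_le j h2
    omega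
  · simp

variable [Fintype F]

theorem IsRowRS.sum_eq_zero {D n : ℕ} {f w : F → F → F → F} (hf : IsRowRS D f)
    (hw : IsRowRS n w) (h : n + D + 2 ≤ Fintype.card F) :
    ∑ a, ∑ b, ∑ c, w a b c * f a b c = 0 := by
  rw [Finset.sum_comm]
  refine Finset.sum_eq_zero fun b _ => ?_
  rw [Finset.sum_comm]
  exact Finset.sum_eq_zero fun c _ =>
    sum_eq_zero_of_mem_reedSolomon (mul_mem_reedSolomon (hw b c) (hf b c)) h

theorem IsColRS.sum_eq_zero {D n : ℕ} {f w : F → F → F → F} (hf : IsColRS D f)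
    (hw : IsColRS n w) (h : n + D + 2 ≤ Fintype.card F) :
    ∑ a, ∑ b, ∑ c, w a b c * f a b c = 0 := by
  refine Finset.sum_eq_zero fun a _ => ?_
  have h1 : ∀ b, ∑ c, w a b c * f a b c =
      ∑ e, w a b (a * b + e) * f a b (a * b + e) := fun b =>
    (Equiv.sum_comp (Equiv.addLeft (a * b)) fun c => w a b c * f a b c).symm
  simp_rw [h1]
  rw [Finset.sum_comm]
  exact Finset.sum_eq_zero fun e _ =>
    sum_eq_zero_of_mem_reedSolomon (mul_mem_reedSolomon (hw a e) (hf a e)) h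

/-- The moment at `a = b = 0` is the pairing of `f` with `(1 - a ^ (q - 1)) * (1 - b ^ (q - 1)) * c
^ k`. Expanded, this weight is a sum of terms of low degree on rows or on columns, except for `(a *
b) ^ (q - 1) * c ^ k`, and that one is split by the Bézout identity. Every resulting piece is
annihilated by the row or by the column condition. -/
theorem sum_pow_mul_center_eq_zero {D₁ D₂ k : ℕ} {f : F → F → F → F} (h₁ : IsRowRS D₁ f)
    (h₂ : IsColRS D₂ f) (hk : k + (D₁ + D₂) + 2 ≤ Fintype.card F) :
    ∑ c, c ^ k * f 0 0 c = 0 := by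
  classical
  set q := Fintype.card F with hq
  have hδ : ∀ x : F, (1 - x ^ (q - 1) : F) = if x = 0 then 1 else 0 := by
    intro x
    split_ifs with h
    · rw [h, zero_pow (by omega), sub_zero]
    · rw [FiniteField.pow_card_sub_one_eq_one x h, sub_self]
  have h0 : ∑ c, c ^ k * f 0 0 c =
      ∑ a, ∑ b, ∑ c, ((1 - a ^ (q - 1)) * (1 - b ^ (q - 1)) * c ^ k) * f a b c := by
    simp_rw [hδ]
    symm
    rw [Finset.sum_eq_single_of_mem (0 : F) (Finset.mem_univ _) (fun a _ ha => by simp [ha]),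
      Finset.sum_eq_single_of_mem (0 : F) (Finset.mem_univ _) (fun b _ hb => by simp [hb])]
    simp
  -- The cofactors have degrees `q - 2 - D₁` and `q - 2 - D₂`, the largest allowed against `f` on
  -- rows and columns. The requirement `u + v ≤ s + 1` is exactly the hypothesis on `k`.
  obtain ⟨U, V, hUV⟩ := exists_bezout_homEval (F := F) (u := k + D₁ + 1) (v := k + D₂ + 1)
    (s := q - 1 + k) (k := k) (by omega) (by omega) (by omega) (by omega)
  have hsplit : ∀ a b c : F, ((1 - a ^ (q - 1)) * (1 - b ^ (q - 1)) * c ^ k) * f a b c =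
      ((1 - b ^ (q - 1)) * c ^ k) * f a b c - a ^ (q - 1) * c ^ k * f a b c +
      (c ^ (k + D₁ + 1) * homEval U (q - 1 + k - (k + D₁ + 1)) c (a * b)) * f a b c +
      ((c - a * b) ^ (k + D₂ + 1) * homEval V (q - 1 + k - (k + D₂ + 1)) c (a * b))
        * f a b c := by
    intro a b c
    have h1 := hUV c (a * b)
    rw [Nat.add_sub_cancel] at h1
    linear_combination (f a b c) * h1 - (c ^ k * f a b c) * (mul_pow a b (q - 1))
  rw [h0]
  simp_rw [hsplit, Finset.sum_add_distrib, Finset.sum_sub_distrib]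
  rw [h₁.sum_eq_zero (w := fun a b c => (1 - b ^ (q - 1)) * c ^ k) (n := 0),
    h₂.sum_eq_zero (w := fun a b c => a ^ (q - 1) * c ^ k) (n := k),
    h₁.sum_eq_zero (w := fun a b c =>
      c ^ (k + D₁ + 1) * homEval U (q - 1 + k - (k + D₁ + 1)) c (a * b)) (n := q - 2 - D₁),
    h₂.sum_eq_zero (w := fun a b c => (c - a * b) ^ (k + D₂ + 1) *
      homEval V (q - 1 + k - (k + D₂ + 1)) c (a * b)) (n := q - 2 - D₂)]
  · simp
  · intro a e
    simp_rw [add_sub_cancel_left, homEval_eq_sum, Finset.mul_sum]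
    have : (fun b => ∑ ij ∈ Finset.HasAntidiagonal.antidiagonal (q - 1 + k - (k + D₂ + 1)),
        e ^ (k + D₂ + 1) * (V.coeff ij.1 * ((a * b + e) ^ ij.1 * (a * b) ^ ij.2))) =
        ∑ ij ∈ Finset.HasAntidiagonal.antidiagonal (q - 1 + k - (k + D₂ + 1)), fun b =>
        (e ^ (k + D₂ + 1) * V.coeff ij.1) * ((a * b + e) ^ ij.1 * (a * b) ^ ij.2) := by
      funext b
      rw [Finset.sum_apply]
      refine Finset.sum_congr rfl fun ij _ => ?_
      ring
    rw [this]
    refine sum_mem fun ij hij => mul_pow_mem_reedSolomon ?_ _ _ _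
    rw [Finset.HasAntidiagonal.mem_antidiagonal] at hij
    omega
  · omega
  · intro b c
    simp_rw [homEval_eq_sum, Finset.mul_sum]
    have : (fun a => ∑ ij ∈ Finset.HasAntidiagonal.antidiagonal (q - 1 + k - (k + D₁ + 1)),
        c ^ (k + D₁ + 1) * (U.coeff ij.1 * (c ^ ij.1 * (a * b) ^ ij.2))) =
        ∑ ij ∈ Finset.HasAntidiagonal.antidiagonal (q - 1 + k - (k + D₁ + 1)), fun a =>
        (c ^ (k + D₁ + 1) * (U.coeff ij.1 * c ^ ij.1)) *
          ((b * a + 0) ^ 0 * (b * a) ^ ij.2) := by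
      funext a
      rw [Finset.sum_apply]
      refine Finset.sum_congr rfl fun ij _ => ?_
      rw [mul_comm a b]
      ring
    rw [this]
    refine sum_mem fun ij hij => mul_pow_mem_reedSolomon ?_ _ _ _
    rw [Finset.HasAntidiagonal.mem_antidiagonal] at hij
    omega
  · omega
  · intro a e
    have := mul_pow_mem_reedSolomon (i := k) (j := 0) (n := k) (by simp) (a ^ (q - 1)) a e
    simpa using this
  · omega
  · intro b c
    have := mul_pow_mem_reedSolomon (i := 0) (j := 0) (n := 0) (by simp)
      ((1 - b ^ (q - 1)) * c ^ k) 0 0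
    simpa using this
  · omega

/-- Low degree along both families of lines implies low degree in the central direction. -/
theorem center_mem_reedSolomon {D₁ D₂ : ℕ} {f : F → F → F → F} (h₁ : IsRowRS D₁ f)
    (h₂ : IsColRS D₂ f) (a b : F) : (fun c => f a b c) ∈ reedSolomon F (D₁ + D₂) := by
  refine mem_reedSolomon_of_moments fun k hk => ?_
  -- A left translation of the Heisenberg group moves the central line over `(a, b)` to the origin
  -- and preserves both families.
  have := sum_pow_mul_center_eq_zero (f := fun a' b' c' => f (a + a') (b + b') (c' + a * b'))
    (D₁ := D₁) (D₂ := D₂) (k := k) (fun b' c' => ?_) (fun a' e' => ?_) hk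
  · simpa using this
  · exact comp_add_mem_reedSolomon (h₁ _ _) a
  · have := comp_add_mem_reedSolomon (h₂ (a + a') (e' - (a + a') * b)) b
    convert this using 3
    ring

end LocalCode

/-! ### Degree filtrations of algebras -/

section Filtration

variable {F : Type u} [Field F]

/-- An exhaustive-type multiplicative filtration of an algebra by subspaces, as given by a
notion of degree. -/
structure DegreeFiltration (F : Type u) [Field F] (S : Type*) [CommRing S] [Algebra F S] where
  W : ℕ → Submodule F S
  mono : Monotone W
  one_mem : (1 : S) ∈ W 0
  mul_mem : ∀ {m n : ℕ} {x y : S}, x ∈ W m → y ∈ W n → x * y ∈ W (m + n)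

namespace DegreeFiltration

variable {S : Type*} [CommRing S] [Algebra F S] (φ : DegreeFiltration F S)

theorem algebraMap_mem (x : F) : algebraMap F S x ∈ φ.W 0 := by
  rw [Algebra.algebraMap_eq_smul_one]
  exact (φ.W 0).smul_mem _ φ.one_mem

theorem pow_mem {m : ℕ} {x : S} (hx : x ∈ φ.W m) (i : ℕ) : x ^ i ∈ φ.W (i * m) := by
  induction i with
  | zero => simpa using φ.one_mem
  | succ i ih =>
    rw [pow_succ, add_mul, one_mul]
    exact φ.mul_mem ih hx

/-- The filtration of polynomials by degree. -/
noncomputable def degree (F : Type u) [Field F] (R : Type*) [CommRing R] [Algebra F R] :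
    DegreeFiltration F R[X] where
  W n :=
    { carrier := {P | P.natDegree ≤ n}
      add_mem' := fun {P Q} hP hQ => natDegree_add_le_of_degree_le hP hQ
      zero_mem' := by simp
      smul_mem' := fun x P hP => (natDegree_smul_le x P).trans hP }
  mono := fun _ _ h _ hP => le_trans (show natDegree _ ≤ _ from hP) h
  one_mem := by
    show natDegree 1 ≤ 0
    simp
  mul_mem := fun hP hQ => natDegree_mul_le_of_le hP hQ

theorem mem_degree {R : Type*} [CommRing R] [Algebra F R] {n : ℕ} {P : R[X]} :
    P ∈ (degree F R).W n ↔ P.natDegree ≤ n :=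
  Iff.rfl

/-- The filtration of polynomials induced by a filtration of the coefficient ring. -/
noncomputable def coeffs : DegreeFiltration F S[X] where
  W n :=
    { carrier := {P | ∀ i, P.coeff i ∈ φ.W n}
      add_mem' := fun {P Q} hP hQ i => by
        rw [coeff_add]
        exact add_mem (hP i) (hQ i)
      zero_mem' := fun i => by
        rw [coeff_zero]
        exact zero_mem _
      smul_mem' := fun x P hP i => by
        rw [coeff_smul]
        exact Submodule.smul_mem _ _ (hP i) }
  mono := fun _ _ h _ hP i => φ.mono h (hP i)
  one_mem := fun i => by
    rw [coeff_one]
    split_ifs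
    · exact φ.one_mem
    · exact zero_mem _
  mul_mem := fun {m n P Q} hP hQ i => by
    rw [coeff_mul]
    exact sum_mem fun x _ => φ.mul_mem (hP _) (hQ _)

theorem eval₂_mem {R : Type*} [CommRing R] (g : R →+* S) {x : S} {p m n : ℕ} (hx : x ∈ φ.W p)
    {P : R[X]} (hP : P.natDegree ≤ n) (hc : ∀ i, g (P.coeff i) ∈ φ.W m) :
    P.eval₂ g x ∈ φ.W (m + n * p) := by
  rw [eval₂_eq_sum_range' g (Nat.lt_succ_of_le hP)]
  refine sum_mem fun i hi => φ.mul_mem (hc i) (φ.mono ?_ (φ.pow_mem hx i))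
  rw [Finset.mem_range] at hi
  exact Nat.mul_le_mul_right _ (by omega)

end DegreeFiltration

end Filtration

/-! ### Polynomials in three variables and their partial degrees -/

section ThreeVariables

variable {F : Type u} [Field F] {S T : Type*} [CommRing S] [Algebra F S] [CommRing T]
  [Algebra F T]

/-- The value of a polynomial in `F[b][c][a]` at given elements of an algebra. -/
noncomputable def subst (x y z : S) : F[X][X][X] →ₐ[F] S where
  toRingHom := eval₂RingHom (eval₂RingHom (eval₂RingHom (algebraMap F S) y) z) x
  commutes' := fun r => by
    simp [Polynomial.algebraMap_apply]

/-- The variable `a` is outermost, so `natDegree` is the degree along rows and the leading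
coefficient is a polynomial in `c` over `F[b]`. -/
noncomputable def va (F : Type u) [Field F] : F[X][X][X] := X

noncomputable def vb (F : Type u) [Field F] : F[X][X][X] := C (C X)

noncomputable def vc (F : Type u) [Field F] : F[X][X][X] := C X

theorem subst_apply (x y z : S) (P : F[X][X][X]) :
    subst x y z P = P.eval₂ (eval₂RingHom (eval₂RingHom (algebraMap F S) y) z) x := rfl

@[simp]
theorem subst_va (x y z : S) : subst x y z (va F) = x := by simp [subst_apply, va]

@[simp]
theorem subst_vb (x y z : S) : subst x y z (vb F) = y := by simp [subst_apply, vb]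

@[simp]
theorem subst_vc (x y z : S) : subst x y z (vc F) = z := by simp [subst_apply, vc]

theorem algHom_ext₃ {φ ψ : F[X][X][X] →ₐ[F] S} (ha : φ (va F) = ψ (va F))
    (hb : φ (vb F) = ψ (vb F)) (hc : φ (vc F) = ψ (vc F)) : φ = ψ := by
  have h : (φ : F[X][X][X] →+* S) = ψ := by
    refine Polynomial.ringHom_ext' (Polynomial.ringHom_ext' (Polynomial.ringHom_ext' ?_ hb) hc) ha
    ext r
    have h1 := φ.commutes r
    have h2 := ψ.commutes r
    rw [Polynomial.algebraMap_apply, Polynomial.algebraMap_apply, Polynomial.algebraMap_apply] at h1 h2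
    exact h1.trans h2.symm
  exact AlgHom.ext fun x => congrArg (fun f : F[X][X][X] →+* S => f x) h

theorem map_subst (φ : S →ₐ[F] T) (x y z : S) (P : F[X][X][X]) :
    φ (subst x y z P) = subst (φ x) (φ y) (φ z) P := by
  have : φ.comp (subst x y z) = subst (φ x) (φ y) (φ z) := by
    apply algHom_ext₃ <;> simp only [AlgHom.comp_apply, subst_va, subst_vb, subst_vc]
  exact congrArg (fun f : F[X][X][X] →ₐ[F] T => f P) this

theorem subst_subst (x y z : S) (x' y' z' P : F[X][X][X]) :
    subst x y z (subst x' y' z' P) =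
      subst (subst x y z x') (subst x y z y') (subst x y z z') P :=
  map_subst (subst x y z) x' y' z' P

theorem subst_id (P : F[X][X][X]) : subst (va F) (vb F) (vc F) P = P := by
  have : subst (va F) (vb F) (vc F) = AlgHom.id F F[X][X][X] :=
    algHom_ext₃ (subst_va _ _ _) (subst_vb _ _ _) (subst_vc _ _ _)
  exact congrArg (fun f : F[X][X][X] →ₐ[F] F[X][X][X] => f P) this

/-- The involution of `F[a, b, c]` that exchanges the two families of lines. -/
noncomputable def swap₃ : F[X][X][X] →ₐ[F] F[X][X][X] :=
  subst (vb F) (va F) (va F * vb F - vc F)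

theorem subst_swap₃ (x y z : S) (P : F[X][X][X]) :
    subst x y z (swap₃ P) = subst y x (x * y - z) P := by
  rw [swap₃, subst_subst, map_sub (subst x y z), map_mul (subst x y z), subst_va, subst_vb, subst_vc]

theorem swap₃_swap₃ (P : F[X][X][X]) : swap₃ (swap₃ P) = P := by
  refine (subst_swap₃ _ _ _ P).trans ?_
  rw [mul_comm (vb F), sub_sub_cancel, subst_id]

noncomputable abbrev aFilt (F : Type u) [Field F] : DegreeFiltration F F[X][X][X] :=
  .degree F F[X][X]

noncomputable abbrev cFilt (F : Type u) [Field F] : DegreeFiltration F F[X][X][X] :=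
  (DegreeFiltration.degree F F[X]).coeffs

noncomputable abbrev bFilt (F : Type u) [Field F] : DegreeFiltration F F[X][X][X] :=
  (DegreeFiltration.degree F F).coeffs.coeffs

theorem mem_aFilt {n : ℕ} {P : F[X][X][X]} : P ∈ (aFilt F).W n ↔ P.natDegree ≤ n := Iff.rfl

/-- Degree bound for a substitution. -/
theorem subst_mem (φ : DegreeFiltration F S) {x y z : S} {p r s i j k : ℕ} (hx : x ∈ φ.W p)
    (hy : y ∈ φ.W r) (hz : z ∈ φ.W s) {P : F[X][X][X]} (ha : P ∈ (aFilt F).W i)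
    (hb : P ∈ (bFilt F).W j) (hc : P ∈ (cFilt F).W k) :
    subst x y z P ∈ φ.W (j * r + k * s + i * p) := by
  rw [subst_apply]
  refine φ.eval₂_mem _ hx ha fun i' => ?_
  rw [coe_eval₂RingHom]
  refine φ.eval₂_mem _ hz (hc i') fun k' => ?_
  rw [coe_eval₂RingHom]
  have := φ.eval₂_mem (algebraMap F S) hy (hb i' k') (m := 0) fun j' => φ.algebraMap_mem _
  rwa [zero_add] at this

theorem va_mem_aFilt : va F ∈ (aFilt F).W 1 := natDegree_X_le

theorem vb_mem_aFilt : vb F ∈ (aFilt F).W 0 := (natDegree_C _).le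

theorem vc_mem_aFilt : vc F ∈ (aFilt F).W 0 := (natDegree_C _).le

theorem va_mem_cFilt : va F ∈ (cFilt F).W 0 := fun i => by
  rw [va, coeff_X]
  split_ifs <;> simp [DegreeFiltration.mem_degree]

theorem vb_mem_cFilt : vb F ∈ (cFilt F).W 0 := fun i => by
  rw [vb, coeff_C]
  split_ifs <;> simp [DegreeFiltration.mem_degree]

theorem vc_mem_cFilt : vc F ∈ (cFilt F).W 1 := fun i => by
  rw [vc, coeff_C]
  split_ifs <;> simp [DegreeFiltration.mem_degree]

theorem va_mem_bFilt : va F ∈ (bFilt F).W 0 := fun i k => by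
  rw [va, coeff_X]
  split_ifs <;> simp [DegreeFiltration.mem_degree, coeff_one, apply_ite natDegree]

theorem vb_mem_bFilt : vb F ∈ (bFilt F).W 1 := fun i k => by
  rw [vb, coeff_C]
  split_ifs <;> simp [DegreeFiltration.mem_degree, coeff_C, apply_ite natDegree]
  split_ifs <;> simp

theorem vc_mem_bFilt : vc F ∈ (bFilt F).W 0 := fun i k => by
  rw [vc, coeff_C]
  split_ifs <;> simp [DegreeFiltration.mem_degree, coeff_X, apply_ite natDegree]

/-- The polynomial `p(a) r(b) s(c)`. -/
noncomputable def tensor₃ (p r s : F[X]) : F[X][X][X] :=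
  aeval (va F) p * aeval (vb F) r * aeval (vc F) s

theorem subst_tensor₃ (x y z : S) (p r s : F[X]) :
    subst x y z (tensor₃ p r s) = aeval x p * aeval y r * aeval z s := by
  rw [tensor₃, map_mul, map_mul, ← aeval_algHom_apply, ← aeval_algHom_apply,
    ← aeval_algHom_apply, subst_va, subst_vb, subst_vc]

theorem aeval_mem (φ : DegreeFiltration F S) {x : S} {p n : ℕ} (hx : x ∈ φ.W p) {P : F[X]}
    (hP : P.natDegree ≤ n) : aeval x P ∈ φ.W (n * p) := by
  have := φ.eval₂_mem (algebraMap F S) hx hP (m := 0) fun i => φ.algebraMap_mem _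
  rwa [zero_add] at this

theorem tensor₃_mem {p r s : F[X]} {i j k : ℕ} (hp : p.natDegree ≤ i) (hr : r.natDegree ≤ j)
    (hs : s.natDegree ≤ k) : tensor₃ p r s ∈ (aFilt F).W i ∧ tensor₃ p r s ∈ (bFilt F).W j ∧
      tensor₃ p r s ∈ (cFilt F).W k := by
  refine ⟨?_, ?_, ?_⟩
  · have := (aFilt F).mul_mem ((aFilt F).mul_mem (aeval_mem _ va_mem_aFilt hp)
      (aeval_mem _ vb_mem_aFilt hr)) (aeval_mem _ vc_mem_aFilt hs)
    simpa [tensor₃] using this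
  · have := (bFilt F).mul_mem ((bFilt F).mul_mem (aeval_mem _ va_mem_bFilt hp)
      (aeval_mem _ vb_mem_bFilt hr)) (aeval_mem _ vc_mem_bFilt hs)
    simpa [tensor₃] using this
  · have := (cFilt F).mul_mem ((cFilt F).mul_mem (aeval_mem _ va_mem_cFilt hp)
      (aeval_mem _ vb_mem_cFilt hr)) (aeval_mem _ vc_mem_cFilt hs)
    simpa [tensor₃] using this

variable [Fintype F]

theorem eq_zero_of_eval_eq_zero {p : F[X]} (hp : p.natDegree < Fintype.card F)
    (h : ∀ x, p.eval x = 0) : p = 0 := by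
  by_contra hp0
  have h1 : (Finset.univ : Finset F).val ≤ p.roots := by
    rw [Multiset.le_iff_subset Finset.univ.nodup]
    intro x _
    exact (mem_roots hp0).2 (h x)
  have h2 := (Multiset.card_le_card h1).trans (card_roots' p)
  rw [Finset.card_val, Finset.card_univ] at h2
  omega

theorem eq_zero_of_subst_eq_zero {P : F[X][X][X]} {i j k : ℕ} (ha : P ∈ (aFilt F).W i)
    (hb : P ∈ (bFilt F).W j) (hc : P ∈ (cFilt F).W k) (hi : i < Fintype.card F)
    (hj : j < Fintype.card F) (hk : k < Fintype.card F)
    (h : ∀ x y z : F, subst x y z P = 0) : P = 0 := by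
  have key : ∀ (i' k' : ℕ) , (P.coeff i').coeff k' = 0 := by
    intro i' k'
    refine eq_zero_of_eval_eq_zero ((hb i' k').trans_lt hj) fun y => ?_
    have h2 : ((P.coeff i').map (evalRingHom y)) = 0 := by
      refine eq_zero_of_eval_eq_zero ((natDegree_map_le.trans (hc i')).trans_lt hk) fun z => ?_
      have h3 : P.map ((evalRingHom z).comp (mapRingHom (evalRingHom y))) = 0 := by
        refine eq_zero_of_eval_eq_zero ((natDegree_map_le.trans ha).trans_lt hi) fun x => ?_
        rw [← h x y z, subst_apply, eval_map]
        congr 1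
        ext <;> simp
      have h4 := congrArg (fun p : F[X] => p.coeff i') h3
      simpa using h4
    have h5 := congrArg (fun p : F[X] => p.coeff k') h2
    simpa using h5
  ext i' k' : 2
  simpa using key i' k'

/-- Nodes and basis polynomials are independent of `g`, so the formula can be applied in one
variable with the others as parameters. -/
theorem exists_interpolation_nodes {n : ℕ} (hn : n < Fintype.card F) :
    ∃ (s : Finset F) (p : F → F[X]), (∀ y, y ∈ s → (p y).natDegree ≤ n) ∧
      ∀ g ∈ reedSolomon F n, ∀ x, g x = ∑ y ∈ s, (p y).eval x * g y := by
  classical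
  obtain ⟨s, hs⟩ := Finset.exists_subset_card_eq (s := (Finset.univ : Finset F))
    (n := n + 1) (by rw [Finset.card_univ]; omega)
  refine ⟨s, Lagrange.basis s id, fun y hy => ?_, fun g hg x => ?_⟩
  · rw [Lagrange.natDegree_basis (Set.injOn_id _) hy, hs.2, Nat.add_sub_cancel]
  · obtain ⟨P, hP, hg⟩ := mem_reedSolomon_iff.1 hg
    have := Lagrange.eq_interpolate (s := s) (v := id) (f := P) (Set.injOn_id _) (by
      rw [hs.2]
      exact (degree_le_of_natDegree_le hP).trans_lt (by exact_mod_cast Nat.lt_succ_self n))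
    rw [hg x, this, Lagrange.interpolate_apply, eval_finsetSum]
    refine Finset.sum_congr rfl fun y _ => ?_
    rw [eval_mul, eval_C, hg y, mul_comm]
    rfl

theorem exists_polynomial_of_degrees {n₁ n₂ n₃ : ℕ} (h₁ : n₁ < Fintype.card F)
    (h₂ : n₂ < Fintype.card F) (h₃ : n₃ < Fintype.card F) {f : F → F → F → F}
    (ha : ∀ b c, (fun a => f a b c) ∈ reedSolomon F n₁)
    (hb : ∀ a c, (fun b => f a b c) ∈ reedSolomon F n₂)
    (hc : ∀ a b, (fun c => f a b c) ∈ reedSolomon F n₃) :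
    ∃ P : F[X][X][X], P ∈ (aFilt F).W n₁ ∧ P ∈ (bFilt F).W n₂ ∧ P ∈ (cFilt F).W n₃ ∧
      ∀ a b c : F, subst a b c P = f a b c := by
  obtain ⟨s₁, p₁, hp₁, e₁⟩ := exists_interpolation_nodes h₁
  obtain ⟨s₂, p₂, hp₂, e₂⟩ := exists_interpolation_nodes h₂
  obtain ⟨s₃, p₃, hp₃, e₃⟩ := exists_interpolation_nodes h₃
  have hmem := fun (y₁ : F) (h1 : y₁ ∈ s₁) (y₂ : F) (h2 : y₂ ∈ s₂) (y₃ : F) (h3 : y₃ ∈ s₃) =>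
    tensor₃_mem (hp₁ y₁ h1) (hp₂ y₂ h2) (hp₃ y₃ h3)
  refine ⟨∑ y₁ ∈ s₁, ∑ y₂ ∈ s₂, ∑ y₃ ∈ s₃, f y₁ y₂ y₃ • tensor₃ (p₁ y₁) (p₂ y₂) (p₃ y₃),
    ?_, ?_, ?_, fun a b c => ?_⟩
  · exact sum_mem fun y₁ h1 => sum_mem fun y₂ h2 => sum_mem fun y₃ h3 =>
      Submodule.smul_mem _ _ (hmem y₁ h1 y₂ h2 y₃ h3).1
  · exact sum_mem fun y₁ h1 => sum_mem fun y₂ h2 => sum_mem fun y₃ h3 =>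
      Submodule.smul_mem _ _ (hmem y₁ h1 y₂ h2 y₃ h3).2.1
  · exact sum_mem fun y₁ h1 => sum_mem fun y₂ h2 => sum_mem fun y₃ h3 =>
      Submodule.smul_mem _ _ (hmem y₁ h1 y₂ h2 y₃ h3).2.2
  · simp only [map_sum, map_smul, subst_tensor₃, coe_aeval_eq_eval, smul_eq_mul]
    rw [e₁ _ (ha b c) a]
    refine Finset.sum_congr rfl fun y₁ _ => ?_
    rw [e₂ _ (hb y₁ c) b, Finset.mul_sum]
    refine Finset.sum_congr rfl fun y₂ _ => ?_
    rw [e₃ _ (hc y₁ y₂) c, Finset.mul_sum, Finset.mul_sum]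
    refine Finset.sum_congr rfl fun y₃ _ => ?_
    ring

end ThreeVariables

/-! ### Functions of low degree on rows and columns are polynomials -/

section Structure

variable {F : Type u} [Field F] [Fintype F]

/-- Interpolating in the second variable writes the function as a sum of `p y (c - a * b) * g b y`,
with factors of degrees at most `m` and `n` in `b`. -/
theorem mem_reedSolomon_of_sheared {n m : ℕ} (hm : m < Fintype.card F) {g : F → F → F}
    (hn : ∀ e, (fun b => g b e) ∈ reedSolomon F n) (he : ∀ b, (fun e => g b e) ∈ reedSolomon F m)
    (a c : F) : (fun b => g b (c - a * b)) ∈ reedSolomon F (m + n) := by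
  obtain ⟨s, p, hp, h⟩ := exists_interpolation_nodes hm
  have h1 : (fun b => g b (c - a * b)) =
      ∑ y ∈ s, fun b => (p y).eval (c - a * b) * g b y := by
    funext b
    rw [Finset.sum_apply, h _ (he b)]
  rw [h1]
  refine sum_mem fun y hy => mul_mem_reedSolomon ?_ (hn y)
  refine mem_reedSolomon_iff.2 ⟨(p y).comp (C c - C a * X), ?_, fun x => ?_⟩
  · refine natDegree_comp_le.trans ?_
    have h2 : (C c - C a * X).natDegree ≤ 1 := by
      refine (natDegree_sub_le _ _).trans (max_le (by simp) ?_)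
      exact (natDegree_C_mul_le _ _).trans natDegree_X_le
    calc (p y).natDegree * (C c - C a * X).natDegree ≤ m * 1 := Nat.mul_le_mul (hp y hy) h2
      _ = m := mul_one m
  · simp [eval_comp]

/-- Varying `b` with `c` fixed follows neither family. In the column coordinate `e = c - a * b` it
is a shear, which adds the central degree `D₁ + D₂` to the column degree `D₂`. -/
theorem transverse_mem_reedSolomon {D₁ D₂ : ℕ} {f : F → F → F → F} (h₁ : IsRowRS D₁ f)
    (h₂ : IsColRS D₂ f) (hD : D₁ + D₂ < Fintype.card F) (a c : F) :
    (fun b => f a b c) ∈ reedSolomon F (D₁ + D₂ + D₂) := by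
  have := mem_reedSolomon_of_sheared (g := fun b e => f a b (a * b + e)) hD (h₂ a) (fun b => ?_) a c
  · simpa using this
  · exact comp_add_mem_reedSolomon (center_mem_reedSolomon h₁ h₂ a b) (a * b)

theorem eq_of_specialize_eq {P Q : F[X][X][X]} {n : ℕ} (hP : P ∈ (bFilt F).W n)
    (hQ : Q ∈ (bFilt F).W n) (hn : n < Fintype.card F)
    (h : ∀ β : F, subst (va F) (algebraMap F _ β) (vc F) P =
      subst (va F) (algebraMap F _ β) (vc F) Q) : P = Q := by
  have key : ∀ (β : F) (R : F[X][X][X]), subst (va F) (algebraMap F _ β) (vc F) R =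
      R.map (mapRingHom (C.comp (evalRingHom β))) := by
    intro β R
    rw [subst_apply, Polynomial.map, va]
    congr 1
    ext <;> simp [vc, Polynomial.algebraMap_apply]
  rw [← sub_eq_zero]
  have hR := sub_mem hP hQ
  ext i k : 2
  rw [coeff_zero, coeff_zero]
  refine eq_zero_of_eval_eq_zero ((hR i k).trans_lt hn) fun β => ?_
  have h1 := h β
  rw [key, key] at h1
  have h2 := congrArg (fun R : F[X][X][X] => ((R.coeff i).coeff k).coeff 0) h1
  simp only [coeff_map, coe_mapRingHom, RingHom.comp_apply, coe_evalRingHom, coeff_C_zero] at h2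
  rw [coeff_sub, coeff_sub, eval_sub, h2, sub_self]

/-- A function of low degree along both families of lines is a polynomial that has low degree
along both families of lines over every extension. -/
theorem exists_polynomial_of_isRowRS_of_isColRS {D₁ D₂ : ℕ} {f : F → F → F → F}
    (h₁ : IsRowRS D₁ f) (h₂ : IsColRS D₂ f) (hD₁ : D₁ + D₂ + D₁ < Fintype.card F)
    (hD₂ : D₁ + D₂ + D₂ < Fintype.card F) :
    ∃ P : F[X][X][X], (∀ a b c : F, subst a b c P = f a b c) ∧ P.natDegree ≤ D₁ ∧
      (swap₃ P).natDegree ≤ D₂ ∧ P ∈ (cFilt F).W (D₁ + D₂) ∧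
      swap₃ P ∈ (cFilt F).W (D₁ + D₂) := by
  have hD : D₁ + D₂ < Fintype.card F := by omega
  obtain ⟨P, hPa, hPb, hPc, hP⟩ := exists_polynomial_of_degrees (by omega) hD₂ hD h₁
    (transverse_mem_reedSolomon h₁ h₂ hD) (center_mem_reedSolomon h₁ h₂)
  obtain ⟨Q, hQa, hQb, hQc, hQ⟩ := exists_polynomial_of_degrees (f := flip₃ f) (n₁ := D₂)
    (n₂ := D₁ + D₂ + D₁) (by omega) hD₁ hD h₂.flip
    (by
      have := transverse_mem_reedSolomon h₂.flip h₁.flip (by omega)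
      rwa [add_comm D₂ D₁] at this)
    (by
      have := center_mem_reedSolomon h₂.flip h₁.flip
      rwa [add_comm D₂ D₁] at this)
  have hβa : ∀ β : F, algebraMap F F[X][X][X] β ∈ (aFilt F).W 0 := (aFilt F).algebraMap_mem
  have hβb : ∀ β : F, algebraMap F F[X][X][X] β ∈ (bFilt F).W 0 := (bFilt F).algebraMap_mem
  have hβc : ∀ β : F, algebraMap F F[X][X][X] β ∈ (cFilt F).W 0 := (cFilt F).algebraMap_mem
  have hsheara : ∀ β : F, va F * algebraMap F _ β - vc F ∈ (aFilt F).W 1 := fun β =>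
    Submodule.sub_mem _ ((aFilt F).mono (by omega) ((aFilt F).mul_mem va_mem_aFilt (hβa β)))
      ((aFilt F).mono zero_le_one vc_mem_aFilt)
  have hshearb : ∀ β : F, va F * algebraMap F _ β - vc F ∈ (bFilt F).W 0 := fun β =>
    Submodule.sub_mem _ ((bFilt F).mono (by omega) ((bFilt F).mul_mem va_mem_bFilt (hβb β)))
      vc_mem_bFilt
  have hshearc : ∀ β : F, va F * algebraMap F _ β - vc F ∈ (cFilt F).W 1 := fun β =>
    Submodule.sub_mem _ ((cFilt F).mono (by omega) ((cFilt F).mul_mem va_mem_cFilt (hβc β)))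
      vc_mem_cFilt
  -- The bounds for `swap₃ P` itself may exceed `q`, so `P` and `Q` are compared after fixing one
  -- coordinate at a scalar. Then all degrees are below `q` and equal values force equal
  -- polynomials.
  have hβ : ∀ β : F, subst (algebraMap F _ β) (va F) (vc F) P =
      subst (va F) (algebraMap F _ β) (va F * algebraMap F _ β - vc F) Q := by
    intro β
    rw [← sub_eq_zero]
    refine eq_zero_of_subst_eq_zero (P := subst (algebraMap F _ β) (va F) (vc F) P -
      subst (va F) (algebraMap F _ β) (va F * algebraMap F _ β - vc F) Q)
      (i := D₁ + D₂ + D₂) (j := 0) (k := D₁ + D₂) ?_ ?_ ?_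
      hD₂ (by omega) hD fun x y z => ?_
    · refine Submodule.sub_mem _ ?_ ?_
      · have := subst_mem (aFilt F) (hβa β) va_mem_aFilt vc_mem_aFilt hPa hPb hPc
        exact (aFilt F).mono (by omega) this
      · have := subst_mem (aFilt F) va_mem_aFilt (hβa β) (hsheara β) hQa hQb hQc
        exact (aFilt F).mono (by omega) this
    · refine Submodule.sub_mem _ ?_ ?_
      · have := subst_mem (bFilt F) (hβb β) va_mem_bFilt vc_mem_bFilt hPa hPb hPc
        exact (bFilt F).mono (by omega) this
      · have := subst_mem (bFilt F) va_mem_bFilt (hβb β) (hshearb β) hQa hQb hQc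
        exact (bFilt F).mono (by omega) this
    · refine Submodule.sub_mem _ ?_ ?_
      · have := subst_mem (cFilt F) (hβc β) va_mem_cFilt vc_mem_cFilt hPa hPb hPc
        exact (cFilt F).mono (by omega) this
      · have := subst_mem (cFilt F) va_mem_cFilt (hβc β) (hshearc β) hQa hQb hQc
        exact (cFilt F).mono (by omega) this
    · rw [map_sub, subst_subst, subst_subst, map_sub, map_mul, subst_va, subst_vc,
        AlgHom.commutes, Algebra.algebraMap_self_apply, hP, hQ, flip₃, sub_sub_cancel, sub_self]
  have hswap : swap₃ P = Q := by
    refine eq_of_specialize_eq (n := D₁ + D₂ + D₁) ?_ hQb hD₁ fun β => ?_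
    · have := subst_mem (bFilt F) vb_mem_bFilt va_mem_bFilt
        (sub_mem ((bFilt F).mul_mem va_mem_bFilt vb_mem_bFilt)
          ((bFilt F).mono zero_le_one vc_mem_bFilt)) hPa hPb hPc
      exact (bFilt F).mono (by omega) this
    · rw [subst_swap₃]
      have := congrArg (subst (va F) (vb F) (va F * algebraMap F _ β - vc F)) (hβ β)
      rw [subst_subst, subst_subst, map_sub, map_mul, subst_va, subst_vc, AlgHom.commutes,
        sub_sub_cancel] at this
      exact this
  refine ⟨P, hP, mem_aFilt.1 hPa, ?_, hPc, ?_⟩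
  · rw [hswap]
    exact mem_aFilt.1 hQa
  · rw [hswap]
    exact hQc

end Structure

/-! ### The dimension count in two variables -/

section DimensionCount

variable {F : Type u} [Field F]

/-- The filtration of `F[s][a]` by the bound `deg (coeff k) ≤ n + k`. -/
noncomputable def trapezoid (F : Type u) [Field F] : DegreeFiltration F F[X][X] where
  W n :=
    { carrier := {P | ∀ k, (P.coeff k).natDegree ≤ n + k}
      add_mem' := fun {P Q} hP hQ k => by
        rw [coeff_add]
        exact natDegree_add_le_of_degree_le (hP k) (hQ k)
      zero_mem' := fun k => by simp
      smul_mem' := fun x P hP k => by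
        rw [coeff_smul]
        exact (natDegree_smul_le _ _).trans (hP k) }
  mono := fun m n h P hP k => (hP k).trans (by omega)
  one_mem := fun k => by
    rw [coeff_one]
    split_ifs <;> simp
  mul_mem := fun {m n P Q} hP hQ k => by
    rw [coeff_mul]
    refine natDegree_sum_le_of_forall_le _ _ fun x hx => ?_
    rw [Finset.HasAntidiagonal.mem_antidiagonal] at hx
    have h1 := hP x.1
    have h2 := hQ x.2
    exact (natDegree_mul_le_of_le h1 h2).trans (by omega)

/-- The polynomial in `F[s][a]` with given coefficients of bounded degrees. -/
noncomputable def ofCoeffs (m : ℕ) (ν : ℕ → ℕ) :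
    (∀ k : Fin m, degreeLT F (ν k)) →ₗ[F] F[X][X] :=
  ∑ k : Fin m, ((monomial (k : ℕ) : F[X] →ₗ[F[X]] F[X][X]).restrictScalars F) ∘ₗ
    (degreeLT F (ν k)).subtype ∘ₗ LinearMap.proj k

theorem coeff_ofCoeffs {m : ℕ} {ν : ℕ → ℕ} (x : ∀ k : Fin m, degreeLT F (ν k)) (j : ℕ) :
    (ofCoeffs m ν x).coeff j = if h : j < m then (x ⟨j, h⟩ : F[X]) else 0 := by
  simp only [ofCoeffs, LinearMap.sum_apply, LinearMap.comp_apply, LinearMap.proj_apply,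
    Submodule.subtype_apply, LinearMap.restrictScalars_apply, finsetSum_coeff, coeff_monomial]
  split_ifs with h
  · rw [Finset.sum_eq_single_of_mem (⟨j, h⟩ : Fin m) (Finset.mem_univ _)]
    · simp
    · intro k _ hk
      rw [if_neg]
      rintro rfl
      exact hk rfl
  · refine Finset.sum_eq_zero fun k _ => if_neg ?_
    rintro rfl
    exact h k.2

theorem ofCoeffs_injective {m : ℕ} {ν : ℕ → ℕ} {x : ∀ k : Fin m, degreeLT F (ν k)}
    (h : ofCoeffs m ν x = 0) : x = 0 := by
  funext k
  have := coeff_ofCoeffs x k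
  rw [h, coeff_zero, dif_pos k.2] at this
  exact Subtype.ext this.symm

theorem natDegree_ofCoeffs_lt {m : ℕ} (hm : 0 < m) {ν : ℕ → ℕ}
    (x : ∀ k : Fin m, degreeLT F (ν k)) : (ofCoeffs m ν x).natDegree < m := by
  refine lt_of_le_of_lt (b := m - 1) (natDegree_le_iff_coeff_eq_zero.2 fun k hk => ?_)
    (Nat.sub_lt hm one_pos)
  rw [coeff_ofCoeffs, dif_neg (by omega)]

/-- At each `z ∈ s`, `E` divides `Q`, hence also the remainder term `r`, whose degree is too small.
So `r` vanishes at all points of `s`, and its coefficients have degree below `s.card`, whence `r =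
0`. Coprimality then makes `E` divide `x`, which is again too small. -/
theorem ofCoeffs_eq_zero_of_relation {E Q : F[X][X]} (hrel : IsRelPrime E Q)
    (hα : 0 < E.natDegree) {s : Finset F} (hlc : ∀ x ∈ s, E.leadingCoeff.eval x ≠ 0)
    (hdvd : ∀ x ∈ s, E.map (evalRingHom x) ∣ Q.map (evalRingHom x)) {D : ℕ} {ν ν' : ℕ → ℕ}
    {x : ∀ k : Fin E.natDegree, degreeLT F (ν k)} {y : ∀ k : Fin D, degreeLT F (ν' k)}
    {r : ∀ k : Fin E.natDegree, degreeLT F s.card}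
    (h : Q * ofCoeffs _ ν x + E * ofCoeffs D ν' y + ofCoeffs _ (fun _ => s.card) r = 0) :
    x = 0 ∧ y = 0 ∧ r = 0 := by
  have hE0 : E ≠ 0 := by
    rintro rfl
    simp at hα
  have hr : r = 0 := by
    have h1 : ∀ z ∈ s, (ofCoeffs _ (fun _ => s.card) r).map (evalRingHom z) = 0 := by
      intro z hz
      have h2 := congrArg (Polynomial.map (evalRingHom z)) h
      simp only [Polynomial.map_add, Polynomial.map_mul, Polynomial.map_zero] at h2
      have h3 : E.map (evalRingHom z) ∣ (ofCoeffs _ (fun _ => s.card) r).map (evalRingHom z) := by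
        rw [eq_neg_of_add_eq_zero_right h2]
        exact (dvd_neg).2 (dvd_add ((hdvd z hz).mul_right _) (dvd_mul_right _ _))
      refine eq_zero_of_dvd_of_natDegree_lt h3 ?_
      have h4 := natDegree_map_of_leadingCoeff_ne_zero (p := E) (evalRingHom z)
        (by rw [coe_evalRingHom]; exact hlc z hz)
      rw [h4]
      exact natDegree_map_le.trans_lt (natDegree_ofCoeffs_lt (ν := fun _ => s.card) hα r)
    funext k
    refine Subtype.ext ?_
    refine Polynomial.eq_zero_of_degree_lt_of_eval_finset_eq_zero s
      (mem_degreeLT.1 (r k).2) fun z hz => ?_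
    have h5 := congrArg (fun p : F[X] => p.coeff k) (h1 z hz)
    simp only [coeff_map, coeff_ofCoeffs, dif_pos k.2, coeff_zero, coe_evalRingHom] at h5
    exact h5
  rw [hr, map_zero, add_zero] at h
  have hx : x = 0 := by
    apply ofCoeffs_injective
    have h1 : E ∣ Q * ofCoeffs _ ν x := by
      rw [eq_neg_of_add_eq_zero_left h]
      exact (dvd_neg).2 (dvd_mul_right _ _)
    exact eq_zero_of_dvd_of_natDegree_lt (hrel.dvd_of_dvd_mul_left h1)
      (natDegree_ofCoeffs_lt hα x)
  refine ⟨hx, ?_, hr⟩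
  apply ofCoeffs_injective
  rw [hx, map_zero, mul_zero, zero_add] at h
  exact (mul_eq_zero.1 h).resolve_left hE0

theorem natDegree_le_of_mem_degreeLT {n : ℕ} {p : F[X]} (hp : p ∈ degreeLT F (n + 1)) :
    p.natDegree ≤ n :=
  Nat.lt_succ_iff.1 (natDegree_lt_of_degree_lt_of_pos (Nat.succ_pos n) (mem_degreeLT.1 hp))

theorem ofCoeffs_mem_trapezoid {m n : ℕ} (x : ∀ k : Fin m, degreeLT F (n + k + 1)) :
    ofCoeffs m (fun k => n + k + 1) x ∈ (trapezoid F).W n := by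
  intro k
  rw [coeff_ofCoeffs]
  split_ifs with h
  · exact natDegree_le_of_mem_degreeLT (x ⟨k, h⟩).2
  · simp

theorem coeff_mul_ofCoeffs_eq_zero {m p : ℕ} {ν : ℕ → ℕ} {P : F[X][X]} (hP : P.natDegree ≤ p)
    (x : ∀ k : Fin m, degreeLT F (ν k)) {k : ℕ} (hk : p + m ≤ k) :
    (P * ofCoeffs m ν x).coeff k = 0 := by
  rw [coeff_mul]
  refine Finset.sum_eq_zero fun ij hij => ?_
  rw [Finset.HasAntidiagonal.mem_antidiagonal] at hij
  rcases lt_or_ge p ij.1 with h | h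
  · rw [coeff_eq_zero_of_natDegree_lt (hP.trans_lt h), zero_mul]
  · rw [coeff_ofCoeffs, dif_neg (by omega), mul_zero]

theorem finrank_degreeLT' (n : ℕ) : Module.finrank F (degreeLT F n) = n := by
  rw [(degreeLTEquiv F n).finrank_eq, Module.finrank_fin_fun]

/-- If `E` and `Q` are coprime polynomials in two variables and `E` divides `Q` on many lines
`s = const`, then the degree of `E` is small. -/
theorem card_mul_natDegree_le {E Q : F[X][X]} {β D : ℕ} (hrel : IsRelPrime E Q)
    (hE : E ∈ (trapezoid F).W β) (hQ : Q.natDegree ≤ D) (hQc : Q ∈ (trapezoid F).W D)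
    (s : Finset F) (hlc : ∀ x ∈ s, E.leadingCoeff.eval x ≠ 0)
    (hdvd : ∀ x ∈ s, E.map (evalRingHom x) ∣ Q.map (evalRingHom x)) :
    s.card * E.natDegree ≤ E.natDegree * D + D * (E.natDegree + β) := by
  classical
  set α := E.natDegree with hα
  rcases Nat.eq_zero_or_pos α with h0 | hα0
  · simp [h0]
  set n := s.card with hn
  set N := n + D + β with hN
  let Vx := ∀ k : Fin α, degreeLT F (n + β + k + 1)
  let Vy := ∀ k : Fin D, degreeLT F (n + D + k + 1)
  let Vr := ∀ k : Fin α, degreeLT F n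
  -- The coefficient bounds are such that `Q * x` and `E * y` both land at level `N` of the
  -- filtration with degree below `α + D`. That space exceeds the room for `x` and `y` by `α * D + D
  -- * (α + β)`, and by injectivity the `α * n` dimensions of `r` must fit there.
  let Ψ : (Vx × Vy × Vr) →ₗ[F] F[X][X] :=
    ((LinearMap.mulLeft F Q) ∘ₗ ofCoeffs α (fun k => n + β + k + 1)) ∘ₗ LinearMap.fst F _ _ +
    ((LinearMap.mulLeft F E) ∘ₗ ofCoeffs D (fun k => n + D + k + 1)) ∘ₗ
      (LinearMap.fst F _ _ ∘ₗ LinearMap.snd F _ _) +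
    ofCoeffs α (fun _ => n) ∘ₗ (LinearMap.snd F _ _ ∘ₗ LinearMap.snd F _ _)
  have hΨ : ∀ v : Vx × Vy × Vr, Ψ v = Q * ofCoeffs α (fun k => n + β + k + 1) v.1 +
      E * ofCoeffs D (fun k => n + D + k + 1) v.2.1 + ofCoeffs α (fun _ => n) v.2.2 :=
    fun v => rfl
  have hΨT : ∀ v, Ψ v ∈ (trapezoid F).W N := by
    intro v
    rw [hΨ]
    refine Submodule.add_mem _ (Submodule.add_mem _ ?_ ?_) ?_
    · exact (trapezoid F).mono (by omega)
        ((trapezoid F).mul_mem hQc (ofCoeffs_mem_trapezoid v.1))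
    · exact (trapezoid F).mono (by omega)
        ((trapezoid F).mul_mem hE (ofCoeffs_mem_trapezoid v.2.1))
    · intro k
      rw [coeff_ofCoeffs]
      split_ifs with h
      · have := degreeLT_mono (R := F) (Nat.le_succ n) (v.2.2 ⟨k, h⟩).2
        exact (natDegree_le_of_mem_degreeLT this).trans (by omega)
      · simp
  have hΨD : ∀ v k, α + D ≤ k → (Ψ v).coeff k = 0 := by
    intro v k hk
    rw [hΨ, coeff_add, coeff_add, coeff_mul_ofCoeffs_eq_zero hQ _ (by omega),
      coeff_mul_ofCoeffs_eq_zero le_rfl _ (by omega), coeff_ofCoeffs, dif_neg (by omega)]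
    simp
  let Θ : (Vx × Vy × Vr) →ₗ[F] ∀ k : Fin (α + D), degreeLT F (N + k + 1) :=
    LinearMap.pi fun k => LinearMap.codRestrict (degreeLT F (N + k + 1))
      (((lcoeff F[X] k).restrictScalars F) ∘ₗ Ψ) (fun v => by
        rw [mem_degreeLT]
        refine (degree_le_of_natDegree_le (hΨT v k)).trans_lt ?_
        exact_mod_cast Nat.lt_succ_self _)
  have hinj : Function.Injective Θ := by
    rw [← LinearMap.ker_eq_bot, LinearMap.ker_eq_bot']
    intro v hv
    have hv0 : Ψ v = 0 := by
      ext1 k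
      rw [coeff_zero]
      rcases lt_or_ge k (α + D) with h | h
      · have := congrArg Subtype.val (congrFun hv ⟨k, h⟩)
        exact this
      · exact hΨD v k h
    obtain ⟨hx, hy, hr⟩ := ofCoeffs_eq_zero_of_relation hrel hα0 hlc hdvd hv0
    exact Prod.ext hx (Prod.ext hy hr)
  have hfr := LinearMap.finrank_le_finrank_of_injective hinj
  simp only [Module.finrank_prod, Module.finrank_pi_fintype, finrank_degreeLT', Vx, Vy, Vr] at hfr
  rw [Fin.sum_univ_eq_sum_range (fun k => N + k + 1), Finset.sum_range_add,
    Fin.sum_univ_eq_sum_range (fun k => n + β + k + 1),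
    Fin.sum_univ_eq_sum_range (fun k => n + D + k + 1)] at hfr
  have e1 : ∑ k ∈ Finset.range α, (N + k + 1) =
      ∑ k ∈ Finset.range α, (n + β + k + 1) + α * D := by
    rw [Finset.sum_congr rfl fun k _ => show N + k + 1 = (n + β + k + 1) + D by omega,
      Finset.sum_add_distrib, Finset.sum_const, Finset.card_range, smul_eq_mul]
  have e2 : ∑ k ∈ Finset.range D, (N + (α + k) + 1) =
      ∑ k ∈ Finset.range D, (n + D + k + 1) + D * (α + β) := by
    rw [Finset.sum_congr rfl fun k _ =>
        show N + (α + k) + 1 = (n + D + k + 1) + (α + β) by omega,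
      Finset.sum_add_distrib, Finset.sum_const, Finset.card_range, smul_eq_mul]
  rw [e1, e2] at hfr
  simp only [Finset.sum_const, Finset.card_univ, Fintype.card_fin, smul_eq_mul] at hfr
  rw [mul_comm n]
  omega

end DimensionCount

/-! ### Resultants over a domain -/

section Resultant

variable {R : Type*} [CommRing R]

/-- A kernel vector of the Sylvester matrix is a relation `E * y + Q * x = 0` with `x` of degree
below that of `E`, and coprimality makes `E` divide `x`. The coefficients form only a domain because
`F[b][c]` is needed. -/
theorem resultant_ne_zero_of_isRelPrime [IsDomain R] [DecompositionMonoid R[X]] {E Q : R[X]}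
    (hrel : IsRelPrime E Q) (hα : 0 < E.natDegree) : resultant E Q ≠ 0 := by
  intro h0
  have hE0 : E ≠ 0 := by
    rintro rfl
    simp at hα
  rw [resultant, ← Matrix.exists_mulVec_eq_zero_iff] at h0
  obtain ⟨v, hv, hv0⟩ := h0
  let b₁ := ((degreeLT.basis R E.natDegree).prod (degreeLT.basis R Q.natDegree)).reindex
    finSumFinEquiv
  let x := b₁.equivFun.symm v
  have hx : x ≠ 0 := by
    simpa only [x, ne_eq, LinearEquiv.map_eq_zero_iff] using hv
  have hS : sylvesterMap E Q le_rfl le_rfl x = 0 := by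
    have h1 := LinearMap.toMatrix_mulVec_repr b₁ (degreeLT.basis R (E.natDegree + Q.natDegree))
      (sylvesterMap E Q le_rfl le_rfl) x
    rw [toMatrix_sylvesterMap'] at h1
    have h2 : ⇑(b₁.repr x) = v := b₁.equivFun.apply_symm_apply v
    rw [h2, hv0] at h1
    apply (degreeLT.basis R (E.natDegree + Q.natDegree)).repr.injective
    rw [map_zero]
    exact DFunLike.coe_injective h1.symm
  have h3 : E * (x.2 : R[X]) + Q * (x.1 : R[X]) = 0 := congrArg Subtype.val hS
  have h4 : (x.1 : R[X]) = 0 := by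
    have h5 : E ∣ Q * (x.1 : R[X]) := by
      rw [eq_neg_of_add_eq_zero_right h3]
      exact (dvd_neg).2 (dvd_mul_right _ _)
    refine eq_zero_of_dvd_of_degree_lt (hrel.dvd_of_dvd_mul_left h5) ?_
    rw [degree_eq_natDegree hE0]
    exact mem_degreeLT.1 x.1.2
  rw [h4, mul_zero, add_zero] at h3
  exact hx (Prod.ext (Subtype.ext h4) (Subtype.ext ((mul_eq_zero.1 h3).resolve_left hE0)))

/-- Each product in the expansion of the Sylvester determinant has one factor of degree at most `k`
per row. -/
theorem natDegree_resultant_le {E Q : R[X][X]} {k : ℕ} (hE : ∀ i, (E.coeff i).natDegree ≤ k)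
    (hQ : ∀ i, (Q.coeff i).natDegree ≤ k) :
    (resultant E Q).natDegree ≤ (E.natDegree + Q.natDegree) * k := by
  rw [resultant, Matrix.det_apply]
  refine natDegree_sum_le_of_forall_le _ _ fun σ _ => ?_
  rw [Units.smul_def, ← Int.cast_smul_eq_zsmul R]
  refine (natDegree_smul_le _ _).trans ((natDegree_prod_le _ _).trans ?_)
  refine (Finset.sum_le_card_nsmul _ _ k fun i _ => ?_).trans (by simp)
  rw [sylvester, Matrix.of_apply]
  induction i using Fin.addCases with
  | left j =>
    rw [Fin.addCases_left]
    split_ifs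
    · exact hQ _
    · simp
  | right j =>
    rw [Fin.addCases_right]
    split_ifs
    · exact hE _
    · simp

end Resultant

/-! ### Degrees in the inner variable -/

section InnerDegree

variable {R : Type*} [CommRing R]

theorem coeff_coeff_swap (P : R[X][X]) (i j : ℕ) :
    ((Bivariate.swap P).coeff i).coeff j = (P.coeff j).coeff i := by
  induction P using Polynomial.induction_on' with
  | add p q hp hq => simp only [map_add, coeff_add, hp, hq]
  | monomial n p =>
    induction p using Polynomial.induction_on' with
    | add p q hp hq => simp only [map_add, coeff_add, hp, hq]
    | monomial m r =>
      rw [Bivariate.swap_monomial_monomial]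
      simp only [coeff_monomial]
      by_cases h : m = i <;> by_cases h' : n = j <;> simp [h, h', coeff_monomial]

theorem natDegree_swap_le_iff {P : R[X][X]} {k : ℕ} :
    (Bivariate.swap P).natDegree ≤ k ↔ ∀ i, (P.coeff i).natDegree ≤ k := by
  simp only [natDegree_le_iff_coeff_eq_zero, Polynomial.ext_iff, coeff_coeff_swap, coeff_zero]
  exact ⟨fun h i n hn => h n hn i, fun h n hn i => h i n hn⟩

/-- The degree in the inner variable of a divisor. -/
theorem natDegree_coeff_le_of_dvd [IsDomain R] {P Q : R[X][X]} (h : P ∣ Q) (hQ : Q ≠ 0) {k : ℕ}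
    (hk : ∀ i, (Q.coeff i).natDegree ≤ k) (i : ℕ) : (P.coeff i).natDegree ≤ k := by
  refine natDegree_swap_le_iff.1 (le_trans ?_ (natDegree_swap_le_iff.2 hk)) i
  obtain ⟨T, rfl⟩ := h
  have h0 : Bivariate.swap (P * T) ≠ 0 := fun h => hQ (Bivariate.swap.injective (h.trans
    (map_zero Bivariate.swap).symm))
  rw [map_mul Bivariate.swap P T] at h0 ⊢
  rw [natDegree_mul (left_ne_zero_of_mul h0) (right_ne_zero_of_mul h0)]
  exact Nat.le_add_right _ _

end InnerDegree

/-! ### Restriction to planes through columns and to rows -/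

section Slices

variable {F : Type u} [Field F]

/-- The polynomial on the plane through a line of the second family. -/
noncomputable def slice (a e : F) (P : F[X][X][X]) : F[X][X] :=
  (P.map (evalRingHom (C a * X + C e))).comp (X + C (C a))

theorem slice_eq_subst (a e : F) (P : F[X][X][X]) :
    slice a e P = subst (X + C (C a) : F[X][X]) (C X) (C (C a * X + C e)) P := by
  rw [slice, subst_apply, comp, eval₂_map]
  congr 1
  ext <;> simp

/-- The filtration gives `s` weight 1 and the row variable weight -1. On the plane, `a * b - c`
becomes `X * s - e`, of weight at most 0, so only the column degree of `P`, read off from `swap₃ P`,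
contributes positive weight. -/
theorem slice_mem_trapezoid (a e : F) {P : F[X][X][X]} {β : ℕ} (h : (swap₃ P).natDegree ≤ β) :
    slice a e P ∈ (trapezoid F).W β := by
  have h1 : slice a e P = subst (C X : F[X][X]) (X + C (C a)) (X * C X - C (C e)) (swap₃ P) := by
    rw [slice_eq_subst, subst_swap₃, mul_comm (C X : F[X][X])]
    congr 2
    simp only [C_add, C_mul]
    ring
  have hX : (X + C (C a) : F[X][X]) ∈ (trapezoid F).W 0 := fun k => by
    rw [coeff_add, coeff_X, coeff_C]
    split_ifs <;> simp
  have hs : (C X : F[X][X]) ∈ (trapezoid F).W 1 := fun k => by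
    rw [coeff_C]
    split_ifs <;> simp
  have hz : (X * C X - C (C e) : F[X][X]) ∈ (trapezoid F).W 0 := fun k => by
    rw [coeff_sub, coeff_mul_C, coeff_X, coeff_C]
    rcases k with _ | _ | k <;> simp
  rw [h1, subst_apply]
  have := (trapezoid F).eval₂_mem (eval₂RingHom (eval₂RingHom (algebraMap F F[X][X])
    (X + C (C a))) (X * C X - C (C e))) hs h (m := 0) fun i => by
      rw [coe_eval₂RingHom]
      have := (trapezoid F).eval₂_mem (eval₂RingHom (algebraMap F F[X][X]) (X + C (C a))) hz
        (P := (swap₃ P).coeff i) le_rfl (m := 0) fun k => by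
          rw [coe_eval₂RingHom]
          have := (trapezoid F).eval₂_mem (algebraMap F F[X][X]) hX
            (P := ((swap₃ P).coeff i).coeff k) le_rfl (m := 0)
            fun j => (trapezoid F).algebraMap_mem _
          exact (trapezoid F).mono (by omega) this
      exact (trapezoid F).mono (by omega) this
  exact (trapezoid F).mono (by omega) this

/-- The restriction of a polynomial to a line of the first family. -/
noncomputable def fiber (b c : F) : F[X][X][X] →ₐ[F] F[X] := subst X (C b) (C c)

theorem map_slice (a e s : F) (P : F[X][X][X]) :
    (slice a e P).map (evalRingHom s) = (fiber s (a * s + e) P).comp (X + C a) := by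
  have h1 := map_subst (mapAlgHom (aeval s) : F[X][X] →ₐ[F] F[X]) (X + C (C a)) (C X)
    (C (C a * X + C e)) P
  have h2 := map_subst (aeval (X + C a) : F[X] →ₐ[F] F[X]) X (C s) (C (a * s + e)) P
  have h3 : ∀ p : F[X], p.comp (X + C a) = aeval (X + C a) p := fun p => rfl
  have h4 : ∀ p : F[X][X], p.map (evalRingHom s) = (mapAlgHom (aeval s) : F[X][X] →ₐ[F] F[X]) p :=
    fun p => rfl
  rw [slice_eq_subst, fiber, h3, h2, h4, h1]
  simp

end Slices

/-! ### Divisibility on most rows bounds the degree -/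

section Divisibility

variable {F : Type u} [Field F]

theorem slice_mul (a e : F) (P Q : F[X][X][X]) : slice a e (P * Q) = slice a e P * slice a e Q := by
  rw [slice, Polynomial.map_mul, mul_comp]
  rfl

theorem slice_add (a e : F) (P Q : F[X][X][X]) : slice a e (P + Q) = slice a e P + slice a e Q := by
  rw [slice, Polynomial.map_add, add_comp]
  rfl

theorem slice_C (a e : F) (R : F[X][X]) : slice a e (C R) = C (R.eval (C a * X + C e)) := by
  rw [slice, map_C, C_comp, coe_evalRingHom]

theorem natDegree_slice {a e : F} {P : F[X][X][X]}
    (h : P.leadingCoeff.eval (C a * X + C e) ≠ 0) : (slice a e P).natDegree = P.natDegree := by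
  rw [slice, natDegree_comp, natDegree_X_add_C, mul_one]
  exact natDegree_map_of_leadingCoeff_ne_zero (p := P) (evalRingHom (C a * X + C e)) h

theorem leadingCoeff_slice {a e : F} {P : F[X][X][X]}
    (h : P.leadingCoeff.eval (C a * X + C e) ≠ 0) :
    (slice a e P).leadingCoeff = P.leadingCoeff.eval (C a * X + C e) := by
  rw [slice, leadingCoeff_comp (by rw [natDegree_X_add_C]; exact one_ne_zero),
    leadingCoeff_X_add_C, one_pow, mul_one]
  exact leadingCoeff_map_of_leadingCoeff_ne_zero (p := P) (evalRingHom (C a * X + C e)) h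

theorem eval_eval_eq (p : F[X][X]) (r : F[X]) (z : F) :
    (p.eval r).eval z = (p.map (evalRingHom z)).eval (r.eval z) := by
  rw [eval_map]
  exact hom_eval₂ p (RingHom.id _) (evalRingHom z) r

theorem natDegree_eval_linear_le {ℓ : F[X][X]} {i j : ℕ} (hc : ℓ.natDegree ≤ i)
    (hb : ∀ k, (ℓ.coeff k).natDegree ≤ j) (a e : F) :
    (ℓ.eval (C a * X + C e)).natDegree ≤ j + i := by
  have := (DegreeFiltration.degree F F).eval₂_mem (RingHom.id F[X])
    (x := C a * X + C e) (p := 1) natDegree_linear_le hc hb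
  rw [mul_one] at this
  exact this

variable [Fintype F]

/-- The `q ^ 2` linear polynomials are distinct candidates for roots of `T` in the domain `F[X]`. -/
theorem exists_eval_linear_ne_zero {T : F[X][X]} (hT : T ≠ 0)
    (h : T.natDegree < Fintype.card F ^ 2) : ∃ a e : F, T.eval (C a * X + C e) ≠ 0 := by
  classical
  by_contra! hc
  let g : F × F → F[X] := fun p => C p.1 * X + C p.2
  have hg : Function.Injective g := by
    intro p p' hp
    have h1 := congrArg (fun r : F[X] => r.coeff 1) hp
    have h0 := congrArg (fun r : F[X] => r.coeff 0) hp
    simp only [g, coeff_add, coeff_C_mul, coeff_X_one, coeff_X_zero, coeff_C_succ, coeff_C_zero,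
      mul_one, mul_zero, add_zero, zero_add] at h1 h0
    exact Prod.ext h1 h0
  have h1 : (Finset.univ.image g).val ≤ T.roots := by
    rw [Multiset.le_iff_subset (Finset.univ.image g).nodup]
    intro x hx
    rw [Finset.mem_val, Finset.mem_image] at hx
    obtain ⟨p, -, rfl⟩ := hx
    exact (mem_roots hT).2 (hc p.1 p.2)
  have h2 := (Multiset.card_le_card h1).trans (card_roots' T)
  rw [Finset.card_val, Finset.card_image_of_injective _ hg, Finset.card_univ, Fintype.card_prod,
    ← sq] at h2
  omega

theorem card_le_card_eval_ne_zero [DecidableEq F] {p : F[X]} (hp : p ≠ 0) :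
    Fintype.card F ≤ (Finset.univ.filter fun x => p.eval x ≠ 0).card + p.natDegree := by
  have h1 := Finset.card_filter_add_card_filter_not (s := (Finset.univ : Finset F))
    (fun x => p.eval x = 0)
  have h2 : (Finset.univ.filter fun x => p.eval x = 0).card ≤ p.natDegree := by
    refine le_trans (Multiset.card_le_card ?_) (card_roots' p)
    rw [Multiset.le_iff_subset (Finset.nodup _)]
    intro x hx
    rw [Finset.mem_val, Finset.mem_filter] at hx
    exact (mem_roots hp).2 hx.2
  rw [Finset.card_univ] at h1
  simp only [ne_eq]
  omega

/-- If `E` and `Q` are coprime and `E` divides `Q` on most lines of the first family, then the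
degree of `E` along these lines is small. -/
theorem card_sub_mul_natDegree_le {E Q : F[X][X][X]} {β D e : ℕ} (hrel : IsRelPrime E Q)
    (hE : E.natDegree ≤ D) (hE' : (swap₃ E).natDegree ≤ β) (hQ : Q.natDegree ≤ D)
    (hQ' : (swap₃ Q).natDegree ≤ D) (hEc : ∀ i, (E.coeff i).natDegree ≤ 2 * D)
    (hQc : ∀ i, (Q.coeff i).natDegree ≤ 2 * D) {ℓ : F[X][X]} (hℓ0 : ℓ ≠ 0)
    (hℓ : E.leadingCoeff ∣ ℓ) (hℓc : ℓ.natDegree ≤ e) (hℓb : ∀ k, (ℓ.coeff k).natDegree ≤ 2 * e)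
    (hq : 2 * D * (2 * D) + e < Fintype.card F ^ 2)
    (hdvd : ∀ b c, (ℓ.eval (C c)).eval b ≠ 0 → fiber b c E ∣ fiber b c Q) :
    (Fintype.card F - 3 * e) * E.natDegree ≤ E.natDegree * D + D * (E.natDegree + β) := by
  classical
  rcases Nat.eq_zero_or_pos E.natDegree with h0 | hα
  · simp [h0]
  have hR := resultant_ne_zero_of_isRelPrime hrel hα
  have hRd := natDegree_resultant_le hEc hQc
  obtain ⟨x, y, -, -, hxy⟩ :=
    exists_mul_add_mul_eq_C_resultant E Q le_rfl le_rfl (Or.inl hα.ne')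
  set R := resultant E Q with hRdef
  have hT : (R * ℓ).natDegree < Fintype.card F ^ 2 := by
    refine lt_of_le_of_lt (natDegree_mul_le.trans (add_le_add hRd hℓc)) (lt_of_le_of_lt ?_ hq)
    exact Nat.add_le_add_right (Nat.mul_le_mul_right _ (by omega)) _
  obtain ⟨a₀, e₀, hL⟩ := exists_eval_linear_ne_zero (mul_ne_zero hR hℓ0) hT
  rw [eval_mul] at hL
  have hRL := left_ne_zero_of_mul hL
  have hℓL := right_ne_zero_of_mul hL
  obtain ⟨ℓ', hℓ'⟩ := hℓ
  have hlcL : E.leadingCoeff.eval (C a₀ * X + C e₀) ≠ 0 := by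
    rw [hℓ', eval_mul] at hℓL
    exact left_ne_zero_of_mul hℓL
  have hdeg := natDegree_slice hlcL
  have hlc := leadingCoeff_slice hlcL
  have hS0 : slice a₀ e₀ E ≠ 0 := by
    intro h
    rw [h, natDegree_zero] at hdeg
    omega
  obtain ⟨E₁, Q₁, g, hrel₁, hgE, hgQ⟩ :=
    UniqueFactorizationMonoid.exists_reduced_factors (slice a₀ e₀ E) hS0 (slice a₀ e₀ Q)
  -- Slicing may create a common factor, but it divides the restricted resultant and hence involves
  -- only `s`.
  have hgR : g ∣ C (R.eval (C a₀ * X + C e₀)) := by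
    have h1 := congrArg (slice a₀ e₀) hxy
    rw [slice_add, slice_mul, slice_mul, slice_C, ← hgE, ← hgQ] at h1
    rw [← h1]
    exact dvd_add ((dvd_mul_right _ _).mul_right _) ((dvd_mul_right _ _).mul_right _)
  have hg0 : g.natDegree = 0 := by
    have := natDegree_le_of_dvd hgR (C_ne_zero.2 hRL)
    rw [natDegree_C] at this
    omega
  obtain ⟨v, rfl⟩ : ∃ v, g = C v := ⟨g.coeff 0, eq_C_of_natDegree_eq_zero hg0⟩
  have hv : v ≠ 0 := by
    rintro rfl
    rw [C_0, zero_mul] at hgE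
    exact hS0 hgE.symm
  have hEd : E₁.natDegree = E.natDegree := by
    rw [← hdeg, ← hgE, natDegree_C_mul hv]
  have hQd : Q₁.natDegree ≤ D := by
    have h1 : (slice a₀ e₀ Q).natDegree ≤ Q.natDegree := by
      rw [slice, natDegree_comp, natDegree_X_add_C, mul_one]
      exact natDegree_map_le
    rw [← hgQ, natDegree_C_mul hv] at h1
    exact h1.trans hQ
  have htrap : ∀ {P P₁ : F[X][X]} {n : ℕ}, C v * P₁ = P → P ∈ (trapezoid F).W n →
      P₁ ∈ (trapezoid F).W n := by
    intro P P₁ n h hP k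
    have h1 := hP k
    rw [← h, coeff_C_mul] at h1
    rcases eq_or_ne (P₁.coeff k) 0 with h2 | h2
    · simp [h2]
    · rw [natDegree_mul hv h2] at h1
      omega
  set s := Finset.univ.filter fun x => (ℓ.eval (C a₀ * X + C e₀)).eval x ≠ 0 with hs
  -- On the plane, `ℓ` has degree at most `2 * e` from `b` plus `e` from `c`.
  have hscard : Fintype.card F - 3 * e ≤ s.card := by
    have h1 : Fintype.card F ≤ s.card + (ℓ.eval (C a₀ * X + C e₀)).natDegree := by
      convert card_le_card_eval_ne_zero hℓL
    have h2 := natDegree_eval_linear_le hℓc hℓb a₀ e₀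
    omega
  have hgood : ∀ z ∈ s, (E₁.leadingCoeff).eval z ≠ 0 ∧ v.eval z ≠ 0 := by
    intro z hz
    have h1 := (Finset.mem_filter.1 hz).2
    rw [hℓ', eval_mul, eval_mul, ← hlc, ← hgE, leadingCoeff_mul, leadingCoeff_C, eval_mul] at h1
    have h2 := left_ne_zero_of_mul h1
    exact ⟨right_ne_zero_of_mul h2, left_ne_zero_of_mul h2⟩
  have hmain := card_mul_natDegree_le hrel₁ (htrap hgE (slice_mem_trapezoid a₀ e₀ hE')) hQd
    (htrap hgQ (slice_mem_trapezoid a₀ e₀ hQ')) s (fun z hz => (hgood z hz).1) fun z hz => by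
      have h1 : (ℓ.eval (C (a₀ * z + e₀))).eval z ≠ 0 := by
        have h2 := (Finset.mem_filter.1 hz).2
        have h3 : ∀ p : F[X][X], (p.eval (C a₀ * X + C e₀)).eval z =
            (p.eval (C (a₀ * z + e₀))).eval z := by
          intro p
          rw [eval_eval_eq, eval_eval_eq]
          simp
        rwa [← h3]
      have h4 : (slice a₀ e₀ E).map (evalRingHom z) ∣ (slice a₀ e₀ Q).map (evalRingHom z) := by
        obtain ⟨p, hp⟩ := hdvd _ _ h1
        rw [map_slice, map_slice, hp, mul_comp]
        exact dvd_mul_right _ _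
      rw [← hgE, ← hgQ, Polynomial.map_mul, Polynomial.map_mul, map_C, coe_evalRingHom] at h4
      exact (mul_dvd_mul_iff_left (C_ne_zero.2 (hgood z hz).2)).1 h4
  rw [hEd] at hmain
  exact (Nat.mul_le_mul_right _ hscard).trans hmain

end Divisibility

/-! ### The local closeness lemma -/

section LocalLemma

variable {F : Type u} [Field F]

theorem fiber_eq_map (b c : F) (P : F[X][X][X]) :
    fiber b c P = P.map ((evalRingHom b).comp (evalRingHom (C c))) := by
  rw [fiber, subst_apply, ← eval₂_C_X (p := P.map _), eval₂_map]
  congr 1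
  ext <;> simp

theorem eval_fiber (a b c : F) (P : F[X][X][X]) : (fiber b c P).eval a = subst a b c P := by
  have := map_subst (aeval a : F[X] →ₐ[F] F) X (C b) (C c) P
  rw [coe_aeval_eq_eval] at this
  rw [fiber, this]
  simp

theorem fiber_ne_zero {b c : F} {P : F[X][X][X]}
    (h : (P.leadingCoeff.eval (C c)).eval b ≠ 0) : fiber b c P ≠ 0 := by
  intro h0
  have := congrArg (fun p : F[X] => p.coeff P.natDegree) h0
  rw [fiber_eq_map] at this
  simp only [coeff_map, coeff_natDegree, coeff_zero] at this
  exact h this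

theorem natDegree_fiber_le (b c : F) (P : F[X][X][X]) : (fiber b c P).natDegree ≤ P.natDegree := by
  rw [fiber_eq_map]
  exact natDegree_map_le

/-- Such a polynomial is unchanged by moves along rows and along columns, and these moves connect
all points. -/
theorem eq_algebraMap_of_natDegree_eq_zero {P : F[X][X][X]} (h : P.natDegree = 0)
    (h' : (swap₃ P).natDegree = 0) : ∃ r : F, P = algebraMap F _ r := by
  have hx : ∀ {P : F[X][X][X]}, P.natDegree = 0 → ∀ x x' y z : F[X][X][X],
      subst x y z P = subst x' y z P := by
    intro P hP x x' y z
    rw [eq_C_of_natDegree_eq_zero hP, subst_apply, subst_apply, eval₂_C, eval₂_C]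
  have hy : ∀ x y y' z : F[X][X][X], subst x y z P = subst x y' (x * y' - (x * y - z)) P := by
    intro x y y' z
    have h1 := subst_swap₃ y x (x * y - z) P
    have h2 := subst_swap₃ y' x (x * y - z) P
    rw [mul_comm y, sub_sub_cancel] at h1
    rw [mul_comm y'] at h2
    rw [← h1, ← h2]
    exact hx h' _ _ _ _
  -- Four alternating moves trace out a commutator, which shifts the centre by `y`.
  have hz : ∀ y z : F[X][X][X], subst 0 0 z P = subst 0 0 (y + z) P := by
    intro y z
    rw [hx h 0 1, hy 1 0 y, hx h 1 0, hy 0 y 0]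
    congr 2
    ring
  refine ⟨subst 0 0 0 P, ?_⟩
  have h3 := map_subst (Algebra.ofId F F[X][X][X]) 0 0 0 P
  rw [map_zero] at h3
  refine Eq.trans ?_ h3.symm
  conv_lhs => rw [← subst_id P]
  rw [hy (va F) (vb F) 0, hx h (va F) 0, hz (-(va F * 0 - (va F * vb F - vc F)))]
  congr 2
  ring

variable [Fintype F]

/-- Both sides have degree below `q` and agree at all points of the row, so the equality of values
is an identity of polynomials. -/
theorem fiber_mul_eq {g : F → F → F → F} {d : ℕ} (hg : IsRowRS d g) {E Q : F[X][X][X]}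
    (h : ∀ a b c, subst a b c Q = subst a b c E * g a b c)
    (hE : E.natDegree + d < Fintype.card F) (hQ : Q.natDegree < Fintype.card F) (b c : F) :
    ∃ p : F[X], (∀ a, g a b c = p.eval a) ∧ fiber b c E * p = fiber b c Q := by
  obtain ⟨p, hp, hgp⟩ := mem_reedSolomon_iff.1 (hg b c)
  refine ⟨p, hgp, ?_⟩
  rw [← sub_eq_zero]
  refine eq_zero_of_eval_eq_zero ?_ fun a => ?_
  · refine (natDegree_sub_le _ _).trans_lt (max_lt ?_ ?_)
    · exact (natDegree_mul_le.trans (add_le_add (natDegree_fiber_le b c E) hp)).trans_lt hE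
    · exact (natDegree_fiber_le b c Q).trans_lt hQ
  · rw [eval_sub, eval_mul, eval_fiber, eval_fiber, h, ← hgp, sub_self]

/-- Rows where the leading coefficient of `E` survives allow the common factor `G` to be cancelled,
so `E'` divides `Q'` there. The bounds `2 * e` leave room for the swapped polynomials, to which this
is applied as well. -/
theorem card_sub_mul_natDegree_le_of_isRowRS {g : F → F → F → F} {d e D : ℕ} (hg : IsRowRS d g)
    {E Q G E' Q' : F[X][X][X]} (h : ∀ a b c, subst a b c Q = subst a b c E * g a b c)
    (hE0 : E ≠ 0) (hGE : G * E' = E) (hGQ : G * Q' = Q) (hrel : IsRelPrime E' Q')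
    (hEa : E.natDegree ≤ 2 * e) (hEb : E ∈ (bFilt F).W (2 * e)) (hEc : E ∈ (cFilt F).W e)
    (hD : d + 2 * e ≤ D) (hQ : Q.natDegree ≤ D) (hQ' : (swap₃ Q).natDegree ≤ D)
    (hQc : Q ∈ (cFilt F).W (2 * D)) (hq : 3 * D + 3 * e < Fintype.card F) :
    (Fintype.card F - 3 * e) * E'.natDegree ≤
      E'.natDegree * D + D * (E'.natDegree + (swap₃ E').natDegree) := by
  have hG0 : G ≠ 0 := by
    rintro rfl
    exact hE0 (by rw [← hGE, zero_mul])
  have hE'0 : E' ≠ 0 := by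
    rintro rfl
    exact hE0 (by rw [← hGE, mul_zero])
  refine card_sub_mul_natDegree_le (ℓ := E.leadingCoeff) (e := e) hrel ?_ le_rfl ?_ ?_
    (fun i => ?_) (fun i => ?_) (leadingCoeff_ne_zero.2 hE0) ?_ (hEc _) (fun k => hEb _ _) ?_
    fun b c hbc => ?_
  · have := natDegree_mul hG0 hE'0
    rw [hGE] at this
    omega
  · rcases eq_or_ne Q' 0 with rfl | h0
    · simp
    · have := natDegree_mul hG0 h0
      rw [hGQ] at this
      omega
  · rcases eq_or_ne Q' 0 with rfl | h0
    · simp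
    · have hinj : Function.Injective (swap₃ (F := F)) :=
        Function.LeftInverse.injective swap₃_swap₃
      have := natDegree_mul ((map_ne_zero_iff _ hinj).2 hG0) ((map_ne_zero_iff _ hinj).2 h0)
      rw [← map_mul, hGQ] at this
      omega
  · have := natDegree_coeff_le_of_dvd (Dvd.intro_left G hGE) hE0 hEc i
    omega
  · rcases eq_or_ne Q' 0 with rfl | h0
    · simp
    · exact natDegree_coeff_le_of_dvd (Dvd.intro_left G hGQ)
        (by rw [← hGQ]; exact mul_ne_zero hG0 h0) hQc i
  · rw [← hGE, leadingCoeff_mul]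
    exact dvd_mul_left _ _
  · nlinarith
  · obtain ⟨p, -, hp⟩ := fiber_mul_eq hg h (by omega) (by omega) b c
    have h1 := fiber_ne_zero hbc
    rw [← hGE, map_mul] at h1
    rw [← hGE, ← hGQ, map_mul, map_mul, mul_assoc] at hp
    exact ⟨p, (mul_left_cancel₀ (left_ne_zero_of_mul h1) hp).symm⟩

/-- Vanishing on `S` imposes fewer linear conditions than there are coefficients. -/
theorem exists_vanishing_polynomial (S : Finset (F × F × F)) {e : ℕ} (h : S.card < (e + 1) ^ 3) :
    ∃ E : F[X][X][X], E ≠ 0 ∧ E ∈ (aFilt F).W e ∧ E ∈ (bFilt F).W e ∧ E ∈ (cFilt F).W e ∧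
      ∀ p ∈ S, subst p.1 p.2.1 p.2.2 E = 0 := by
  classical
  let I := Fin (e + 1) × Fin (e + 1) × Fin (e + 1)
  let Λ : (I → F) →ₗ[F] F[X][X][X] :=
    Fintype.linearCombination F fun i => monomial (i.1 : ℕ) (monomial (i.2.2 : ℕ)
      (monomial (i.2.1 : ℕ) (1 : F)))
  have hΛ : ∀ v : I → F, Λ v = ∑ i, monomial (i.1 : ℕ) (monomial (i.2.2 : ℕ)
      (monomial (i.2.1 : ℕ) (v i))) := by
    intro v
    simp only [Λ, Fintype.linearCombination_apply, smul_monomial, smul_eq_mul, mul_one]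
  have hcoeff : ∀ v i, (((Λ v).coeff (i : I).1).coeff i.2.2).coeff i.2.1 = v i := by
    intro v i
    rw [hΛ]
    simp only [finsetSum_coeff]
    rw [Finset.sum_eq_single i]
    · simp
    · intro j _ hj
      simp only [coeff_monomial]
      by_cases h1 : (j.1 : ℕ) = i.1
      · by_cases h2 : (j.2.2 : ℕ) = i.2.2
        · by_cases h3 : (j.2.1 : ℕ) = i.2.1
          · exact absurd (Prod.ext (Fin.ext h1) (Prod.ext (Fin.ext h3) (Fin.ext h2))) hj
          · simp [h1, h2, coeff_monomial, h3]
        · simp [h1, coeff_monomial, h2]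
      · simp [h1]
    · simp
  let ev : (I → F) →ₗ[F] S → F :=
    LinearMap.pi fun p => (subst p.1.1 p.1.2.1 p.1.2.2 : F[X][X][X] →ₐ[F] F).toLinearMap ∘ₗ Λ
  have hker : LinearMap.ker ev ≠ ⊥ := by
    apply LinearMap.ker_ne_bot_of_finrank_lt
    rw [Module.finrank_fintype_fun_eq_card, Module.finrank_fintype_fun_eq_card, Fintype.card_coe]
    simp only [I, Fintype.card_prod, Fintype.card_fin]
    calc S.card < (e + 1) ^ 3 := h
      _ = _ := by ring
  obtain ⟨v, hv, hv0⟩ := (Submodule.ne_bot_iff _).1 hker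
  have hmem : ∀ {φ : DegreeFiltration F F[X][X][X]},
      (∀ i : I, monomial (i.1 : ℕ) (monomial (i.2.2 : ℕ) (monomial (i.2.1 : ℕ) (1 : F))) ∈ φ.W e) →
      Λ v ∈ φ.W e := by
    intro φ h
    rw [show Λ v = _ from Fintype.linearCombination_apply F _ v]
    exact sum_mem fun i _ => Submodule.smul_mem _ _ (h i)
  refine ⟨Λ v, fun h0 => hv0 ?_, hmem fun i => ?_, hmem fun i => ?_, hmem fun i => ?_,
    fun p hp => ?_⟩
  · funext i
    rw [← hcoeff v i, h0]
    simp
  · exact (natDegree_monomial_le _).trans (by omega)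
  · intro j k
    rw [coeff_monomial]
    split_ifs
    · rw [coeff_monomial]
      split_ifs
      · exact (natDegree_monomial_le _).trans (by omega)
      · exact zero_mem _
    · exact zero_mem _
  · intro j
    rw [coeff_monomial]
    split_ifs
    · exact (natDegree_monomial_le _).trans (by omega)
    · exact zero_mem _
  · exact congrFun (LinearMap.mem_ker.1 hv) ⟨p, hp⟩

end LocalLemma

section LocalLemma

variable {F : Type u} [Field F]

theorem flip₃_subst (w : F[X][X][X]) :
    flip₃ (fun a b c : F => subst a b c w) = fun a b c : F => subst a b c (swap₃ w) := by
  funext a b c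
  rw [subst_swap₃]
  rfl

theorem isRowRS_subst {w : F[X][X][X]} {d : ℕ} (h : w.natDegree ≤ d) :
    IsRowRS d fun a b c : F => subst a b c w := fun b c =>
  mem_reedSolomon_iff.2 ⟨fiber b c w, (natDegree_fiber_le b c w).trans h,
    fun a => (eval_fiber a b c w).symm⟩

variable [Fintype F] [DecidableEq F]

/-- Schwartz–Zippel: at most `j` values of `b` kill the leading coefficient, and each other one
leaves at most `i` zeros in `c`. -/
theorem card_eval_eval_eq_zero_le {ℓ : F[X][X]} (h0 : ℓ ≠ 0) {i j : ℕ} (hc : ℓ.natDegree ≤ i)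
    (hb : ∀ k, (ℓ.coeff k).natDegree ≤ j) :
    (Finset.univ.filter fun p : F × F => (ℓ.eval (C p.2)).eval p.1 = 0).card ≤
      (j + i) * Fintype.card F := by
  have hroots : ∀ p : F[X], p ≠ 0 → (Finset.univ.filter fun x => p.eval x = 0).card ≤ p.natDegree := by
    intro p hp
    have h1 := card_le_card_eval_ne_zero hp
    have h2 := Finset.card_filter_add_card_filter_not (s := (Finset.univ : Finset F))
      (fun x => p.eval x = 0)
    rw [Finset.card_univ] at h2
    simp only [ne_eq] at h1
    omega
  have hsub : (Finset.univ.filter fun p : F × F => (ℓ.eval (C p.2)).eval p.1 = 0) ⊆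
      (Finset.univ.filter fun b => ℓ.leadingCoeff.eval b = 0) ×ˢ Finset.univ ∪
      (Finset.univ.filter fun b => ℓ.leadingCoeff.eval b ≠ 0).biUnion fun b =>
        (Finset.univ.filter fun c => (ℓ.map (evalRingHom b)).eval c = 0).image fun c => (b, c) := by
    rintro ⟨b, c⟩ hp
    simp only [Finset.mem_filter, Finset.mem_univ, true_and, eval_eval_eq, eval_C] at hp
    simp only [Finset.mem_union, Finset.mem_product, Finset.mem_filter, Finset.mem_univ, true_and,
      and_true, Finset.mem_biUnion, Finset.mem_image, Prod.mk.injEq]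
    by_cases h : ℓ.leadingCoeff.eval b = 0
    · exact Or.inl h
    · exact Or.inr ⟨b, h, c, hp, rfl, rfl⟩
  refine (Finset.card_le_card hsub).trans ((Finset.card_union_le _ _).trans ?_)
  rw [add_mul, Finset.card_product, Finset.card_univ]
  refine add_le_add (Nat.mul_le_mul_right _ ((hroots _ (leadingCoeff_ne_zero.2 h0)).trans (hb _))) ?_
  refine Finset.card_biUnion_le.trans ((Finset.sum_le_card_nsmul _ _ i fun b hb' => ?_).trans ?_)
  · refine Finset.card_image_le.trans ?_
    have h1 := (Finset.mem_filter.1 hb').2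
    have h2 : ℓ.map (evalRingHom b) ≠ 0 := fun h => h1 (by
      have := congrArg (fun p : F[X] => p.coeff ℓ.natDegree) h
      simpa using this)
    exact (hroots _ h2).trans (natDegree_map_le.trans hc)
  · rw [smul_eq_mul, mul_comm]
    exact Nat.mul_le_mul_left _ (Finset.card_le_univ _)

/-- Where the leading coefficient of `E` does not vanish, `E` can be cancelled on the whole row. -/
theorem card_ne_le_of_mul_eq {g : F → F → F → F} {d : ℕ} (hg : IsRowRS d g) {E Q w : F[X][X][X]}
    {i j : ℕ} (h : ∀ a b c, subst a b c Q = subst a b c E * g a b c) (hE0 : E ≠ 0)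
    (hE : E.natDegree + d < Fintype.card F) (hQ : Q.natDegree < Fintype.card F) (hw : Q = E * w)
    (hb : E ∈ (bFilt F).W j) (hc : E ∈ (cFilt F).W i) :
    (Finset.univ.filter fun p : F × F => ∃ a, g a p.1 p.2 ≠ subst a p.1 p.2 w).card ≤
      (j + i) * Fintype.card F := by
  refine le_trans (Finset.card_le_card ?_)
    (card_eval_eval_eq_zero_le (leadingCoeff_ne_zero.2 hE0) (hc _) (fun k => hb _ k))
  rintro ⟨b, c⟩ hp
  simp only [Finset.mem_filter, Finset.mem_univ, true_and] at hp ⊢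
  by_contra h1
  obtain ⟨a, ha⟩ := hp
  obtain ⟨p, hgp, hp⟩ := fiber_mul_eq hg h hE hQ b c
  rw [hw, map_mul] at hp
  apply ha
  rw [hgp a, mul_left_cancel₀ (fiber_ne_zero h1) hp, eval_fiber]

/-- If a function of low degree along the first family of lines is close to one of low degree
along the second family, then both agree on most lines with a function that has low degree along
both families. -/
theorem exists_isRowRS_isColRS_near {d : ℕ} (hd : 4 * d < Fintype.card F)
    {fA fB : F → F → F → F} (hA : IsRowRS d fA) (hB : IsColRS d fB)
    (hS : 125000 * (Finset.univ.filter fun p : F × F × F =>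
      fA p.1 p.2.1 p.2.2 ≠ fB p.1 p.2.1 p.2.2).card ≤ Fintype.card F ^ 3) :
    ∃ w : F → F → F → F, IsRowRS d w ∧ IsColRS d w ∧
      16 * (Finset.univ.filter fun p : F × F => ∃ a, fA a p.1 p.2 ≠ w a p.1 p.2).card ≤
        Fintype.card F ^ 2 ∧
      16 * (Finset.univ.filter fun p : F × F => ∃ a, flip₃ fB a p.1 p.2 ≠ flip₃ w a p.1 p.2).card ≤
        Fintype.card F ^ 2 := by
  set q := Fintype.card F with hq
  set S := Finset.univ.filter fun p : F × F × F => fA p.1 p.2.1 p.2.2 ≠ fB p.1 p.2.1 p.2.2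
  -- With this `e`, the bound on `S` by `q ^ 3 / 50 ^ 3` admits a vanishing polynomial of degree `e`
  -- in each variable, while `3 * (d + 2 * e) + 3 * e` stays below `q` for `d < q / 4`.
  set e := q / 50 with he
  have he1 : 50 * e ≤ q := Nat.mul_div_le q 50
  have he2 : q < 50 * (e + 1) := by omega
  have hScard : S.card < (e + 1) ^ 3 := by
    have h1 : q ^ 3 < (50 * (e + 1)) ^ 3 := Nat.pow_lt_pow_left he2 (by norm_num)
    rw [mul_pow] at h1
    omega
  obtain ⟨E, hE0, hEa, hEb, hEc, hES⟩ := exists_vanishing_polynomial S hScard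
  have hinj : Function.Injective (swap₃ (F := F)) := Function.LeftInverse.injective swap₃_swap₃
  have hsE0 : swap₃ E ≠ 0 := (map_ne_zero_iff _ hinj).2 hE0
  have hsEa : (swap₃ E).natDegree ≤ 2 * e := by
    have := subst_mem (aFilt F) vb_mem_aFilt va_mem_aFilt
      (Submodule.sub_mem _ ((aFilt F).mul_mem va_mem_aFilt vb_mem_aFilt)
        ((aFilt F).mono zero_le_one vc_mem_aFilt)) hEa hEb hEc
    exact (aFilt F).mono (by omega) this
  have hsEb : swap₃ E ∈ (bFilt F).W (2 * e) := by
    have := subst_mem (bFilt F) vb_mem_bFilt va_mem_bFilt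
      (Submodule.sub_mem _ ((bFilt F).mul_mem va_mem_bFilt vb_mem_bFilt)
        ((bFilt F).mono zero_le_one vc_mem_bFilt)) hEa hEb hEc
    exact (bFilt F).mono (by omega) this
  have hsEc : swap₃ E ∈ (cFilt F).W e := by
    have := subst_mem (cFilt F) vb_mem_cFilt va_mem_cFilt
      (Submodule.sub_mem _ ((cFilt F).mono zero_le_one
        ((cFilt F).mul_mem va_mem_cFilt vb_mem_cFilt)) vc_mem_cFilt) hEa hEb hEc
    exact (cFilt F).mono (by omega) this
  have hEa' : E.natDegree ≤ e := hEa
  have hAB : ∀ a b c : F, subst a b c E * fA a b c = subst a b c E * fB a b c := by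
    intro a b c
    by_cases h : fA a b c = fB a b c
    · rw [h]
    · rw [hES (a, b, c) (Finset.mem_filter.2 ⟨Finset.mem_univ _, h⟩), zero_mul, zero_mul]
  -- The exact degree of `E` is kept, rather than `e`, so that the quotient of `Q` by `E` has degree
  -- at most `d`.
  have h₁ : IsRowRS (E.natDegree + d) fun a b c => subst a b c E * fA a b c := fun b c =>
    mul_mem_reedSolomon (isRowRS_subst le_rfl b c) (hA b c)
  have h₂ : IsColRS ((swap₃ E).natDegree + d) fun a b c => subst a b c E * fA a b c := by
    have h3 : IsRowRS ((swap₃ E).natDegree + d)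
        (flip₃ fun a b c : F => subst a b c E * fA a b c) := by
      have : flip₃ (fun a b c : F => subst a b c E * fA a b c) =
          fun a b c => subst a b c (swap₃ E) * flip₃ fB a b c := by
        funext a b c
        rw [subst_swap₃]
        exact hAB _ _ _
      rw [this]
      exact fun b c => mul_mem_reedSolomon (isRowRS_subst le_rfl b c) (hB.flip b c)
    have h4 := h3.flip
    rwa [flip₃_flip₃] at h4
  obtain ⟨Q, hQ, hQa, hQb, hQc, hsQc⟩ := exists_polynomial_of_isRowRS_of_isColRS h₁ h₂
    (by omega) (by omega)
  set D := d + 2 * e with hD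
  have hsQ : ∀ a b c : F, subst a b c (swap₃ Q) = subst a b c (swap₃ E) * flip₃ fB a b c := by
    intro a b c
    rw [subst_swap₃, subst_swap₃, hQ]
    exact hAB _ _ _
  obtain ⟨E', Q', G, hrel, hGE, hGQ⟩ := UniqueFactorizationMonoid.exists_reduced_factors E hE0 Q
  have hi₁ := card_sub_mul_natDegree_le_of_isRowRS (D := D) (e := e) hA hQ hE0 hGE hGQ hrel
    (by omega) ((bFilt F).mono (by omega) hEb) hEc (by omega) (by omega) (by omega)
    ((cFilt F).mono (by omega) hQc) (by omega)
  have hrel' : IsRelPrime (swap₃ E') (swap₃ Q') := by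
    intro x hx hy
    have hx' := map_dvd (swap₃ (F := F)) hx
    have hy' := map_dvd (swap₃ (F := F)) hy
    rw [swap₃_swap₃] at hx' hy'
    have := (hrel hx' hy').map (swap₃ (F := F))
    rwa [swap₃_swap₃] at this
  have hi₂ := card_sub_mul_natDegree_le_of_isRowRS (D := D) (e := e) hB.flip hsQ hsE0
    (by rw [← map_mul, hGE]) (by rw [← map_mul, hGQ]) hrel'
    hsEa hsEb hsEc (by omega) (by omega) (by rw [swap₃_swap₃]; omega)
    ((cFilt F).mono (by omega) hsQc) (by omega)
  rw [swap₃_swap₃] at hi₂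
  -- The two inequalities add up to `(q - 3 * e) * n ≤ 3 * D * n` for the sum `n` of the two
  -- degrees, and `3 * D < q - 3 * e`.
  have hzero : E'.natDegree + (swap₃ E').natDegree = 0 := by
    by_contra h0
    have h1 : 3 * D + 1 ≤ q - 3 * e := by omega
    have h2 := Nat.mul_le_mul_right E'.natDegree h1
    have h3 := Nat.mul_le_mul_right (swap₃ E').natDegree h1
    have h4 := Nat.pos_of_ne_zero h0
    have h5 := h2.trans hi₁
    have h6 := h3.trans hi₂
    nlinarith
  obtain ⟨r, hr⟩ := eq_algebraMap_of_natDegree_eq_zero (P := E') (by omega) (by omega)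
  have hr0 : r ≠ 0 := by
    rintro rfl
    rw [map_zero] at hr
    exact hE0 (by rw [← hGE, hr, mul_zero])
  obtain ⟨w, hw⟩ : ∃ w, Q = E * w := by
    refine ⟨r⁻¹ • Q', ?_⟩
    rw [← hGE, hr, ← hGQ, mul_assoc, mul_smul_comm, ← Algebra.smul_def, smul_smul,
      inv_mul_cancel₀ hr0, one_smul]
  have hsw : swap₃ Q = swap₃ E * swap₃ w := by rw [hw, map_mul]
  have hwa : w.natDegree ≤ d := by
    rcases eq_or_ne w 0 with rfl | h0
    · simp
    · have := natDegree_mul hE0 h0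
      rw [← hw] at this
      omega
  have hwb : (swap₃ w).natDegree ≤ d := by
    rcases eq_or_ne w 0 with rfl | h0
    · simp
    · have := natDegree_mul hsE0 ((map_ne_zero_iff _ hinj).2 h0)
      rw [← hsw] at this
      omega
  refine ⟨fun a b c => subst a b c w, isRowRS_subst hwa, ?_, ?_, ?_⟩
  · have := (isRowRS_subst hwb).flip
    rwa [flip₃_subst, swap₃_swap₃] at this
  · have := card_ne_le_of_mul_eq hA hQ hE0 (by omega) (by omega) hw hEb hEc
    rw [← hq] at this
    nlinarith
  · rw [flip₃_subst]
    have := card_ne_le_of_mul_eq hB.flip hsQ hsE0 (by omega) (by omega) hsw hsEb hsEc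
    rw [← hq] at this
    nlinarith

end LocalLemma

/-! ### Trickling down for three subspaces -/

section TricklingDown

open scoped InnerProductSpace

variable {V : Type*} [NormedAddCommGroup V] [InnerProductSpace ℝ V] [FiniteDimensional ℝ V]
  {B : Fin 3 → Submodule ℝ V} {ε : ℝ}

/-- The subspaces `B (i + 1)` and `B (i + 2)` are nearly orthogonal modulo their intersection. -/
def IsLocallyExpanding (B : Fin 3 → Submodule ℝ V) (ε : ℝ) : Prop :=
  ∀ i, ∀ x ∈ B (i + 1), ∀ y ∈ B (i + 2), (∀ a ∈ B (i + 1) ⊓ B (i + 2), ⟪a, x⟫_ℝ = 0) →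
    (∀ a ∈ B (i + 1) ⊓ B (i + 2), ⟪a, y⟫_ℝ = 0) → ⟪x, y⟫_ℝ ≤ ε * (‖x‖ * ‖y‖)

/-- Both vectors are split along the intersection. The projections pair by Cauchy–Schwarz and the
remainders by local expansion. -/
theorem IsLocallyExpanding.inner_le (hB : IsLocallyExpanding B ε) (i : Fin 3) {x y : V}
    (hx : x ∈ B (i + 1)) (hy : y ∈ B (i + 2)) :
    ∃ p ∈ B (i + 1) ⊓ B (i + 2), ∃ r ∈ B (i + 1) ⊓ B (i + 2),
      ⟪x, p⟫_ℝ = ‖p‖ ^ 2 ∧ ⟪y, r⟫_ℝ = ‖r‖ ^ 2 ∧ ‖p‖ ^ 2 + ‖x - p‖ ^ 2 = ‖x‖ ^ 2 ∧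
      ‖r‖ ^ 2 + ‖y - r‖ ^ 2 = ‖y‖ ^ 2 ∧
      ⟪x, y⟫_ℝ ≤ ‖p‖ * ‖r‖ + ε * (‖x - p‖ * ‖y - r‖) := by
  set A := B (i + 1) ⊓ B (i + 2) with hA
  have key : ∀ z : V, ∃ p ∈ A, (∀ a ∈ A, ⟪a, z - p⟫_ℝ = 0) ∧ ⟪z, p⟫_ℝ = ‖p‖ ^ 2 ∧
      ‖p‖ ^ 2 + ‖z - p‖ ^ 2 = ‖z‖ ^ 2 := by
    intro z
    obtain ⟨p, hp, w, hw, hz⟩ := A.exists_add_mem_mem_orthogonal z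
    have hw' : z - p = w := by rw [hz, add_sub_cancel_left]
    have h0 : ⟪p, w⟫_ℝ = 0 := (Submodule.mem_orthogonal A w).1 hw p hp
    refine ⟨p, hp, fun a ha => ?_, ?_, ?_⟩
    · rw [hw']
      exact (Submodule.mem_orthogonal A w).1 hw a ha
    · rw [hz, inner_add_left, real_inner_comm, real_inner_comm p w, h0, add_zero,
        real_inner_self_eq_norm_sq]
    · rw [hw', hz, norm_add_sq_real, h0]
      ring
  obtain ⟨p, hp, hpo, hp1, hp2⟩ := key x
  obtain ⟨r, hr, hro, hr1, hr2⟩ := key y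
  refine ⟨p, hp, r, hr, hp1, hr1, hp2, hr2, ?_⟩
  have h1 := hB i (x - p) (Submodule.sub_mem _ hx hp.1) (y - r) (Submodule.sub_mem _ hy hr.2)
    hpo hro
  have h2 : ⟪x, y⟫_ℝ = ⟪p, r⟫_ℝ + ⟪x - p, y - r⟫_ℝ := by
    have e1 := hpo r hr
    have e2 := hro p hp
    rw [real_inner_comm] at e1
    simp only [inner_sub_left, inner_sub_right] at e1 e2 ⊢
    linarith
  linarith [real_inner_le_norm p r]

theorem fin_three_add_one_add_two (i : Fin 3) : i + 1 + 2 = i := by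
  revert i
  decide

theorem fin_three_add_two_add_one (i : Fin 3) : i + 2 + 1 = i := by
  revert i
  decide

theorem fin_three_add_two_add_two (i : Fin 3) : i + 2 + 2 = i + 1 := by
  revert i
  decide

theorem fin_three_add_one_add_one (i : Fin 3) : i + 1 + 1 = i + 2 := by
  revert i
  decide

theorem eq_zero_of_mem_cyclic (hbot : ∀ v : V, (∀ j, v ∈ B j) → v = 0) (i : Fin 3) {v : V}
    (h0 : v ∈ B i) (h1 : v ∈ B (i + 1)) (h2 : v ∈ B (i + 2)) : v = 0 := by
  refine hbot v fun j => ?_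
  have : j = i ∨ j = i + 1 ∨ j = i + 2 := by
    clear h0 h1 h2
    revert i j
    decide
  rcases this with rfl | rfl | rfl <;> assumption

/-- The maximal cosine is attained by compactness. A cosine of 1 would give a nonzero vector in all
three subspaces. -/
theorem exists_max_inner (B : Fin 3 → Submodule ℝ V)
    (hbot : ∀ v : V, (∀ j, v ∈ B j) → v = 0) (i : Fin 3) :
    ∃ θ : ℝ, 0 ≤ θ ∧ θ < 1 ∧
      (∀ u ∈ B (i + 1) ⊓ B (i + 2), ∀ v ∈ B (i + 2) ⊓ B i, ⟪u, v⟫_ℝ ≤ θ * (‖u‖ * ‖v‖)) ∧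
      ∃ u ∈ B (i + 1) ⊓ B (i + 2), ∃ v ∈ B (i + 2) ⊓ B i, ‖u‖ ≤ 1 ∧ ‖v‖ ≤ 1 ∧ ⟪u, v⟫_ℝ = θ := by
  let C : Set (V × V) := (Metric.closedBall 0 1 ∩ (B (i + 1) ⊓ B (i + 2) : Submodule ℝ V)) ×ˢ
    (Metric.closedBall 0 1 ∩ (B (i + 2) ⊓ B i : Submodule ℝ V))
  have hC : IsCompact C :=
    ((isCompact_closedBall 0 1).inter_right (Submodule.closed_of_finiteDimensional _)).prod
      ((isCompact_closedBall 0 1).inter_right (Submodule.closed_of_finiteDimensional _))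
  have hC0 : (0, 0) ∈ C := ⟨⟨by simp, zero_mem _⟩, ⟨by simp, zero_mem _⟩⟩
  obtain ⟨⟨u, v⟩, ⟨⟨hu1, hu⟩, ⟨hv1, hv⟩⟩, hmax⟩ := hC.exists_isMaxOn ⟨_, hC0⟩
    (f := fun p : V × V => ⟪p.1, p.2⟫_ℝ) (by fun_prop)
  have hmax' : ∀ p ∈ C, ⟪p.1, p.2⟫_ℝ ≤ ⟪u, v⟫_ℝ := fun p hp => hmax hp
  rw [mem_closedBall_zero_iff] at hu1 hv1
  refine ⟨⟪u, v⟫_ℝ, by simpa using hmax' _ hC0, ?_, ?_, u, hu, v, hv, hu1, hv1, rfl⟩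
  · by_contra! h
    have h1 : ‖u - v‖ ^ 2 ≤ 0 := by
      rw [norm_sub_sq_real]
      nlinarith [norm_nonneg u, norm_nonneg v]
    have h2 : u = v := by
      rw [← sub_eq_zero, ← norm_eq_zero]
      exact pow_eq_zero_iff (two_ne_zero) |>.1 (le_antisymm h1 (sq_nonneg _))
    have h3 : u = 0 := eq_zero_of_mem_cyclic hbot i (h2 ▸ hv.2) hu.1 hu.2
    rw [h3, inner_zero_left] at h
    linarith
  · intro u' hu' v' hv'
    rcases eq_or_ne u' 0 with rfl | hu0
    · simp
    rcases eq_or_ne v' 0 with rfl | hv0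
    · simp
    have hun := norm_pos_iff.2 hu0
    have hvn := norm_pos_iff.2 hv0
    have h1 := hmax' (‖u'‖⁻¹ • u', ‖v'‖⁻¹ • v')
      ⟨⟨by simp [norm_smul, hun.ne'], Submodule.smul_mem _ _ hu'⟩,
        ⟨by simp [norm_smul, hvn.ne'], Submodule.smul_mem _ _ hv'⟩⟩
    rw [real_inner_smul_left, real_inner_smul_right, ← mul_assoc, ← mul_inv,
      inv_mul_le_iff₀ (by positivity)] at h1
    linarith

/-- Take the worst pair, of cosine θ. Its projections to the intersection left out have norm at most
θ, again by maximality, so local expansion gives a quadratic inequality for θ. -/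
theorem IsLocallyExpanding.inner_le_of_mem (hB : IsLocallyExpanding B ε) (h0 : 0 ≤ ε) (h1 : ε < 1)
    (hbot : ∀ v : V, (∀ j, v ∈ B j) → v = 0) (i : Fin 3) {u v : V}
    (hu : u ∈ B (i + 1) ⊓ B (i + 2)) (hv : v ∈ B (i + 2) ⊓ B i) :
    ⟪u, v⟫_ℝ ≤ ε / (1 - ε) * (‖u‖ * ‖v‖) := by
  choose θ hθ0 hθ1 hθ hθm using exists_max_inner B hbot
  obtain ⟨m, hm⟩ := Finite.exists_max θ
  have hall : ∀ j, ∀ u ∈ B (j + 1) ⊓ B (j + 2), ∀ v ∈ B (j + 2) ⊓ B j,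
      ⟪u, v⟫_ℝ ≤ θ m * (‖u‖ * ‖v‖) := fun j u hu v hv =>
    (hθ j u hu v hv).trans (mul_le_mul_of_nonneg_right (hm j) (by positivity))
  have hbound : ∀ {p x : V}, ⟪x, p⟫_ℝ = ‖p‖ ^ 2 → ⟪x, p⟫_ℝ ≤ θ m * (‖x‖ * ‖p‖) →
      ‖p‖ ≤ θ m * ‖x‖ := by
    intro p x h h'
    rcases eq_or_ne p 0 with rfl | hp
    · simpa using mul_nonneg (hθ0 m) (norm_nonneg x)
    · have hpn := norm_pos_iff.2 hp
      rw [h] at h'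
      nlinarith
  have hmain : θ m ≤ ε / (1 - ε) := by
    obtain ⟨u, hu, v, hv, hu1, hv1, huv⟩ := hθm m
    -- The vectors share the subspace `B (m + 2)` but are compared as members of `B m` and `B (m +
    -- 1)`.
    obtain ⟨p, hp, r, hr, hp1, hr1, hp2, hr2, hle⟩ := hB.inner_le (m + 2)
      (x := v) (y := u) (by rw [fin_three_add_two_add_one]; exact hv.2)
      (by rw [fin_three_add_two_add_two]; exact hu.1)
    have hpm : p ∈ B (m + 2 + 1) ⊓ B (m + 2 + 2) := hp
    have hrm : r ∈ B (m + 2 + 1) ⊓ B (m + 2 + 2) := hr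
    have hr' : ‖r‖ ≤ θ m * ‖u‖ := by
      refine hbound hr1 ?_
      have := hall (m + 2) r hrm u ⟨by rw [fin_three_add_two_add_two]; exact hu.1, hu.2⟩
      rw [real_inner_comm, mul_comm ‖r‖] at this
      exact this
    have hp' : ‖p‖ ≤ θ m * ‖v‖ := by
      refine hbound hp1 ?_
      refine hall (m + 1) v ⟨by rw [fin_three_add_one_add_one]; exact hv.1,
        by rw [fin_three_add_one_add_two]; exact hv.2⟩ p ⟨?_, ?_⟩
      · rw [fin_three_add_one_add_two]
        have := hpm.1
        rwa [fin_three_add_two_add_one] at this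
      · have := hpm.2
        rwa [fin_three_add_two_add_two] at this
    have hpθ : ‖p‖ ≤ θ m := hp'.trans (mul_le_of_le_one_right (hθ0 m) hv1)
    have hrθ : ‖r‖ ≤ θ m := hr'.trans (mul_le_of_le_one_right (hθ0 m) hu1)
    have h3 : ‖v - p‖ * ‖u - r‖ ≤ 1 - ‖p‖ * ‖r‖ := by
      nlinarith [sq_nonneg (‖v - p‖ - ‖u - r‖), sq_nonneg (‖p‖ - ‖r‖), norm_nonneg u, norm_nonneg v]
    rw [real_inner_comm, huv] at hle
    have h4 : ‖p‖ * ‖r‖ ≤ θ m * θ m := mul_le_mul hpθ hrθ (norm_nonneg _) (hθ0 m)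
    -- Equivalently `(1 - θ) * ((1 - ε) * θ - ε) ≤ 0`, and `θ < 1` decides the sign.
    have h5 : θ m ≤ (1 - ε) * (θ m * θ m) + ε := by nlinarith
    rw [le_div_iff₀ (by linarith)]
    have h6 := hθ1 m
    by_contra! h7
    nlinarith
  exact (hall i u hu v hv).trans (mul_le_mul_of_nonneg_right hmain (by positivity))

theorem IsLocallyExpanding.inner_le_of_mem_opposite (hB : IsLocallyExpanding B ε) (h0 : 0 ≤ ε)
    (h1 : ε < 1) (hbot : ∀ v : V, (∀ j, v ∈ B j) → v = 0) (i : Fin 3) {x y : V}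
    (hx : x ∈ B i) (hy : y ∈ B (i + 1) ⊓ B (i + 2)) :
    ⟪x, y⟫_ℝ ≤ (ε / (1 - ε) + ε) * (‖x‖ * ‖y‖) := by
  obtain ⟨p, hp, r, hr, hp1, hr1, hp2, hr2, hle⟩ := hB.inner_le (i + 2) (x := x) (y := y)
    (by rw [fin_three_add_two_add_one]; exact hx) (by rw [fin_three_add_two_add_two]; exact hy.1)
  have hpx : ‖p‖ ≤ ‖x‖ := by
    apply le_of_sq_le_sq _ (norm_nonneg _)
    nlinarith [sq_nonneg ‖x - p‖]
  have hpx' : ‖x - p‖ ≤ ‖x‖ := by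
    apply le_of_sq_le_sq _ (norm_nonneg _)
    nlinarith [sq_nonneg ‖p‖]
  have hry : ‖y - r‖ ≤ ‖y‖ := by
    apply le_of_sq_le_sq _ (norm_nonneg _)
    nlinarith [sq_nonneg ‖r‖]
  have hθ0 : 0 ≤ ε / (1 - ε) := div_nonneg h0 (by linarith)
  have hr' : ‖r‖ ≤ ε / (1 - ε) * ‖y‖ := by
    have h3 := hB.inner_le_of_mem h0 h1 hbot (i + 2) (u := r) (v := y) hr
      ⟨by rw [fin_three_add_two_add_two]; exact hy.1, hy.2⟩
    rw [real_inner_comm, hr1] at h3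
    rcases eq_or_ne r 0 with rfl | hr0
    · simpa using mul_nonneg hθ0 (norm_nonneg y)
    · have hrn := norm_pos_iff.2 hr0
      nlinarith
  have h4 : ‖p‖ * ‖r‖ ≤ ‖x‖ * (ε / (1 - ε) * ‖y‖) :=
    mul_le_mul hpx hr' (norm_nonneg _) (norm_nonneg _)
  have h5 : ε * (‖x - p‖ * ‖y - r‖) ≤ ε * (‖x‖ * ‖y‖) :=
    mul_le_mul_of_nonneg_left (mul_le_mul hpx' hry (norm_nonneg _) (norm_nonneg _)) h0
  nlinarith

end TricklingDown

/-! ### Heisenberg triples: invariant functions and averages -/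

/-- A group generated by three one-parameter subgroups `h i`, where any two of them generate a
Heisenberg group `k i a b c`. -/
structure HeisenbergTriple (F : Type*) [Field F] (Γ : Type*) [Group Γ] where
  h : Fin 3 → F → Γ
  k : Fin 3 → F → F → F → Γ
  k_zero : ∀ i, k i 0 0 0 = 1
  k_mul_h_add_one : ∀ i a b c α, k i a b c * h (i + 1) α = k i (a + α) b c
  k_mul_h_add_two : ∀ i a b c β, k i a b c * h (i + 2) β = k i a (b + β) (c + a * β)
  h_add_one_mul_k : ∀ i a b c α, h (i + 1) α * k i a b c = k i (a + α) b (c + α * b)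
  h_add_two_mul_k : ∀ i a b c β, h (i + 2) β * k i a b c = k i a (b + β) c
  k_injective : ∀ i a b c a' b' c', k i a b c = k i a' b' c' → a = a' ∧ b = b' ∧ c = c'
  closure_eq_top : ∀ S : Subgroup Γ, (∀ i α, h i α ∈ S) → S = ⊤

namespace HeisenbergTriple

variable {F : Type*} [Field F] {Γ : Type*} [Group Γ] (H : HeisenbergTriple F Γ)

theorem h_add_one_eq (i : Fin 3) (α : F) : H.h (i + 1) α = H.k i α 0 0 := by
  have := H.k_mul_h_add_one i 0 0 0 α
  rwa [H.k_zero, one_mul, zero_add] at this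

theorem h_add (j : Fin 3) (α β : F) : H.h j α * H.h j β = H.h j (α + β) := by
  obtain ⟨i, rfl⟩ : ∃ i, j = i + 1 := ⟨j + 2, (fin_three_add_two_add_one j).symm⟩
  rw [h_add_one_eq, k_mul_h_add_one, ← h_add_one_eq]

theorem h_zero (j : Fin 3) : H.h j 0 = 1 := by
  obtain ⟨i, rfl⟩ : ∃ i, j = i + 1 := ⟨j + 2, (fin_three_add_two_add_one j).symm⟩
  rw [h_add_one_eq, k_zero]

theorem h_injective (j : Fin 3) : Function.Injective (H.h j) := by
  obtain ⟨i, rfl⟩ : ∃ i, j = i + 1 := ⟨j + 2, (fin_three_add_two_add_one j).symm⟩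
  intro α β h
  rw [h_add_one_eq, h_add_one_eq] at h
  exact (H.k_injective _ _ _ _ _ _ _ h).1

/-- Invariance of a function under right multiplication by the one-parameter subgroup `h j`. -/
def IsInv {T : Type*} (j : Fin 3) (x : Γ → T) : Prop := ∀ g α, x (g * H.h j α) = x g

variable {H}

/-- The centre is reached as a commutator: `e₃` moves `c` by passing through `a = c` and `b = 1`. -/
theorem IsInv.apply_k {T : Type*} {i : Fin 3} {x : Γ → T} (h₁ : H.IsInv (i + 1) x)
    (h₂ : H.IsInv (i + 2) x) (g : Γ) (a b c : F) : x (g * H.k i a b c) = x g := by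
  have e₁ : ∀ a b c α, x (g * H.k i (a + α) b c) = x (g * H.k i a b c) := by
    intro a b c α
    rw [← H.k_mul_h_add_one, ← mul_assoc, h₁]
  have e₂ : ∀ a b c β, x (g * H.k i a (b + β) (c + a * β)) = x (g * H.k i a b c) := by
    intro a b c β
    rw [← H.k_mul_h_add_two, ← mul_assoc, h₂]
  have e₁' : ∀ a b c, x (g * H.k i a b c) = x (g * H.k i 0 b c) := by
    intro a b c
    have := e₁ 0 b c a
    rwa [zero_add] at this
  have e₂' : ∀ b c, x (g * H.k i 0 b c) = x (g * H.k i 0 0 c) := by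
    intro b c
    have := e₂ 0 0 c b
    rwa [zero_add, zero_mul, add_zero] at this
  have e₃ : ∀ c, x (g * H.k i 0 0 c) = x (g * H.k i 0 0 0) := by
    intro c
    have := e₂ c 0 0 1
    rw [zero_add, zero_add, mul_one, e₁', e₂', e₁' c 0 0] at this
    exact this
  rw [e₁', e₂', e₃, H.k_zero, mul_one]

theorem eq_of_isInv {T : Type*} {x : Γ → T} (h : ∀ j, H.IsInv j x) (g g' : Γ) : x g = x g' := by
  let S : Subgroup Γ :=
    { carrier := {γ | ∀ g, x (g * γ) = x g}
      mul_mem' := fun {γ γ'} hγ hγ' g => by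
        rw [← mul_assoc]
        exact (hγ' _).trans (hγ g)
      one_mem' := fun g => by rw [mul_one]
      inv_mem' := fun {γ} hγ g => by
        have := hγ (g * γ⁻¹)
        rw [inv_mul_cancel_right] at this
        exact this.symm }
  have hS := H.closure_eq_top S fun j α g => h j g α
  have hmem : g⁻¹ * g' ∈ S := by
    rw [hS]
    trivial
  have := hmem g
  rw [mul_inv_cancel_left] at this
  exact this.symm

variable [Fintype F]

variable (H) in
/-- The average over the coset of the Heisenberg group `k i`. -/
noncomputable def avg (i : Fin 3) (x : Γ → ℝ) (g : Γ) : ℝ :=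
  ((Fintype.card F : ℝ) ^ 3)⁻¹ * ∑ p : F × F × F, x (g * H.k i p.1 p.2.1 p.2.2)

theorem avg_isInv_add_one (i : Fin 3) (x : Γ → ℝ) : H.IsInv (i + 1) (H.avg i x) := by
  intro g α
  unfold avg
  congr 1
  refine Fintype.sum_equiv
    ⟨fun p : F × F × F => (p.1 + α, p.2.1, p.2.2 + α * p.2.1),
      fun p => (p.1 - α, p.2.1, p.2.2 - α * p.2.1), fun p => by simp, fun p => by simp⟩ _ _ fun p => ?_
  rw [mul_assoc, H.h_add_one_mul_k]
  rfl

theorem avg_isInv_add_two (i : Fin 3) (x : Γ → ℝ) : H.IsInv (i + 2) (H.avg i x) := by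
  intro g β
  unfold avg
  congr 1
  refine Fintype.sum_equiv
    ⟨fun p : F × F × F => (p.1, p.2.1 + β, p.2.2),
      fun p => (p.1, p.2.1 - β, p.2.2), fun p => by simp, fun p => by simp⟩ _ _ fun p => ?_
  rw [mul_assoc, H.h_add_two_mul_k]
  rfl

variable [Fintype Γ]

theorem sum_sum_mul_k (i : Fin 3) (x : Γ → ℝ) :
    ∑ g, ∑ p : F × F × F, x (g * H.k i p.1 p.2.1 p.2.2) = (Fintype.card F : ℝ) ^ 3 * ∑ g, x g := by
  rw [Finset.sum_comm]
  have : ∀ p : F × F × F, ∑ g, x (g * H.k i p.1 p.2.1 p.2.2) = ∑ g, x g := fun p =>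
    Fintype.sum_equiv (Equiv.mulRight _) _ _ fun g => rfl
  simp only [this, Finset.sum_const, Finset.card_univ, Fintype.card_prod, nsmul_eq_mul,
    Nat.cast_mul]
  ring

theorem card_pow_pos (n : ℕ) : 0 < (Fintype.card F : ℝ) ^ n := by
  have : 0 < Fintype.card F := Fintype.card_pos
  positivity

theorem sum_avg (i : Fin 3) (x : Γ → ℝ) : ∑ g, H.avg i x g = ∑ g, x g := by
  unfold avg
  rw [← Finset.mul_sum, sum_sum_mul_k, inv_mul_cancel_left₀ (card_pow_pos 3).ne']

/-- With the invariance of averages, this says that `avg i` is the orthogonal projection to the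
functions constant on cosets of type `i`. -/
theorem sum_mul_avg {i : Fin 3} {y : Γ → ℝ} (h₁ : H.IsInv (i + 1) y) (h₂ : H.IsInv (i + 2) y)
    (x : Γ → ℝ) : ∑ g, y g * H.avg i x g = ∑ g, y g * x g := by
  have h3 := sum_sum_mul_k (H := H) i fun g => y g * x g
  have h4 : ∀ g, y g * H.avg i x g = ((Fintype.card F : ℝ) ^ 3)⁻¹ *
      ∑ p : F × F × F, y (g * H.k i p.1 p.2.1 p.2.2) * x (g * H.k i p.1 p.2.1 p.2.2) := by
    intro g
    unfold avg
    simp only [h₁.apply_k h₂]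
    rw [← Finset.mul_sum]
    ring
  simp only [h4]
  rw [← Finset.mul_sum, h3, inv_mul_cancel_left₀ (card_pow_pos 3).ne']

theorem sum_avg_mul_avg (i : Fin 3) (x y : Γ → ℝ) :
    ∑ g, H.avg i x g * H.avg i y g = ∑ g, H.avg i x g * y g :=
  sum_mul_avg (avg_isInv_add_one i x) (avg_isInv_add_two i x) y

end HeisenbergTriple

/-! ### Point-line incidences -/

section Incidence

variable {F : Type*} [Field F] [Fintype F]

/-- Point-line incidences in an affine plane without one class of parallel lines. -/
theorem sum_incidence_sq_le (Y : F → F → ℝ) (hY : ∑ a, ∑ e, Y a e = 0) :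
    ∑ b, ∑ c, (∑ a, Y a (c - a * b)) ^ 2 ≤ Fintype.card F * ∑ a, ∑ e, Y a e ^ 2 := by
  classical
  -- Two lines of different slopes meet in exactly one point, so `(b, c)` corresponds bijectively to
  -- the pair of intercepts.
  have h1 : ∀ a a' : F, ∑ b, ∑ c, Y a (c - a * b) * Y a' (c - a' * b) =
      if a = a' then Fintype.card F * ∑ e, Y a e ^ 2 else (∑ e, Y a e) * ∑ e, Y a' e := by
    intro a a'
    split_ifs with h
    · subst h
      have : ∀ b, ∑ c, Y a (c - a * b) * Y a (c - a * b) = ∑ e, Y a e ^ 2 := fun b =>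
        Fintype.sum_equiv (Equiv.subRight (a * b)) _ _ fun c => (sq _).symm
      simp only [this, Finset.sum_const, Finset.card_univ, nsmul_eq_mul]
    · have hne : a' - a ≠ 0 := sub_ne_zero.2 (Ne.symm h)
      rw [Finset.sum_mul_sum, ← Fintype.sum_prod_type', ← Fintype.sum_prod_type']
      refine Fintype.sum_equiv
        ⟨fun p : F × F => (p.2 - a * p.1, p.2 - a' * p.1),
          fun p => ((p.1 - p.2) / (a' - a), p.1 + a * ((p.1 - p.2) / (a' - a))), fun p => ?_,
          fun p => ?_⟩ _ _ fun p => rfl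
      · ext <;> simp <;> field_simp <;> ring
      · ext
        · simp
        · simp
          field_simp
          ring
  have h2 : ∑ b, ∑ c, (∑ a, Y a (c - a * b)) ^ 2 =
      ∑ a, ∑ a', ∑ b, ∑ c, Y a (c - a * b) * Y a' (c - a' * b) := by
    simp only [sq, Finset.sum_mul_sum]
    rw [Finset.sum_congr rfl fun b _ => Finset.sum_comm, Finset.sum_comm]
    refine Finset.sum_congr rfl fun a _ => ?_
    rw [Finset.sum_congr rfl fun b _ => Finset.sum_comm, Finset.sum_comm]
  rw [h2]
  simp only [h1]
  -- The mixed terms are completed to a product with the total sum, which is zero. Only a negative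
  -- sum of squares remains besides the main term.
  have h3 : ∀ a, ∑ a', (if a = a' then Fintype.card F * ∑ e, Y a e ^ 2 else
      (∑ e, Y a e) * ∑ e, Y a' e) =
      Fintype.card F * ∑ e, Y a e ^ 2 + (∑ e, Y a e) * (∑ a', ∑ e, Y a' e) - (∑ e, Y a e) ^ 2 := by
    intro a
    have : ∀ a', (if a = a' then Fintype.card F * ∑ e, Y a e ^ 2 else
        (∑ e, Y a e) * ∑ e, Y a' e) = (∑ e, Y a e) * (∑ e, Y a' e) +
        if a = a' then Fintype.card F * ∑ e, Y a e ^ 2 - (∑ e, Y a e) ^ 2 else 0 := by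
      intro a'
      split_ifs with h
      · subst h
        ring
      · ring
    simp only [this, Finset.sum_add_distrib, Finset.sum_ite_eq, Finset.mem_univ, if_true,
      ← Finset.mul_sum]
    ring
  simp only [h3, hY, mul_zero, add_zero, Finset.sum_sub_distrib, ← Finset.mul_sum]
  have : 0 ≤ ∑ a, (∑ e, Y a e) ^ 2 := Finset.sum_nonneg fun a _ => sq_nonneg _
  linarith

theorem incidence_sq_le (X Y : F → F → ℝ) (hY : ∑ a, ∑ e, Y a e = 0) :
    (∑ b, ∑ c, X b c * ∑ a, Y a (c - a * b)) ^ 2 ≤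
      Fintype.card F * ((∑ b, ∑ c, X b c ^ 2) * ∑ a, ∑ e, Y a e ^ 2) := by
  rw [← Fintype.sum_prod_type', ← Fintype.sum_prod_type' (f := fun b c => X b c ^ 2)]
  refine (Finset.sum_mul_sq_le_sq_mul_sq _ _ _).trans ?_
  have h1 := sum_incidence_sq_le Y hY
  rw [← Fintype.sum_prod_type'] at h1
  have h2 : 0 ≤ ∑ p : F × F, X p.1 p.2 ^ 2 := Finset.sum_nonneg fun _ _ => sq_nonneg _
  calc _ ≤ _ := mul_le_mul_of_nonneg_left h1 h2
    _ = _ := by ring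

end Incidence

/-! ### Local expansion in the cosets -/

namespace HeisenbergTriple

/-- The local expansion constant. -/
noncomputable def expansion (F : Type*) [Fintype F] : ℝ := (Real.sqrt (Fintype.card F))⁻¹

theorem expansion_nonneg {F : Type*} [Fintype F] : 0 ≤ expansion F := inv_nonneg.2 (Real.sqrt_nonneg _)

theorem expansion_sq {F : Type*} [Fintype F] : expansion F ^ 2 = (Fintype.card F : ℝ)⁻¹ := by
  rw [expansion, inv_pow, Real.sq_sqrt (Nat.cast_nonneg _)]

theorem expansion_lt_one {F : Type*} [Fintype F] [Nontrivial F] : expansion F < 1 := by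
  refine inv_lt_one_of_one_lt₀ ?_
  rw [Real.lt_sqrt zero_le_one, one_pow]
  exact_mod_cast Fintype.one_lt_card

variable {F : Type*} [Field F] {Γ : Type*} [Group Γ] {H : HeisenbergTriple F Γ}

theorem IsInv.apply_k_add_one {T : Type*} {i : Fin 3} {x : Γ → T} (hx : H.IsInv (i + 1) x)
    (g : Γ) (a b c : F) : x (g * H.k i a b c) = x (g * H.k i 0 b c) := by
  have := H.k_mul_h_add_one i 0 b c a
  rw [zero_add] at this
  rw [← this, ← mul_assoc, hx]

theorem IsInv.apply_k_add_two {T : Type*} {i : Fin 3} {y : Γ → T} (hy : H.IsInv (i + 2) y)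
    (g : Γ) (a b c : F) : y (g * H.k i a b c) = y (g * H.k i a 0 (c - a * b)) := by
  have := H.k_mul_h_add_two i a 0 (c - a * b) b
  rw [zero_add, sub_add_cancel] at this
  rw [← this, ← mul_assoc, hy]

variable [Fintype F]

/-- On the coset, `x` is a function of the point `(b, c)` and `y` of the line `(a, c - a * b)`, so
this is the incidence bound. The factor `q⁻¹` stays inside the sum so that the coset bounds can be
added by Cauchy–Schwarz. -/
theorem sum_coset_sq_le {i : Fin 3} {x y : Γ → ℝ} (hx : H.IsInv (i + 1) x)
    (hy : H.IsInv (i + 2) y) (hy0 : ∀ g, H.avg i y g = 0) (g : Γ) :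
    (∑ p : F × F × F, x (g * H.k i p.1 p.2.1 p.2.2) * y (g * H.k i p.1 p.2.1 p.2.2)) ^ 2 ≤
      (∑ p : F × F × F, (Fintype.card F : ℝ)⁻¹ * x (g * H.k i p.1 p.2.1 p.2.2) ^ 2) *
      ∑ p : F × F × F, y (g * H.k i p.1 p.2.1 p.2.2) ^ 2 := by
  set q : ℝ := (Fintype.card F : ℝ) with hq
  have hq0 : 0 < q := Nat.cast_pos.2 Fintype.card_pos
  set X : F → F → ℝ := fun b c => x (g * H.k i 0 b c)
  set Y : F → F → ℝ := fun a e => y (g * H.k i a 0 e)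
  have hshift : ∀ (Z : F → F → ℝ), ∑ a, ∑ b, ∑ c, Z a (c - a * b) = q * ∑ a, ∑ e, Z a e := by
    intro Z
    have : ∀ a b, ∑ c, Z a (c - a * b) = ∑ e, Z a e := fun a b =>
      Fintype.sum_equiv (Equiv.subRight (a * b)) _ _ fun c => rfl
    simp only [this, Finset.sum_const, Finset.card_univ, nsmul_eq_mul, ← Finset.mul_sum, hq]
  have ex : ∀ a b c, x (g * H.k i a b c) = X b c := hx.apply_k_add_one g
  have ey : ∀ a b c, y (g * H.k i a b c) = Y a (c - a * b) := hy.apply_k_add_two g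
  simp only [Fintype.sum_prod_type, ex, ey]
  have h1 : ∑ a, ∑ b, ∑ c, X b c * Y a (c - a * b) =
      ∑ b, ∑ c, X b c * ∑ a, Y a (c - a * b) := by
    rw [Finset.sum_comm]
    refine Finset.sum_congr rfl fun b _ => ?_
    rw [Finset.sum_comm]
    simp only [Finset.mul_sum]
  have hY0 : ∑ a, ∑ e, Y a e = 0 := by
    have h2 := hy0 g
    unfold avg at h2
    simp only [Fintype.sum_prod_type, ey] at h2
    rw [hshift Y, mul_eq_zero, mul_eq_zero] at h2
    rcases h2 with h2 | h2 | h2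
    · exact absurd h2 (inv_ne_zero (card_pow_pos 3).ne')
    · exact absurd h2 hq0.ne'
    · exact h2
  have h3 := incidence_sq_le X Y hY0
  have h4 := hshift fun a e => Y a e ^ 2
  have h5 : ∑ _a : F, ∑ b, ∑ c, q⁻¹ * X b c ^ 2 = ∑ b, ∑ c, X b c ^ 2 := by
    simp only [Finset.sum_const, Finset.card_univ, nsmul_eq_mul, ← Finset.mul_sum]
    rw [← hq, mul_inv_cancel_left₀ hq0.ne']
  refine le_of_eq_of_le (congrArg (fun t => t ^ 2) h1) (h3.trans_eq ?_)
  refine Eq.trans ?_ (congrArg₂ (fun s t => s * t) h5.symm h4.symm)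
  ring

theorem avg_sub (i : Fin 3) (x y : Γ → ℝ) (g : Γ) :
    H.avg i (fun g => x g - y g) g = H.avg i x g - H.avg i y g := by
  simp only [avg, Finset.sum_sub_distrib, mul_sub]

theorem avg_of_isInv {i : Fin 3} {y : Γ → ℝ} (h₁ : H.IsInv (i + 1) y) (h₂ : H.IsInv (i + 2) y)
    (g : Γ) : H.avg i y g = y g := by
  have : (Fintype.card F : ℝ) ≠ 0 := Nat.cast_ne_zero.2 Fintype.card_ne_zero
  simp only [avg, h₁.apply_k h₂, Finset.sum_const, Finset.card_univ, Fintype.card_prod,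
    nsmul_eq_mul, Nat.cast_mul]
  field_simp

variable [Fintype Γ]

theorem sum_mul_sq_le_of_avg_eq_zero {i : Fin 3} {x y : Γ → ℝ} (hx : H.IsInv (i + 1) x)
    (hy : H.IsInv (i + 2) y) (hy0 : ∀ g, H.avg i y g = 0) :
    (∑ g, x g * y g) ^ 2 ≤ (Fintype.card F : ℝ)⁻¹ * ((∑ g, x g ^ 2) * ∑ g, y g ^ 2) := by
  have h1 := Finset.sum_sq_le_sum_mul_sum_of_sq_le_mul (Finset.univ : Finset Γ)
    (r := fun g => ∑ p : F × F × F, x (g * H.k i p.1 p.2.1 p.2.2) * y (g * H.k i p.1 p.2.1 p.2.2))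
    (f := fun g => ∑ p : F × F × F, (Fintype.card F : ℝ)⁻¹ * x (g * H.k i p.1 p.2.1 p.2.2) ^ 2)
    (g := fun g => ∑ p : F × F × F, y (g * H.k i p.1 p.2.1 p.2.2) ^ 2)
    (fun g _ => Finset.sum_nonneg fun p _ => by positivity)
    (fun g _ => Finset.sum_nonneg fun p _ => by positivity)
    (fun g _ => sum_coset_sq_le hx hy hy0 g)
  rw [sum_sum_mul_k (H := H) i fun g => x g * y g,
    sum_sum_mul_k (H := H) i fun g => (Fintype.card F : ℝ)⁻¹ * x g ^ 2,
    sum_sum_mul_k (H := H) i fun g => y g ^ 2, ← Finset.mul_sum] at h1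
  have h2 := card_pow_pos (F := F) 3
  have h3 : 0 < ((Fintype.card F : ℝ) ^ 3) ^ 2 := by positivity
  refine le_of_mul_le_mul_left ?_ h3
  calc _ = _ := by ring
    _ ≤ _ := h1
    _ = _ := by ring

theorem sum_mul_le_of_avg_eq_zero {i : Fin 3} {x y : Γ → ℝ} (hx : H.IsInv (i + 1) x)
    (hy : H.IsInv (i + 2) y) (hy0 : ∀ g, H.avg i y g = 0) :
    ∑ g, x g * y g ≤
      expansion F * (Real.sqrt (∑ g, x g ^ 2) * Real.sqrt (∑ g, y g ^ 2)) := by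
  refine le_of_sq_le_sq ?_ (mul_nonneg expansion_nonneg (by positivity))
  rw [mul_pow, mul_pow, Real.sq_sqrt (Finset.sum_nonneg fun _ _ => sq_nonneg _),
    Real.sq_sqrt (Finset.sum_nonneg fun _ _ => sq_nonneg _), expansion_sq]
  exact sum_mul_sq_le_of_avg_eq_zero hx hy hy0

/-- Mixing within cosets: the part of `y` orthogonal to the functions on cosets is controlled by the
expansion constant, and the rest is the product of averages. -/
theorem sum_mul_le {i : Fin 3} {x y : Γ → ℝ} (hx : H.IsInv (i + 1) x) (hy : H.IsInv (i + 2) y) :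
    ∑ g, x g * y g ≤ ∑ g, H.avg i x g * H.avg i y g +
      expansion F * (Real.sqrt (∑ g, x g ^ 2) * Real.sqrt (∑ g, y g ^ 2)) := by
  have hA₁ := avg_isInv_add_one (H := H) i y
  have hA₂ := avg_isInv_add_two (H := H) i y
  have h1 := sum_mul_le_of_avg_eq_zero (H := H) (i := i) (x := x)
    (y := fun g => y g - H.avg i y g) hx
    (fun g α => by simp only [hy g α, hA₂ g α])
    (fun g => by rw [avg_sub, avg_of_isInv hA₁ hA₂, sub_self])
  have h2 : ∑ g, H.avg i x g * H.avg i y g = ∑ g, x g * H.avg i y g := by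
    simp only [mul_comm (H.avg i x _), mul_comm (x _)]
    exact sum_avg_mul_avg i y x
  have h3 : ∑ g, (y g - H.avg i y g) ^ 2 ≤ ∑ g, y g ^ 2 := by
    have h4 := sum_avg_mul_avg (H := H) i y y
    have h5 : ∑ g, (y g - H.avg i y g) ^ 2 = ∑ g, y g ^ 2 - 2 * ∑ g, H.avg i y g * y g +
        ∑ g, H.avg i y g * H.avg i y g := by
      rw [Finset.mul_sum, ← Finset.sum_sub_distrib, ← Finset.sum_add_distrib]
      exact Finset.sum_congr rfl fun g _ => by ring
    have h6 : 0 ≤ ∑ g, H.avg i y g * H.avg i y g :=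
      Finset.sum_nonneg fun _ _ => mul_self_nonneg _
    linarith
  have h7 : ∑ g, x g * (y g - H.avg i y g) = ∑ g, x g * y g - ∑ g, x g * H.avg i y g := by
    simp only [mul_sub, Finset.sum_sub_distrib]
  have h8 : expansion F * (Real.sqrt (∑ g, x g ^ 2) * Real.sqrt (∑ g, (y g - H.avg i y g) ^ 2)) ≤
      expansion F * (Real.sqrt (∑ g, x g ^ 2) * Real.sqrt (∑ g, y g ^ 2)) :=
    mul_le_mul_of_nonneg_left (mul_le_mul_of_nonneg_left (Real.sqrt_le_sqrt h3)
      (Real.sqrt_nonneg _)) expansion_nonneg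
  linarith

end HeisenbergTriple

/-! ### Global expansion -/

namespace HeisenbergTriple

open scoped InnerProductSpace

variable {F : Type*} [Field F] {Γ : Type*} [Group Γ] (H : HeisenbergTriple F Γ) [Fintype Γ]

/-- The functions of mean zero that are invariant under the one-parameter subgroup `h j`. -/
def invSubspace (j : Fin 3) : Submodule ℝ (EuclideanSpace ℝ Γ) where
  carrier := {v | H.IsInv j (fun g => v g) ∧ ∑ g, v g = 0}
  add_mem' := fun {v w} hv hw => ⟨fun g α => by
    have h1 := hv.1 g α
    have h2 := hw.1 g α
    simp only [PiLp.add_apply] at h1 h2 ⊢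
    rw [h1, h2], by
    simp only [PiLp.add_apply, Finset.sum_add_distrib, hv.2, hw.2, add_zero]⟩
  zero_mem' := ⟨fun g α => rfl, by simp⟩
  smul_mem' := fun r v hv => ⟨fun g α => by
    have h1 := hv.1 g α
    simp only [PiLp.smul_apply] at h1 ⊢
    rw [h1], by
    simp only [PiLp.smul_apply, ← Finset.smul_sum, hv.2, smul_zero]⟩

theorem inner_eq_sum (x y : EuclideanSpace ℝ Γ) : ⟪x, y⟫_ℝ = ∑ g, x g * y g := by
  simp only [PiLp.inner_apply, RCLike.inner_apply, conj_trivial, mul_comm]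

theorem norm_eq_sqrt (x : EuclideanSpace ℝ Γ) : ‖x‖ = Real.sqrt (∑ g, x g ^ 2) := by
  simp only [EuclideanSpace.norm_eq, Real.norm_eq_abs, sq_abs]

variable {H} [Fintype F]

theorem isLocallyExpanding : IsLocallyExpanding H.invSubspace (expansion F) := by
  intro i x hx y hy _ hy0
  rw [inner_eq_sum, norm_eq_sqrt, norm_eq_sqrt]
  refine sum_mul_le_of_avg_eq_zero hx.1 hy.1 ?_
  set Y : Γ → ℝ := fun g => y g with hY
  have hA₁ := avg_isInv_add_one (H := H) i Y
  have hA₂ := avg_isInv_add_two (H := H) i Y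
  have hA0 : ∑ g, H.avg i Y g = 0 := by rw [sum_avg, hY, hy.2]
  -- Testing the orthogonality of `y` against its own average shows that the average is zero.
  have h1 := hy0 (WithLp.toLp 2 (H.avg i Y)) ⟨⟨hA₁, hA0⟩, ⟨hA₂, hA0⟩⟩
  rw [inner_eq_sum] at h1
  have h2 : ∑ g, H.avg i Y g * H.avg i Y g = 0 := by
    rw [sum_avg_mul_avg]
    exact h1
  have h3 := (Finset.sum_eq_zero_iff_of_nonneg fun g _ => mul_self_nonneg (H.avg i Y g)).1 h2
  exact fun g => mul_self_eq_zero.1 (h3 g (Finset.mem_univ g))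

theorem eq_zero_of_mem_invSubspace (v : EuclideanSpace ℝ Γ) (h : ∀ j, v ∈ H.invSubspace j) :
    v = 0 := by
  have h1 : ∀ g, v g = v 1 := fun g => eq_of_isInv (fun j => (h j).1) g 1
  have h2 := (h 0).2
  simp only [h1, Finset.sum_const, Finset.card_univ, nsmul_eq_mul, mul_eq_zero, Nat.cast_eq_zero,
    Fintype.card_ne_zero, false_or] at h2
  ext g
  rw [h1, h2]
  rfl

/-- The part of mean zero of a function. -/
noncomputable def center (x : Γ → ℝ) : EuclideanSpace ℝ Γ :=
  WithLp.toLp 2 fun g => x g - (∑ g, x g) / Fintype.card Γ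

theorem sum_center (x : Γ → ℝ) : ∑ g, center x g = 0 := by
  have : (Fintype.card Γ : ℝ) ≠ 0 := Nat.cast_ne_zero.2 Fintype.card_ne_zero
  simp only [center, Finset.sum_sub_distrib, Finset.sum_const, Finset.card_univ, nsmul_eq_mul]
  rw [mul_div_cancel₀ _ this, sub_self]

theorem center_mem {j : Fin 3} {x : Γ → ℝ} (hx : H.IsInv j x) : center x ∈ H.invSubspace j :=
  ⟨fun g α => by simp only [center, hx g α], sum_center x⟩

theorem inner_center (x y : Γ → ℝ) :
    ⟪center x, center y⟫_ℝ = ∑ g, x g * y g - (∑ g, x g) * (∑ g, y g) / Fintype.card Γ := by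
  have hN : (Fintype.card Γ : ℝ) ≠ 0 := Nat.cast_ne_zero.2 Fintype.card_ne_zero
  rw [inner_eq_sum]
  simp only [center, sub_mul, mul_sub, Finset.sum_sub_distrib, Finset.sum_const, Finset.card_univ,
    nsmul_eq_mul, ← Finset.sum_mul, ← Finset.mul_sum]
  field_simp
  ring

theorem norm_center_sq (x : Γ → ℝ) :
    ‖center x‖ ^ 2 = ∑ g, x g ^ 2 - (∑ g, x g) ^ 2 / Fintype.card Γ := by
  rw [← real_inner_self_eq_norm_sq, inner_center]
  simp only [sq]

theorem norm_center_le (x : Γ → ℝ) : ‖center x‖ ≤ Real.sqrt (∑ g, x g ^ 2) := by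
  refine Real.le_sqrt_of_sq_le ?_
  rw [norm_center_sq]
  have : 0 ≤ (∑ g, x g) ^ 2 / Fintype.card Γ := by positivity
  linarith

variable (F) in
/-- The global expansion constant. -/
noncomputable def globalExpansion (F : Type*) [Fintype F] : ℝ := expansion F / (1 - expansion F)

theorem globalExpansion_nonneg : 0 ≤ globalExpansion F :=
  div_nonneg expansion_nonneg (by linarith [expansion_lt_one (F := F)])

/-- Here `x` and `y` are functions of the cosets of types `i` and `i + 1`, so this is an expander
mixing lemma between two types of cosets. -/
theorem sum_mul_le_global (i : Fin 3) {x y : Γ → ℝ} (hx₁ : H.IsInv (i + 1) x)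
    (hx₂ : H.IsInv (i + 2) x) (hy₁ : H.IsInv (i + 2) y) (hy₂ : H.IsInv i y) :
    ∑ g, x g * y g ≤ (∑ g, x g) * (∑ g, y g) / Fintype.card Γ +
      globalExpansion F * (Real.sqrt (∑ g, x g ^ 2) * Real.sqrt (∑ g, y g ^ 2)) := by
  have h1 := (isLocallyExpanding (H := H)).inner_le_of_mem expansion_nonneg expansion_lt_one
    eq_zero_of_mem_invSubspace i (u := center x) (v := center y)
    ⟨center_mem hx₁, center_mem hx₂⟩ ⟨center_mem hy₁, center_mem hy₂⟩
  rw [inner_center] at h1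
  have h2 : expansion F / (1 - expansion F) * (‖center x‖ * ‖center y‖) ≤
      globalExpansion F * (Real.sqrt (∑ g, x g ^ 2) * Real.sqrt (∑ g, y g ^ 2)) :=
    mul_le_mul_of_nonneg_left (mul_le_mul (norm_center_le x) (norm_center_le y) (norm_nonneg _)
      (Real.sqrt_nonneg _)) globalExpansion_nonneg
  linarith

/-- Cosets of type `i` are transverse to lines of type `i`, so a sparse set of such lines is spread
almost evenly over the cosets. The pairing of `x` with its average is the squared norm of the
average, up to the means. -/
theorem sum_avg_sq_le (i : Fin 3) {x : Γ → ℝ} (hx : H.IsInv i x) :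
    ∑ g, H.avg i x g ^ 2 ≤ (∑ g, x g) ^ 2 / Fintype.card Γ +
      (globalExpansion F + expansion F) ^ 2 * ∑ g, x g ^ 2 := by
  set μ := globalExpansion F + expansion F with hμ
  have hμ0 : 0 ≤ μ := add_nonneg globalExpansion_nonneg expansion_nonneg
  have h1 := (isLocallyExpanding (H := H)).inner_le_of_mem_opposite expansion_nonneg
    expansion_lt_one eq_zero_of_mem_invSubspace i (x := center x) (y := center (H.avg i x))
    (center_mem hx) ⟨center_mem (avg_isInv_add_one i x), center_mem (avg_isInv_add_two i x)⟩
  have h2 : ⟪center x, center (H.avg i x)⟫_ℝ = ‖center (H.avg i x)‖ ^ 2 := by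
    rw [inner_center, norm_center_sq, sum_avg]
    have := sum_avg_mul_avg (H := H) i x x
    simp only [sq]
    rw [this]
    simp only [mul_comm]
  rw [h2] at h1
  change _ ≤ μ * _ at h1
  have h3 : ‖center (H.avg i x)‖ ≤ μ * ‖center x‖ := by
    rcases (norm_nonneg (center (H.avg i x))).eq_or_lt with h | h
    · rw [← h]
      positivity
    · nlinarith
  have h4 : ‖center (H.avg i x)‖ ^ 2 ≤ μ ^ 2 * ∑ g, x g ^ 2 := by
    calc _ ≤ (μ * ‖center x‖) ^ 2 := pow_le_pow_left₀ (norm_nonneg _) h3 2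
      _ = μ ^ 2 * ‖center x‖ ^ 2 := by ring
      _ ≤ μ ^ 2 * ∑ g, x g ^ 2 := by
        refine mul_le_mul_of_nonneg_left ?_ (sq_nonneg _)
        rw [norm_center_sq]
        have : 0 ≤ (∑ g, x g) ^ 2 / Fintype.card Γ := by positivity
        linarith
  rw [norm_center_sq, sum_avg] at h4
  linarith

end HeisenbergTriple

/-! ### Indicator functions -/

section Indicator

variable {Γ : Type*}

open Classical in
/-- The real-valued indicator function of a predicate. -/
noncomputable def ind (P : Γ → Prop) (g : Γ) : ℝ := if P g then 1 else 0

theorem ind_of {P : Γ → Prop} {g : Γ} (h : P g) : ind P g = 1 := if_pos h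

theorem ind_of_not {P : Γ → Prop} {g : Γ} (h : ¬ P g) : ind P g = 0 := if_neg h

theorem ind_nonneg (P : Γ → Prop) (g : Γ) : 0 ≤ ind P g := by
  unfold ind
  split_ifs <;> norm_num

theorem ind_le_one (P : Γ → Prop) (g : Γ) : ind P g ≤ 1 := by
  unfold ind
  split_ifs <;> norm_num

theorem ind_sq (P : Γ → Prop) (g : Γ) : ind P g ^ 2 = ind P g := by
  unfold ind
  split_ifs <;> norm_num

theorem ind_le_of_imp {P : Γ → Prop} {g : Γ} {r : ℝ} (h0 : 0 ≤ r) (h : P g → 1 ≤ r) :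
    ind P g ≤ r := by
  unfold ind
  split_ifs with h'
  · exact h h'
  · exact h0

theorem ind_congr {Γ' : Type*} {P : Γ → Prop} {P' : Γ' → Prop} {g : Γ} {g' : Γ'}
    (h : P g ↔ P' g') : ind P g = ind P' g' := by
  by_cases hP : P g
  · rw [ind_of hP, ind_of (h.1 hP)]
  · rw [ind_of_not hP, ind_of_not fun hP' => hP (h.2 hP')]

theorem sum_ind [Fintype Γ] (P : Γ → Prop) [DecidablePred P] :
    ∑ g, ind P g = (Finset.univ.filter P).card := by
  rw [Finset.card_filter]
  push_cast
  refine Finset.sum_congr rfl fun g _ => ?_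
  by_cases hP : P g
  · rw [ind_of hP, if_pos hP]
  · rw [ind_of_not hP, if_neg hP]

end Indicator

/-! ### Mixing of lines within a coset -/

namespace HeisenbergTriple

variable {F : Type*} [Field F] {Γ : Type*} [Group Γ] {H : HeisenbergTriple F Γ}

variable (H) in
/-- The functions with degree at most `d` on all lines. -/
def IsCodeword (d : ℕ) (f : Γ → F) : Prop :=
  ∀ i g, (fun α => f (g * H.h i α)) ∈ reedSolomon F d

theorem IsInv.ind {j : Fin 3} {P : Γ → Prop} (h : ∀ g α, P g → P (g * H.h j α)) :
    H.IsInv j (ind P) := by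
  intro g α
  refine ind_congr ⟨fun hg => ?_, h g α⟩
  have := h _ (-α) hg
  rwa [mul_assoc, H.h_add, add_neg_cancel, H.h_zero, mul_one] at this

variable [Fintype F]

theorem sum_coset_mul_h_add_one (i : Fin 3) (x : Γ → ℝ) (g : Γ) (α : F) :
    ∑ p : F × F × F, x (g * H.k i p.1 p.2.1 p.2.2 * H.h (i + 1) α) =
      ∑ p : F × F × F, x (g * H.k i p.1 p.2.1 p.2.2) := by
  refine Fintype.sum_equiv
    ⟨fun p : F × F × F => (p.1 + α, p.2.1, p.2.2), fun p => (p.1 - α, p.2.1, p.2.2),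
      fun p => by simp, fun p => by simp⟩ _ _ fun p => ?_
  rw [mul_assoc, H.k_mul_h_add_one]
  rfl

theorem sum_coset_mul_h_add_two (i : Fin 3) (x : Γ → ℝ) (g : Γ) (β : F) :
    ∑ p : F × F × F, x (g * H.k i p.1 p.2.1 p.2.2 * H.h (i + 2) β) =
      ∑ p : F × F × F, x (g * H.k i p.1 p.2.1 p.2.2) := by
  refine Fintype.sum_equiv
    ⟨fun p : F × F × F => (p.1, p.2.1 + β, p.2.2 + p.1 * β),
      fun p => (p.1, p.2.1 - β, p.2.2 - p.1 * β), fun p => by simp, fun p => by simp⟩ _ _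
      fun p => ?_
  rw [mul_assoc, H.k_mul_h_add_two]
  rfl

theorem avg_mono (i : Fin 3) {x y : Γ → ℝ} (h : ∀ g, x g ≤ y g) (g : Γ) :
    H.avg i x g ≤ H.avg i y g :=
  mul_le_mul_of_nonneg_left (Finset.sum_le_sum fun _ _ => h _) (inv_nonneg.2 (card_pow_pos 3).le)

theorem avg_nonneg (i : Fin 3) {x : Γ → ℝ} (h : ∀ g, 0 ≤ x g) (g : Γ) : 0 ≤ H.avg i x g :=
  mul_nonneg (inv_nonneg.2 (card_pow_pos 3).le) (Finset.sum_nonneg fun _ _ => h _)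

/-- If every line of type `j` has at most `x` as much weight for `y` as for `s`, then this holds on
average over the cosets that contain lines of this type. -/
theorem mul_avg_le_avg {i j : Fin 3} (hj : j = i + 1 ∨ j = i + 2) {r : ℝ} {y s : Γ → ℝ}
    (h : ∀ g, r * y g ≤ ∑ α, s (g * H.h j α)) (g : Γ) :
    r * H.avg i y g ≤ Fintype.card F * H.avg i s g := by
  have h1 : ∑ p : F × F × F, r * y (g * H.k i p.1 p.2.1 p.2.2) ≤
      Fintype.card F * ∑ p : F × F × F, s (g * H.k i p.1 p.2.1 p.2.2) := by
    refine (Finset.sum_le_sum fun p _ => h _).trans_eq ?_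
    rw [Finset.sum_comm]
    rcases hj with rfl | rfl
    · simp only [sum_coset_mul_h_add_one, Finset.sum_const, Finset.card_univ, nsmul_eq_mul]
    · simp only [sum_coset_mul_h_add_two, Finset.sum_const, Finset.card_univ, nsmul_eq_mul]
  rw [← Finset.mul_sum] at h1
  have h2 := mul_le_mul_of_nonneg_left h1 (inv_nonneg.2 (card_pow_pos (F := F) 3).le)
  unfold avg
  linarith

/-- The incidence bound is applied to `ind P'` minus its density on the coset, whose mean square is
the variance and is at most that density. -/
theorem avg_mul_le (i : Fin 3) {P P' : Γ → Prop} (hP : H.IsInv (i + 1) (ind P))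
    (hP' : H.IsInv (i + 2) (ind P')) (g : Γ) :
    H.avg i (fun g => ind P g * ind P' g) g ≤ H.avg i (ind P) g * H.avg i (ind P') g +
      expansion F * Real.sqrt (H.avg i (ind P) g * H.avg i (ind P') g) := by
  set x := ind P with hx
  set y := ind P' with hy
  have hA₁ := avg_isInv_add_one (H := H) i y
  have hA₂ := avg_isInv_add_two (H := H) i y
  have h1 := sum_coset_sq_le (H := H) (i := i) (x := x)
    (y := fun g => y g - H.avg i y g) hP
    (fun g α => by simp only [hP' g α, hA₂ g α])
    (fun g => by rw [avg_sub, avg_of_isInv hA₁ hA₂, sub_self]) g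
  set n : ℝ := (Fintype.card F : ℝ) ^ 3 with hn
  have hn0 : 0 < n := card_pow_pos 3
  set p := H.avg i x g with hp
  set r := H.avg i y g with hr
  have hp0 : 0 ≤ p := avg_nonneg i (ind_nonneg P) g
  have hr0 : 0 ≤ r := avg_nonneg i (ind_nonneg P') g
  have ep : ∑ t : F × F × F, x (g * H.k i t.1 t.2.1 t.2.2) = n * p := by
    rw [hp, avg, mul_inv_cancel_left₀ hn0.ne']
  have er : ∑ t : F × F × F, y (g * H.k i t.1 t.2.1 t.2.2) = n * r := by
    rw [hr, avg, mul_inv_cancel_left₀ hn0.ne']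
  have ec : (Finset.univ : Finset (F × F × F)).card = n := by
    rw [Finset.card_univ, Fintype.card_prod, Fintype.card_prod, hn]
    push_cast
    ring
  have exy : ∑ t : F × F × F, x (g * H.k i t.1 t.2.1 t.2.2) * y (g * H.k i t.1 t.2.1 t.2.2) =
      n * H.avg i (fun g => x g * y g) g := by
    rw [avg, mul_inv_cancel_left₀ hn0.ne']
  simp only [hA₁.apply_k hA₂, mul_sub, Finset.sum_sub_distrib, ← Finset.sum_mul, exy, ep] at h1
  have e2 : ∑ t : F × F × F, (y (g * H.k i t.1 t.2.1 t.2.2) - r) ^ 2 = n * (r - r ^ 2) := by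
    simp only [sub_sq, hy, ind_sq, Finset.sum_add_distrib, Finset.sum_sub_distrib, ← Finset.mul_sum,
      ← Finset.sum_mul, Finset.sum_const, nsmul_eq_mul, ec]
    rw [← hy, er]
    ring
  have e1 : ∑ t : F × F × F, (Fintype.card F : ℝ)⁻¹ * x (g * H.k i t.1 t.2.1 t.2.2) ^ 2 =
      expansion F ^ 2 * (n * p) := by
    simp only [hx, ind_sq]
    rw [← Finset.mul_sum, ← hx, ep, expansion_sq]
  rw [e1] at h1
  change _ ≤ _ * ∑ t : F × F × F, (y (g * H.k i t.1 t.2.1 t.2.2) - r) ^ 2 at h1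
  rw [e2] at h1
  set m := H.avg i (fun g => x g * y g) g
  have h2 : (m - p * r) ^ 2 ≤ (expansion F * Real.sqrt (p * r)) ^ 2 := by
    rw [mul_pow, Real.sq_sqrt (mul_nonneg hp0 hr0)]
    have h3 : n ^ 2 * (m - p * r) ^ 2 ≤ n ^ 2 * (expansion F ^ 2 * (p * (r - r ^ 2))) := by
      refine le_of_eq_of_le ?_ (h1.trans_eq ?_)
      · rw [← hr]
        ring
      · ring
    have h4 := le_of_mul_le_mul_left h3 (by positivity)
    have h5 : 0 ≤ expansion F ^ 2 * (p * r ^ 2) := by positivity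
    nlinarith
  have h6 := abs_le_of_sq_le_sq h2 (mul_nonneg expansion_nonneg (Real.sqrt_nonneg _))
  linarith [le_abs_self (m - p * r)]

end HeisenbergTriple

/-! ### Distance of the code -/

namespace HeisenbergTriple

variable {F : Type*} [Field F] {Γ : Type*} [Group Γ] {H : HeisenbergTriple F Γ}

variable (H) in
/-- The lines of type `j` on which two words differ. -/
def DiffersOnLine (f f' : Γ → F) (j : Fin 3) (g : Γ) : Prop :=
  ∃ α, f (g * H.h j α) ≠ f' (g * H.h j α)

theorem DiffersOnLine.mul_h {f f' : Γ → F} {j : Fin 3} {g : Γ} (h : H.DiffersOnLine f f' j g)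
    (β : F) : H.DiffersOnLine f f' j (g * H.h j β) := by
  obtain ⟨α, hα⟩ := h
  refine ⟨α - β, ?_⟩
  rwa [mul_assoc, H.h_add, add_sub_cancel]

theorem differsOnLine_of_ne {f f' : Γ → F} {g : Γ} (j : Fin 3) (h : f g ≠ f' g) :
    H.DiffersOnLine f f' j g := ⟨0, by rwa [H.h_zero, mul_one]⟩

theorem isInv_differsOnLine (f f' : Γ → F) (j : Fin 3) :
    H.IsInv j (ind (H.DiffersOnLine f f' j)) :=
  IsInv.ind fun _ α h => h.mul_h α

variable (H) in
/-- The cosets of type `i` on which a word does not vanish. -/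
def CosetSupport (f : Γ → F) (i : Fin 3) (g : Γ) : Prop := ∃ a b c, f (g * H.k i a b c) ≠ 0

theorem cosetSupport_of_differsOnLine {f : Γ → F} {i j : Fin 3} (hj : j = i + 1 ∨ j = i + 2)
    {g : Γ} (h : H.DiffersOnLine f 0 j g) : H.CosetSupport f i g := by
  obtain ⟨α, hα⟩ := h
  rcases hj with rfl | rfl
  · have := H.k_mul_h_add_one i 0 0 0 α
    rw [H.k_zero, one_mul] at this
    exact ⟨_, _, _, by rw [← this]; exact hα⟩
  · have := H.k_mul_h_add_two i 0 0 0 α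
    rw [H.k_zero, one_mul] at this
    exact ⟨_, _, _, by rw [← this]; exact hα⟩

theorem isInv_cosetSupport_add_one (f : Γ → F) (i : Fin 3) :
    H.IsInv (i + 1) (ind (H.CosetSupport f i)) := by
  refine IsInv.ind fun g α h => ?_
  obtain ⟨a, b, c, h⟩ := h
  refine ⟨a - α, b, c - α * b, ?_⟩
  rwa [mul_assoc, H.h_add_one_mul_k, sub_add_cancel, sub_add_cancel]

theorem isInv_cosetSupport_add_two (f : Γ → F) (i : Fin 3) :
    H.IsInv (i + 2) (ind (H.CosetSupport f i)) := by
  refine IsInv.ind fun g α h => ?_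
  obtain ⟨a, b, c, h⟩ := h
  refine ⟨a, b - α, c, ?_⟩
  rwa [mul_assoc, H.h_add_two_mul_k, sub_add_cancel]

variable [Fintype F]

theorem card_sub_mul_ind_le {f f' : Γ → F} {d : ℕ} {j : Fin 3}
    (hf : ∀ g, (fun α => f (g * H.h j α)) ∈ reedSolomon F d)
    (hf' : ∀ g, (fun α => f' (g * H.h j α)) ∈ reedSolomon F d) (g : Γ) :
    ((Fintype.card F : ℝ) - d) * ind (H.DiffersOnLine f f' j) g ≤
      ∑ α, ind (fun g => f g ≠ f' g) (g * H.h j α) := by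
  classical
  by_cases h : H.DiffersOnLine f f' j g
  · rw [ind_of h, mul_one]
    obtain ⟨α, hα⟩ := h
    have h1 := card_le_add_card_ne (hf g) (hf' g) hα
    have h2 : ∑ α, ind (fun g => f g ≠ f' g) (g * H.h j α) =
        ((Finset.univ.filter fun α => f (g * H.h j α) ≠ f' (g * H.h j α)).card : ℝ) := by
      rw [← sum_ind]
      rfl
    rw [h2]
    have h3 : (Fintype.card F : ℝ) ≤
        d + (Finset.univ.filter fun α => f (g * H.h j α) ≠ f' (g * H.h j α)).card := by
      exact_mod_cast h1
    linarith
  · rw [ind_of_not h, mul_zero]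
    exact Finset.sum_nonneg fun _ _ => ind_nonneg _ _

/-- Let p and r be the densities of the nonzero lines of the two families. Each such line is nonzero
on a fraction of at least 5/√q of its points, so the support has density at least 5√(pr)/√q. Mixing
bounds it by pr + √(pr)/√q. Comparing the two leaves √(pr) ≥ 4/√q. -/
theorem four_mul_expansion_le_sqrt {f : Γ → F} {d : ℕ} (hf : H.IsCodeword d f)
    (hd : (d : ℝ) ≤ Fintype.card F - 5 * Real.sqrt (Fintype.card F)) (i : Fin 3) {g : Γ}
    (hg : H.CosetSupport f i g) :
    4 * expansion F ≤ Real.sqrt (H.avg i (ind (H.DiffersOnLine f 0 (i + 1))) g *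
      H.avg i (ind (H.DiffersOnLine f 0 (i + 2))) g) := by
  set q : ℝ := (Fintype.card F : ℝ) with hq
  have hq0 : 0 < q := Nat.cast_pos.2 Fintype.card_pos
  have hsq : 0 < Real.sqrt q := Real.sqrt_pos.2 hq0
  set p := H.avg i (ind (H.DiffersOnLine f 0 (i + 1))) g with hp
  set r := H.avg i (ind (H.DiffersOnLine f 0 (i + 2))) g with hr
  set s := H.avg i (ind fun g => f g ≠ (0 : Γ → F) g) g with hs
  have hp0 : 0 ≤ p := avg_nonneg i (ind_nonneg _) g
  have hr0 : 0 ≤ r := avg_nonneg i (ind_nonneg _) g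
  have h0 : ∀ j g, (fun α => (0 : Γ → F) (g * H.h j α)) ∈ reedSolomon F d := fun j g =>
    zero_mem (reedSolomon F d)
  have h1 : (q - d) * p ≤ q * s := mul_avg_le_avg (Or.inl rfl)
    (card_sub_mul_ind_le (hf (i + 1)) (h0 (i + 1))) g
  have h2 : (q - d) * r ≤ q * s := mul_avg_le_avg (Or.inr rfl)
    (card_sub_mul_ind_le (hf (i + 2)) (h0 (i + 2))) g
  have h3 : s ≤ p * r + expansion F * Real.sqrt (p * r) := by
    refine le_trans (avg_mono i (fun g => ?_) g) (avg_mul_le i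
      (isInv_differsOnLine f 0 (i + 1)) (isInv_differsOnLine f 0 (i + 2)) g)
    refine ind_le_of_imp (mul_nonneg (ind_nonneg _ _) (ind_nonneg _ _)) fun h => ?_
    rw [ind_of (differsOnLine_of_ne (i + 1) h), ind_of (differsOnLine_of_ne (i + 2) h), mul_one]
  have hs0 : 0 < s := by
    obtain ⟨a, b, c, h⟩ := hg
    refine mul_pos (inv_pos.2 (card_pow_pos 3)) ?_
    refine Finset.sum_pos' (fun _ _ => ind_nonneg _ _) ⟨(a, b, c), Finset.mem_univ _, ?_⟩
    rw [ind_of (P := fun g => f g ≠ (0 : Γ → F) g) h]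
    exact one_pos
  set m := Real.sqrt (p * r) with hm
  have hmsq : m ^ 2 = p * r := Real.sq_sqrt (mul_nonneg hp0 hr0)
  have hm0 : 0 < m := by
    refine Real.sqrt_pos.2 (lt_of_le_of_ne (mul_nonneg hp0 hr0) fun h => ?_)
    rw [hm, ← h, Real.sqrt_zero, mul_zero, add_zero] at h3
    linarith
  have hε : expansion F * Real.sqrt q = 1 := inv_mul_cancel₀ hsq.ne'
  have hsqq : Real.sqrt q * Real.sqrt q = q := Real.mul_self_sqrt hq0.le
  have h4 : 5 * Real.sqrt q * m ≤ q * s := by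
    have h5 : 5 * Real.sqrt q * p ≤ q * s :=
      (mul_le_mul_of_nonneg_right (by linarith) hp0).trans h1
    have h6 : 5 * Real.sqrt q * r ≤ q * s :=
      (mul_le_mul_of_nonneg_right (by linarith) hr0).trans h2
    refine le_of_sq_le_sq ?_ (by positivity)
    calc (5 * Real.sqrt q * m) ^ 2 = (5 * Real.sqrt q * p) * (5 * Real.sqrt q * r) := by
          rw [mul_pow, hmsq]
          ring
      _ ≤ (q * s) * (q * s) := mul_le_mul h5 h6 (by positivity) (by positivity)
      _ = _ := by ring
  have h7 : 5 * expansion F * m ≤ s := by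
    have h8 : q * (5 * expansion F * m) = 5 * Real.sqrt q * m := by
      linear_combination (5 * m * Real.sqrt q) * hε - 5 * m * expansion F * hsqq
    exact le_of_mul_le_mul_left (h8.trans_le h4) hq0
  rw [← hmsq] at h3
  nlinarith

variable [Fintype Γ]

theorem sum_cosetSupport_sq_le {f : Γ → F} {d : ℕ} (hf : H.IsCodeword d f)
    (hd : (d : ℝ) ≤ Fintype.card F - 5 * Real.sqrt (Fintype.card F)) (i : Fin 3) :
    (4 * expansion F * ∑ g, ind (H.CosetSupport f i) g) ^ 2 ≤
      (∑ g, ind (H.DiffersOnLine f 0 (i + 1)) g) * ∑ g, ind (H.DiffersOnLine f 0 (i + 2)) g := by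
  rw [← sum_avg (H := H) i (ind (H.DiffersOnLine f 0 (i + 1))),
    ← sum_avg (H := H) i (ind (H.DiffersOnLine f 0 (i + 2))),
    Finset.mul_sum]
  refine Finset.sum_sq_le_sum_mul_sum_of_sq_le_mul _ (fun g _ => avg_nonneg i (ind_nonneg _) g)
    (fun g _ => avg_nonneg i (ind_nonneg _) g) fun g _ => ?_
  by_cases hg : H.CosetSupport f i g
  · rw [ind_of hg, mul_one]
    have h1 := four_mul_expansion_le_sqrt hf hd i hg
    have h2 := pow_le_pow_left₀ (mul_nonneg (by norm_num) expansion_nonneg) h1 2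
    rwa [Real.sq_sqrt (mul_nonneg (avg_nonneg i (ind_nonneg _) g)
      (avg_nonneg i (ind_nonneg _) g))] at h2
  · rw [ind_of_not hg, mul_zero, zero_pow two_ne_zero]
    exact mul_nonneg (avg_nonneg i (ind_nonneg _) g) (avg_nonneg i (ind_nonneg _) g)

theorem sum_differsOnLine_le (f : Γ → F) (i : Fin 3) :
    ∑ g, ind (H.DiffersOnLine f 0 (i + 2)) g ≤
      (∑ g, ind (H.CosetSupport f i) g) * (∑ g, ind (H.CosetSupport f (i + 1)) g) /
        Fintype.card Γ + globalExpansion F * Real.sqrt ((∑ g, ind (H.CosetSupport f i) g) *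
          ∑ g, ind (H.CosetSupport f (i + 1)) g) := by
  have h1 := sum_mul_le_global i (isInv_cosetSupport_add_one (H := H) f i)
    (isInv_cosetSupport_add_two f i)
    (by
      have := isInv_cosetSupport_add_one (H := H) f (i + 1)
      rwa [fin_three_add_one_add_one] at this)
    (by
      have := isInv_cosetSupport_add_two (H := H) f (i + 1)
      rwa [fin_three_add_one_add_two] at this)
  simp only [ind_sq] at h1
  rw [← Real.sqrt_mul (Finset.sum_nonneg fun _ _ => ind_nonneg _ _)] at h1
  refine le_trans (Finset.sum_le_sum fun g _ => ?_) h1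
  refine ind_le_of_imp (mul_nonneg (ind_nonneg _ _) (ind_nonneg _ _)) fun h => ?_
  rw [ind_of (cosetSupport_of_differsOnLine (Or.inr rfl) h),
    ind_of (cosetSupport_of_differsOnLine (Or.inl (fin_three_add_one_add_one i).symm) h), mul_one]

/-- The support of a nonzero codeword has positive density. -/
theorem card_le_sum_support {f : Γ → F} {d : ℕ} (hf : H.IsCodeword d f) (hf0 : f ≠ 0)
    (hd : (d : ℝ) ≤ Fintype.card F - 5 * Real.sqrt (Fintype.card F)) :
    (4 * expansion F - globalExpansion F) * Fintype.card Γ ≤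
      (Fintype.card F : ℝ) ^ 3 * ∑ g, ind (fun g => f g ≠ 0) g := by
  have hN : (0 : ℝ) < Fintype.card Γ := Nat.cast_pos.2 Fintype.card_pos
  set t : Fin 3 → ℝ := fun i => ∑ g, ind (H.CosetSupport f i) g with ht
  set l : Fin 3 → ℝ := fun j => ∑ g, ind (H.DiffersOnLine f 0 j) g with hl
  set c := 4 * expansion F with hc
  have ht0 : ∀ i, 0 < t i := by
    obtain ⟨g, hg⟩ := Function.ne_iff.1 hf0
    intro i
    refine Finset.sum_pos' (fun _ _ => ind_nonneg _ _) ⟨g, Finset.mem_univ _, ?_⟩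
    rw [ind_of ⟨0, 0, 0, by rwa [H.k_zero, mul_one]⟩]
    exact one_pos
  have hl0 : ∀ j, 0 ≤ l j := fun j => Finset.sum_nonneg fun _ _ => ind_nonneg _ _
  have h1 : ∀ i, (c * t i) ^ 2 ≤ l (i + 1) * l (i + 2) := sum_cosetSupport_sq_le hf hd
  have h2 : ∀ i, l (i + 2) ≤ t i * t (i + 1) / Fintype.card Γ +
      globalExpansion F * Real.sqrt (t i * t (i + 1)) := sum_differsOnLine_le f
  have hε : 0 < expansion F := inv_pos.2 (Real.sqrt_pos.2 (Nat.cast_pos.2 Fintype.card_pos))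
  have h3 : ∃ i, (c - globalExpansion F) * Fintype.card Γ ≤ t i := by
    by_contra! h
    -- If all three coset supports are sparse, the main term of the mixing bound is absorbed by the
    -- gap between `c` and the global expansion constant.
    have h4 : ∀ i, l (i + 2) ^ 2 < c ^ 2 * (t i * t (i + 1)) := by
      intro i
      have hs0 : 0 < Real.sqrt (t i * t (i + 1)) := Real.sqrt_pos.2 (mul_pos (ht0 _) (ht0 _))
      have hs2 := Real.sq_sqrt (mul_pos (ht0 i) (ht0 (i + 1))).le
      have hpos : 0 < (c - globalExpansion F) * Fintype.card Γ := (ht0 i).trans (h i)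
      have hs1 : Real.sqrt (t i * t (i + 1)) < (c - globalExpansion F) * Fintype.card Γ := by
        rw [Real.sqrt_lt' hpos, sq]
        exact mul_lt_mul (h i) (h (i + 1)).le (ht0 _) hpos.le
      have h5 := h2 i
      set s := Real.sqrt (t i * t (i + 1))
      rw [← hs2] at h5 ⊢
      have h6 : s ^ 2 / Fintype.card Γ < s * (c - globalExpansion F) := by
        rw [div_lt_iff₀ hN]
        nlinarith
      have h7 : l (i + 2) < c * s := by linarith
      calc l (i + 2) ^ 2 < (c * s) ^ 2 := pow_lt_pow_left₀ h7 (hl0 _) two_ne_zero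
        _ = _ := by ring
    have e0 := h4 0
    have e1 := h4 1
    have e2 := h4 2
    have f0 := h1 0
    have f1 := h1 1
    have f2 := h1 2
    simp only [show (0 : Fin 3) + 1 = 1 from rfl, show (0 : Fin 3) + 2 = 2 from rfl,
      show (1 : Fin 3) + 1 = 2 from rfl, show (1 : Fin 3) + 2 = 0 from rfl,
      show (2 : Fin 3) + 1 = 0 from rfl, show (2 : Fin 3) + 2 = 1 from rfl] at e0 e1 e2 f0 f1 f2
    have hc0 : 0 < c := by positivity
    have t0 := ht0 0
    have t1 := ht0 1
    have t2 := ht0 2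
    -- Multiplied over the three types, the upper bounds `h4` and the lower bounds `h1` involve the
    -- same two products and contradict each other.
    have g1 : l 2 ^ 2 * l 0 ^ 2 * l 1 ^ 2 <
        c ^ 2 * (t 0 * t 1) * (c ^ 2 * (t 1 * t 2)) * (c ^ 2 * (t 2 * t 0)) := by
      have := mul_lt_mul'' (mul_lt_mul'' e0 e1 (sq_nonneg _) (sq_nonneg _)) e2 (by positivity)
        (sq_nonneg _)
      exact this
    have g2 : (c * t 0) ^ 2 * (c * t 1) ^ 2 * (c * t 2) ^ 2 ≤
        (l 1 * l 2) * (l 2 * l 0) * (l 0 * l 1) :=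
      mul_le_mul (mul_le_mul f0 f1 (sq_nonneg _) ((sq_nonneg _).trans f0)) f2 (sq_nonneg _)
        (mul_nonneg ((sq_nonneg _).trans f0) ((sq_nonneg _).trans f1))
    have : (c * t 0) ^ 2 * (c * t 1) ^ 2 * (c * t 2) ^ 2 =
      c ^ 2 * (t 0 * t 1) * (c ^ 2 * (t 1 * t 2)) * (c ^ 2 * (t 2 * t 0)) := by ring
    have : l 2 ^ 2 * l 0 ^ 2 * l 1 ^ 2 = (l 1 * l 2) * (l 2 * l 0) * (l 0 * l 1) := by ring
    linarith
  -- Every coset in the support contains a point of the support, and each point is seen from the `q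
  -- ^ 3` elements of its coset.
  obtain ⟨i, hi⟩ := h3
  refine hi.trans ?_
  rw [← sum_sum_mul_k (H := H) i]
  refine Finset.sum_le_sum fun g _ => ?_
  refine ind_le_of_imp (Finset.sum_nonneg fun _ _ => ind_nonneg _ _) fun ⟨a, b, c, h⟩ => ?_
  have := Finset.single_le_sum (f := fun p : F × F × F =>
    ind (fun g => f g ≠ 0) (g * H.k i p.1 p.2.1 p.2.2)) (fun p _ => ind_nonneg _ _)
    (Finset.mem_univ (a, b, c))
  rwa [ind_of (P := fun g => f g ≠ 0) h] at this

end HeisenbergTriple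

/-! ### Local words, bad lines and local minima -/

namespace HeisenbergTriple

variable {F : Type*} [Field F] {Γ : Type*} [Group Γ] {H : HeisenbergTriple F Γ}

variable (H) in
/-- The words with degree at most `d` on the lines contained in the cosets of type `i`. -/
def IsLocalWord (d : ℕ) (i : Fin 3) (y : Γ → F) : Prop :=
  ∀ j, j = i + 1 ∨ j = i + 2 → ∀ g, (fun α => y (g * H.h j α)) ∈ reedSolomon F d

variable (H) in
/-- The lines of type `k` where the two local words that are constrained there disagree. -/
noncomputable def bad (z : Fin 3 → Γ → F) (k : Fin 3) : Γ → ℝ :=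
  ind (H.DiffersOnLine (z (k + 1)) (z (k + 2)) k)

theorem bad_isInv (z : Fin 3 → Γ → F) (k : Fin 3) : H.IsInv k (H.bad z k) :=
  isInv_differsOnLine _ _ k

theorem bad_nonneg (z : Fin 3 → Γ → F) (k : Fin 3) (g : Γ) : 0 ≤ H.bad z k g := ind_nonneg _ _

theorem bad_le_one (z : Fin 3 → Γ → F) (k : Fin 3) (g : Γ) : H.bad z k g ≤ 1 := ind_le_one _ _

theorem bad_sq (z : Fin 3 → Γ → F) (k : Fin 3) (g : Γ) : H.bad z k g ^ 2 = H.bad z k g :=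
  ind_sq _ _

variable (H) in
/-- The points of a coset of type `i`. -/
def cosetPoint (i : Fin 3) (g : Γ) (p : F × F × F) : Γ := g * H.k i p.1 p.2.1 p.2.2

theorem cosetPoint_injective (i : Fin 3) (g : Γ) : Function.Injective (H.cosetPoint i g) := by
  intro p p' h
  obtain ⟨h1, h2, h3⟩ := H.k_injective _ _ _ _ _ _ _ (mul_left_cancel h)
  exact Prod.ext h1 (Prod.ext h2 h3)

theorem cosetPoint_mul_h_add_one (i : Fin 3) (g : Γ) (p : F × F × F) (α : F) :
    H.cosetPoint i g p * H.h (i + 1) α = H.cosetPoint i g (p.1 + α, p.2.1, p.2.2) := by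
  rw [cosetPoint, mul_assoc, H.k_mul_h_add_one]
  rfl

theorem cosetPoint_mul_h_add_two (i : Fin 3) (g : Γ) (p : F × F × F) (β : F) :
    H.cosetPoint i g p * H.h (i + 2) β =
      H.cosetPoint i g (p.1, p.2.1 + β, p.2.2 + p.1 * β) := by
  rw [cosetPoint, mul_assoc, H.k_mul_h_add_two]
  rfl

theorem mul_h_mem_range {i j : Fin 3} (hj : j = i + 1 ∨ j = i + 2) {g x : Γ}
    (hx : x ∈ Set.range (H.cosetPoint i g)) (α : F) :
    x * H.h j α ∈ Set.range (H.cosetPoint i g) := by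
  obtain ⟨p, rfl⟩ := hx
  rcases hj with rfl | rfl
  · exact ⟨_, (cosetPoint_mul_h_add_one i g p α).symm⟩
  · exact ⟨_, (cosetPoint_mul_h_add_two i g p α).symm⟩

theorem mul_h_notMem_range {i j : Fin 3} (hj : j = i + 1 ∨ j = i + 2) {g x : Γ}
    (hx : x ∉ Set.range (H.cosetPoint i g)) (α : F) :
    x * H.h j α ∉ Set.range (H.cosetPoint i g) := by
  intro h
  have := mul_h_mem_range hj h (-α)
  rw [mul_assoc, H.h_add, add_neg_cancel, H.h_zero, mul_one] at this
  exact hx this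

variable (H) in
/-- The word `y` with its values on a coset replaced by `w`. -/
noncomputable def replaceCoset (i : Fin 3) (g : Γ) (w : F → F → F → F) (y : Γ → F) : Γ → F :=
  Function.extend (H.cosetPoint i g) (fun p => w p.1 p.2.1 p.2.2) y

theorem replaceCoset_apply (i : Fin 3) (g : Γ) (w : F → F → F → F) (y : Γ → F) (p : F × F × F) :
    H.replaceCoset i g w y (H.cosetPoint i g p) = w p.1 p.2.1 p.2.2 :=
  (cosetPoint_injective i g).extend_apply _ _ p

theorem replaceCoset_of_notMem {i : Fin 3} {g x : Γ} (hx : x ∉ Set.range (H.cosetPoint i g))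
    (w : F → F → F → F) (y : Γ → F) : H.replaceCoset i g w y x = y x :=
  Function.extend_apply' _ _ _ fun ⟨p, hp⟩ => hx ⟨p, hp⟩

theorem IsLocalWord.replaceCoset {d : ℕ} {i : Fin 3} {y : Γ → F} (hy : H.IsLocalWord d i y)
    (g : Γ) {w : F → F → F → F} (hw₁ : IsRowRS d w) (hw₂ : IsColRS d w) :
    H.IsLocalWord d i (H.replaceCoset i g w y) := by
  intro j hj x
  by_cases hx : x ∈ Set.range (H.cosetPoint i g)
  · obtain ⟨⟨a, b, c⟩, rfl⟩ := hx
    rcases hj with rfl | rfl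
    · simp only [cosetPoint_mul_h_add_one, replaceCoset_apply]
      exact comp_add_mem_reedSolomon (hw₁ b c) a
    · simp only [cosetPoint_mul_h_add_two, replaceCoset_apply]
      have h1 := comp_add_mem_reedSolomon (hw₂ a (c - a * b)) b
      convert h1 using 3
      ring
  · simp only [fun α => replaceCoset_of_notMem (mul_h_notMem_range hj hx α) w y]
    exact hy j hj x

variable [Fintype Γ]

variable (H) in
-- The sum runs over points, so each bad line is counted once for every point on it.
noncomputable def badness (z : Fin 3 → Γ → F) : ℝ := ∑ k, ∑ g, H.bad z k g

variable (H) in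
/-- Local words that cannot be improved by a change on a single coset. -/
structure IsLocallyMinimal (d : ℕ) (z : Fin 3 → Γ → F) : Prop where
  isLocalWord : ∀ i, H.IsLocalWord d i (z i)
  badness_le : ∀ i g w, IsRowRS d w → IsColRS d w →
    H.badness z ≤ H.badness (Function.update z i (H.replaceCoset i g w (z i)))

theorem badness_nonneg (z : Fin 3 → Γ → F) : 0 ≤ H.badness z :=
  Finset.sum_nonneg fun _ _ => Finset.sum_nonneg fun _ _ => bad_nonneg _ _ _

theorem badness_eq_natCast (z : Fin 3 → Γ → F) : ∃ n : ℕ, H.badness z = n := by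
  classical
  refine ⟨∑ k, (Finset.univ.filter (H.DiffersOnLine (z (k + 1)) (z (k + 2)) k)).card, ?_⟩
  unfold badness bad
  push_cast
  exact Finset.sum_congr rfl fun k _ => sum_ind _

variable [Fintype F]

theorem exists_isLocallyMinimal {d : ℕ} {z₀ : Fin 3 → Γ → F}
    (hz₀ : ∀ i, H.IsLocalWord d i (z₀ i)) :
    ∃ z, H.IsLocallyMinimal d z ∧ H.badness z ≤ H.badness z₀ ∧
      ∀ i, ∑ g, ind (fun g => z₀ i g ≠ z i g) g ≤
        ((Fintype.card F : ℝ) ^ 3 + 1) * H.badness z₀ := by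
  classical
  set n : ℝ := (Fintype.card F : ℝ) ^ 3 with hn
  have hn0 : 0 < n := card_pow_pos 3
  let S := {z : Fin 3 → Γ → F // ∀ i, H.IsLocalWord d i (z i)}
  let dist : (Fin 3 → Γ → F) → ℝ := fun z => ∑ i, ∑ g, ind (fun g => z₀ i g ≠ z i g) g
  -- Changing one coset increases the distance to `z₀` by at most `n`, while badness is an integer.
  -- With weight `n + 1`, a minimizer of `Φ` cannot be improved on a coset, and its distance to `z₀`
  -- is bounded as well.
  let Φ : S → ℝ := fun z => (n + 1) * H.badness z.1 + dist z.1
  have : Nonempty S := ⟨⟨z₀, hz₀⟩⟩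
  obtain ⟨⟨z, hz⟩, hmin⟩ := Finite.exists_min Φ
  have hdist0 : dist z₀ = 0 := by
    refine Finset.sum_eq_zero fun i _ => Finset.sum_eq_zero fun g _ => ind_of_not ?_
    simp
  have hdist : ∀ z i, ∑ g, ind (fun g => z₀ i g ≠ z i g) g ≤ dist z := fun z i =>
    Finset.single_le_sum (f := fun i => ∑ g, ind (fun g => z₀ i g ≠ z i g) g)
      (fun i _ => Finset.sum_nonneg fun _ _ => ind_nonneg _ _) (Finset.mem_univ i)
  have hdistn : 0 ≤ dist z := Finset.sum_nonneg fun _ _ => Finset.sum_nonneg fun _ _ => ind_nonneg _ _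
  have h0 : (n + 1) * H.badness z + dist z ≤ (n + 1) * H.badness z₀ := by
    have : (n + 1) * H.badness z + dist z ≤ (n + 1) * H.badness z₀ + dist z₀ := hmin ⟨z₀, hz₀⟩
    rwa [hdist0, add_zero] at this
  refine ⟨z, ⟨hz, fun i g w hw₁ hw₂ => ?_⟩, ?_, fun i => ?_⟩
  · set z' := Function.update z i (H.replaceCoset i g w (z i)) with hz'
    have hz'w : ∀ j, H.IsLocalWord d j (z' j) := by
      intro j
      rcases eq_or_ne j i with rfl | hj
      · rw [hz', Function.update_self]
        exact (hz j).replaceCoset g hw₁ hw₂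
      · rw [hz', Function.update_of_ne hj]
        exact hz j
    have h1 : (n + 1) * H.badness z + dist z ≤ (n + 1) * H.badness z' + dist z' :=
      hmin ⟨z', hz'w⟩
    have h2 : dist z' ≤ dist z + n := by
      have h3 : ∀ j, ∑ g, ind (fun g => z₀ j g ≠ z' j g) g ≤
          ∑ g, ind (fun g => z₀ j g ≠ z j g) g + if j = i then n else 0 := by
        intro j
        rcases eq_or_ne j i with rfl | hj
        · rw [if_pos rfl, hz', Function.update_self]
          have h4 : n = ∑ x, ind (fun x => x ∈ Set.range (H.cosetPoint j g)) x := by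
            rw [sum_ind, hn]
            have : (Finset.univ.filter fun x => x ∈ Set.range (H.cosetPoint j g)) =
                Finset.univ.image (H.cosetPoint j g) := by
              ext x
              simp
            rw [this, Finset.card_image_of_injective _ (cosetPoint_injective j g),
              Finset.card_univ, Fintype.card_prod, Fintype.card_prod]
            push_cast
            ring
          rw [h4, ← Finset.sum_add_distrib]
          refine Finset.sum_le_sum fun x _ => ?_
          by_cases hx : x ∈ Set.range (H.cosetPoint j g)
          · rw [ind_of (P := fun x => x ∈ Set.range (H.cosetPoint j g)) hx]
            linarith [ind_le_one (fun g_1 => z₀ j g_1 ≠ H.replaceCoset j g w (z j) g_1) x,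
              ind_nonneg (fun g => z₀ j g ≠ z j g) x]
          · rw [ind_of_not (P := fun x => x ∈ Set.range (H.cosetPoint j g)) hx, add_zero]
            refine (ind_congr ?_).le
            rw [replaceCoset_of_notMem hx]
        · rw [if_neg hj, hz', Function.update_of_ne hj, add_zero]
      refine (Finset.sum_le_sum fun j _ => h3 j).trans_eq ?_
      rw [Finset.sum_add_distrib, Finset.sum_ite_eq' Finset.univ i, if_pos (Finset.mem_univ _)]
    obtain ⟨m, hm⟩ := badness_eq_natCast (H := H) z
    obtain ⟨m', hm'⟩ := badness_eq_natCast (H := H) z'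
    rw [hm, hm'] at h1 ⊢
    by_contra! h5
    have h6 : m' + 1 ≤ m := by exact_mod_cast h5
    have h7 : (m' : ℝ) + 1 ≤ m := by exact_mod_cast h6
    nlinarith
  · have : (n + 1) * H.badness z ≤ (n + 1) * H.badness z₀ := by linarith
    exact le_of_mul_le_mul_left this (by linarith)
  · have : 0 ≤ (n + 1) * H.badness z := mul_nonneg (by linarith) (badness_nonneg z)
    linarith [hdist z i]

end HeisenbergTriple

theorem sum_fin_three_cyclic {M : Type*} [AddCommMonoid M] (f : Fin 3 → M) (k : Fin 3) :
    ∑ j, f j = f k + f (k + 1) + f (k + 2) := by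
  rw [Fin.sum_univ_three]
  fin_cases k
  · rfl
  · change _ = f 1 + f 2 + f 0
    abel
  · change _ = f 2 + f 0 + f 1
    abel

theorem fin_three_add_one_ne (k : Fin 3) : k + 1 ≠ k := by
  revert k
  decide

theorem fin_three_add_two_ne (k : Fin 3) : k + 2 ≠ k := by
  revert k
  decide

/-! ### Consequences of local minimality -/

namespace HeisenbergTriple

variable {F : Type*} [Field F] {Γ : Type*} [Group Γ] {H : HeisenbergTriple F Γ}

theorem bad_update_self (z : Fin 3 → Γ → F) (k : Fin 3) (y : Γ → F) :
    H.bad (Function.update z k y) k = H.bad z k := by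
  rw [bad, Function.update_of_ne (fin_three_add_one_ne k),
    Function.update_of_ne (fin_three_add_two_ne k)]
  rfl

theorem bad_update_add_one (z : Fin 3 → Γ → F) (k : Fin 3) (y : Γ → F) :
    H.bad (Function.update z k y) (k + 1) = ind (H.DiffersOnLine (z (k + 2)) y (k + 1)) := by
  rw [bad, fin_three_add_one_add_one, fin_three_add_one_add_two, Function.update_self,
    Function.update_of_ne (fin_three_add_two_ne k)]

theorem bad_update_add_two (z : Fin 3 → Γ → F) (k : Fin 3) (y : Γ → F) :
    H.bad (Function.update z k y) (k + 2) = ind (H.DiffersOnLine y (z (k + 1)) (k + 2)) := by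
  rw [bad, fin_three_add_two_add_one, fin_three_add_two_add_two, Function.update_self,
    Function.update_of_ne (fin_three_add_one_ne k)]

theorem bad_update_of_notMem (z : Fin 3 → Γ → F) (k : Fin 3) {g x : Γ} (w : F → F → F → F)
    (hx : x ∉ Set.range (H.cosetPoint k g)) {j : Fin 3} (hj : j = k + 1 ∨ j = k + 2) :
    H.bad (Function.update z k (H.replaceCoset k g w (z k))) j x = H.bad z j x := by
  have h1 : ∀ α, H.replaceCoset k g w (z k) (x * H.h j α) = z k (x * H.h j α) := fun α =>
    replaceCoset_of_notMem (mul_h_notMem_range hj hx α) w (z k)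
  rcases hj with rfl | rfl
  · rw [bad_update_add_one, bad, fin_three_add_one_add_one, fin_three_add_one_add_two]
    refine ind_congr ?_
    simp only [DiffersOnLine, h1]
  · rw [bad_update_add_two, bad, fin_three_add_two_add_one, fin_three_add_two_add_two]
    refine ind_congr ?_
    simp only [DiffersOnLine, h1]

variable [Fintype Γ] [Fintype F]

/-- A replacement on a coset of type `k` affects only bad lines inside that coset, and these have
types `k + 1` and `k + 2`. So minimality becomes a statement about the coset alone. -/
theorem IsLocallyMinimal.sum_bad_le {d : ℕ} {z : Fin 3 → Γ → F} (hz : H.IsLocallyMinimal d z)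
    (k : Fin 3) (g : Γ) {w : F → F → F → F} (hw₁ : IsRowRS d w) (hw₂ : IsColRS d w) :
    ∑ p, H.bad z (k + 1) (H.cosetPoint k g p) + ∑ p, H.bad z (k + 2) (H.cosetPoint k g p) ≤
      ∑ p, ind (H.DiffersOnLine (z (k + 2)) (H.replaceCoset k g w (z k)) (k + 1))
        (H.cosetPoint k g p) +
      ∑ p, ind (H.DiffersOnLine (H.replaceCoset k g w (z k)) (z (k + 1)) (k + 2))
        (H.cosetPoint k g p) := by
  have h1 := hz.badness_le k g w hw₁ hw₂
  rw [badness, badness, sum_fin_three_cyclic _ k, sum_fin_three_cyclic _ k, bad_update_self] at h1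
  set z' := Function.update z k (H.replaceCoset k g w (z k)) with hz'
  have h2 : ∀ j, j = k + 1 ∨ j = k + 2 → ∑ x, H.bad z' j x - ∑ x, H.bad z j x =
      ∑ p, H.bad z' j (H.cosetPoint k g p) - ∑ p, H.bad z j (H.cosetPoint k g p) := by
    intro j hj
    rw [← Finset.sum_sub_distrib, ← Finset.sum_sub_distrib]
    refine (Fintype.sum_of_injective (H.cosetPoint k g) (cosetPoint_injective k g) _ _
      (fun x hx => ?_) fun p => rfl).symm
    rw [hz', bad_update_of_notMem z k w hx hj, sub_self]
  have h3 := h2 (k + 1) (Or.inl rfl)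
  have h4 := h2 (k + 2) (Or.inr rfl)
  rw [hz', bad_update_add_one] at h3 h1
  rw [hz', bad_update_add_two] at h4
  rw [bad_update_add_two] at h1
  linarith

/-- On the coset, `z (k + 2)` has low degree on rows and `z (k + 1)` on columns, and they differ
only on bad lines of type `k`. If these are rare, the local closeness lemma gives a replacement for
`z k` that leaves a fraction of at most 1/16 of the lines of each family bad, and the minimum does
no worse in total. -/
theorem IsLocallyMinimal.avg_bad_le {d : ℕ} (hd : 4 * d < Fintype.card F) {z : Fin 3 → Γ → F}
    (hz : H.IsLocallyMinimal d z) (k : Fin 3) (g : Γ)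
    (hg : 125000 * H.avg k (H.bad z k) g ≤ 1) :
    H.avg k (H.bad z (k + 1)) g + H.avg k (H.bad z (k + 2)) g ≤ 1 / 8 := by
  classical
  set q : ℝ := (Fintype.card F : ℝ) with hq
  have hn0 : 0 < q ^ 3 := card_pow_pos 3
  have hq0 : 0 ≤ q := Nat.cast_nonneg _
  set e := H.cosetPoint k g with he
  set fA : F → F → F → F := fun a b c => z (k + 2) (e (a, b, c)) with hfA
  set fB : F → F → F → F := fun a b c => z (k + 1) (e (a, b, c)) with hfB
  have hA : IsRowRS d fA := by
    intro b c
    have := hz.isLocalWord (k + 2) (k + 1) (Or.inr (fin_three_add_two_add_two k).symm) (e (0, b, c))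
    simpa only [he, cosetPoint_mul_h_add_one, zero_add] using this
  have hB : IsColRS d fB := by
    intro a t
    have := hz.isLocalWord (k + 1) (k + 2) (Or.inl (fin_three_add_one_add_one k).symm) (e (a, 0, t))
    simpa only [he, cosetPoint_mul_h_add_two, zero_add, add_comm t] using this
  have hS : 125000 * (Finset.univ.filter fun p : F × F × F =>
      fA p.1 p.2.1 p.2.2 ≠ fB p.1 p.2.1 p.2.2).card ≤ Fintype.card F ^ 3 := by
    have h1 : ∑ p : F × F × F, ind (fun p : F × F × F =>
        fA p.1 p.2.1 p.2.2 ≠ fB p.1 p.2.1 p.2.2) p ≤ ∑ p, H.bad z k (e p) := by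
      refine Finset.sum_le_sum fun p _ => ind_le_of_imp (bad_nonneg _ _ _) fun h => ?_
      exact (ind_of (differsOnLine_of_ne (f := z (k + 1)) (f' := z (k + 2)) (g := e p) k
        (Ne.symm h))).ge
    rw [sum_ind] at h1
    have h2 : ∑ p, H.bad z k (e p) = q ^ 3 * H.avg k (H.bad z k) g := by
      rw [avg, mul_inv_cancel_left₀ hn0.ne']
      rfl
    have h3 : (125000 * ((Finset.univ.filter fun p : F × F × F =>
        fA p.1 p.2.1 p.2.2 ≠ fB p.1 p.2.1 p.2.2).card : ℝ)) ≤ (Fintype.card F : ℝ) ^ 3 := by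
      rw [h2] at h1
      nlinarith
    exact_mod_cast h3
  obtain ⟨w, hw₁, hw₂, hbA, hbB⟩ := exists_isRowRS_isColRS_near hd hA hB hS
  have hmin := hz.sum_bad_le k g hw₁ hw₂
  have hbA' : 16 * ∑ p : F × F, ind (fun p : F × F => ∃ a, fA a p.1 p.2 ≠ w a p.1 p.2) p ≤
      q ^ 2 := by
    rw [sum_ind, hq]
    exact_mod_cast hbA
  have hbB' : 16 * ∑ p : F × F, ind (fun p : F × F =>
      ∃ a, flip₃ fB a p.1 p.2 ≠ flip₃ w a p.1 p.2) p ≤ q ^ 2 := by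
    rw [sum_ind, hq]
    exact_mod_cast hbB
  have h1 : ∑ p, ind (H.DiffersOnLine (z (k + 2)) (H.replaceCoset k g w (z k)) (k + 1)) (e p) ≤
      q * ∑ p : F × F, ind (fun p : F × F => ∃ a, fA a p.1 p.2 ≠ w a p.1 p.2) p := by
    rw [Fintype.sum_prod_type]
    have h2 : ∀ a : F, ∑ p : F × F, ind (H.DiffersOnLine (z (k + 2))
        (H.replaceCoset k g w (z k)) (k + 1)) (e (a, p)) ≤
        ∑ p : F × F, ind (fun p : F × F => ∃ a, fA a p.1 p.2 ≠ w a p.1 p.2) p := by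
      intro a
      refine Finset.sum_le_sum fun p _ => ind_le_of_imp (ind_nonneg _ _) fun ⟨α, h⟩ => ?_
      rw [cosetPoint_mul_h_add_one, replaceCoset_apply] at h
      exact (ind_of (P := fun p : F × F => ∃ a, fA a p.1 p.2 ≠ w a p.1 p.2) ⟨_, h⟩).ge
    refine (Finset.sum_le_sum fun a _ => h2 a).trans_eq ?_
    rw [Finset.sum_const, Finset.card_univ, nsmul_eq_mul]
  have h3 : ∑ p, ind (H.DiffersOnLine (H.replaceCoset k g w (z k)) (z (k + 1)) (k + 2)) (e p) ≤
      q * ∑ p : F × F, ind (fun p : F × F =>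
        ∃ a, flip₃ fB a p.1 p.2 ≠ flip₃ w a p.1 p.2) p := by
    set ψ := ind (fun p : F × F => ∃ a, flip₃ fB a p.1 p.2 ≠ flip₃ w a p.1 p.2) with hψ
    have h4 : ∀ p : F × F × F, ind (H.DiffersOnLine (H.replaceCoset k g w (z k)) (z (k + 1))
        (k + 2)) (e p) ≤ ψ (p.1, p.1 * p.2.1 - p.2.2) := by
      intro p
      refine ind_le_of_imp (ind_nonneg _ _) fun ⟨β, h⟩ => (ind_of ⟨p.2.1 + β, ?_⟩).ge
      rw [cosetPoint_mul_h_add_two, replaceCoset_apply] at h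
      have h5 : (p.2.1 + β) * p.1 - (p.1 * p.2.1 - p.2.2) = p.2.2 + p.1 * β := by ring
      simp only [flip₃, h5]
      exact Ne.symm h
    refine (Finset.sum_le_sum fun p _ => h4 p).trans_eq ?_
    simp only [Fintype.sum_prod_type]
    rw [Finset.mul_sum]
    refine Finset.sum_congr rfl fun a _ => ?_
    have h6 : ∀ b, ∑ c, ψ (a, a * b - c) = ∑ t, ψ (a, t) := fun b =>
      Fintype.sum_equiv (Equiv.subLeft (a * b)) _ _ fun c => rfl
    simp only [h6, Finset.sum_const, Finset.card_univ, nsmul_eq_mul]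
    rfl
  have h7 : H.avg k (H.bad z (k + 1)) g + H.avg k (H.bad z (k + 2)) g =
      (q ^ 3)⁻¹ * (∑ p, H.bad z (k + 1) (e p) + ∑ p, H.bad z (k + 2) (e p)) := by
    rw [avg, avg, ← mul_add]
    rfl
  rw [h7, inv_mul_le_iff₀ hn0]
  have h8 := mul_le_mul_of_nonneg_left hbA' hq0
  have h9 := mul_le_mul_of_nonneg_left hbB' hq0
  have h10 : q * q ^ 2 = q ^ 3 := by ring
  linarith

end HeisenbergTriple

/-! ### Expansion leaves no bad lines -/

namespace HeisenbergTriple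

variable {F : Type*} [Field F] {Γ : Type*} [Group Γ] {H : HeisenbergTriple F Γ}

/-- If two of the words differ at a point, the third differs from one of them, so a second bad line
passes through the point. -/
theorem ind_ne_le_bad (z : Fin 3 → Γ → F) (k : Fin 3) (g : Γ) :
    ind (fun g => z (k + 1) g ≠ z (k + 2) g) g ≤
      H.bad z k g * H.bad z (k + 1) g + H.bad z k g * H.bad z (k + 2) g := by
  refine ind_le_of_imp (add_nonneg (mul_nonneg (bad_nonneg _ _ _) (bad_nonneg _ _ _))
    (mul_nonneg (bad_nonneg _ _ _) (bad_nonneg _ _ _))) fun h => ?_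
  have h1 : H.bad z k g = 1 := ind_of (differsOnLine_of_ne k h)
  rw [h1, one_mul, one_mul]
  by_cases h2 : z (k + 2) g = z k g
  · have h3 : H.bad z (k + 2) g = 1 := by
      rw [bad, fin_three_add_two_add_one, fin_three_add_two_add_two]
      exact ind_of (differsOnLine_of_ne _ fun h4 => h (h4.symm.trans h2.symm))
    linarith [bad_nonneg (H := H) z (k + 1) g]
  · have h3 : H.bad z (k + 1) g = 1 := by
      rw [bad, fin_three_add_one_add_one, fin_three_add_one_add_two]
      exact ind_of (differsOnLine_of_ne _ h2)
    linarith [bad_nonneg (H := H) z (k + 2) g]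

variable [Fintype F]

theorem avg_bad_le_one (z : Fin 3 → Γ → F) (i k : Fin 3) (g : Γ) : H.avg i (H.bad z k) g ≤ 1 := by
  have h1 := card_pow_pos (F := F) 3
  rw [avg, inv_mul_le_iff₀ h1, mul_one]
  refine (Finset.sum_le_sum fun p _ => bad_le_one z k _).trans_eq ?_
  rw [Finset.sum_const, Finset.card_univ, Fintype.card_prod, Fintype.card_prod, nsmul_eq_mul]
  push_cast
  ring

variable [Fintype Γ]

/-- On a bad line the two words differ at more than three quarters of the points, since `d < q / 4`,
and each such point lies on a second bad line. -/
theorem three_quarters_mul_sum_bad_le {d : ℕ} (hd : 4 * d < Fintype.card F) {z : Fin 3 → Γ → F}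
    (hz : ∀ i, H.IsLocalWord d i (z i)) (k : Fin 3) :
    3 / 4 * ∑ g, H.bad z k g ≤
      ∑ g, H.bad z k g * H.bad z (k + 1) g + ∑ g, H.bad z k g * H.bad z (k + 2) g := by
  set q : ℝ := (Fintype.card F : ℝ) with hq
  have hq0 : 0 < q := Nat.cast_pos.2 Fintype.card_pos
  have h1 : ∑ g, (q - d) * H.bad z k g ≤
      ∑ g, ∑ α, ind (fun g => z (k + 1) g ≠ z (k + 2) g) (g * H.h k α) :=
    Finset.sum_le_sum fun g _ => card_sub_mul_ind_le
      (hz (k + 1) k (Or.inr (fin_three_add_one_add_two k).symm))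
      (hz (k + 2) k (Or.inl (fin_three_add_two_add_one k).symm)) g
  have h2 : ∀ α, ∑ g, ind (fun g => z (k + 1) g ≠ z (k + 2) g) (g * H.h k α) =
      ∑ g, ind (fun g => z (k + 1) g ≠ z (k + 2) g) g := fun α =>
    Fintype.sum_equiv (Equiv.mulRight _) _ _ fun g => rfl
  rw [Finset.sum_comm, ← Finset.mul_sum] at h1
  simp only [h2, Finset.sum_const, Finset.card_univ, nsmul_eq_mul] at h1
  have h3 : ∑ g, ind (fun g => z (k + 1) g ≠ z (k + 2) g) g ≤
      ∑ g, H.bad z k g * H.bad z (k + 1) g + ∑ g, H.bad z k g * H.bad z (k + 2) g := by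
    rw [← Finset.sum_add_distrib]
    exact Finset.sum_le_sum fun g _ => ind_ne_le_bad z k g
  have h4 : (4 * d : ℝ) < q := by
    rw [hq]
    exact_mod_cast hd
  have h5 : 0 ≤ ∑ g, H.bad z k g := Finset.sum_nonneg fun _ _ => bad_nonneg _ _ _
  have h6 : q * (3 / 4 * ∑ g, H.bad z k g) ≤
      q * ∑ g, ind (fun g => z (k + 1) g ≠ z (k + 2) g) g := by
    refine le_trans ?_ h1
    nlinarith
  exact (le_of_mul_le_mul_left h6 hq0).trans h3

/-- Mixing reduces the sum to products of densities on cosets of type `k`. These are small by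
minimality, except on cosets hit by many bad lines of type `k`, and such cosets are rare by global
expansion. -/
theorem IsLocallyMinimal.sum_bad_mul_bad_le {d : ℕ} (hd : 4 * d < Fintype.card F)
    {z : Fin 3 → Γ → F} (hz : H.IsLocallyMinimal d z) (k : Fin 3) :
    ∑ g, H.bad z (k + 1) g * H.bad z (k + 2) g ≤
      (1 / 32 + expansion F / 2) * (∑ g, H.bad z (k + 1) g + ∑ g, H.bad z (k + 2) g) +
      125000 ^ 2 * ((∑ g, H.bad z k g) ^ 2 / Fintype.card Γ +
        (globalExpansion F + expansion F) ^ 2 * ∑ g, H.bad z k g) := by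
  have h1 := sum_mul_le (H := H) (i := k) (bad_isInv z (k + 1)) (bad_isInv z (k + 2))
  have h2 := sum_avg_sq_le (H := H) k (bad_isInv z k)
  simp only [bad_sq] at h1 h2
  -- For densities with `a + b ≤ 1 / 8`, `a * b ≤ (a + b) ^ 2 / 4 ≤ (a + b) / 32`. Otherwise the
  -- second term alone exceeds 1.
  have hpt : ∀ g, H.avg k (H.bad z (k + 1)) g * H.avg k (H.bad z (k + 2)) g ≤
      1 / 32 * (H.avg k (H.bad z (k + 1)) g + H.avg k (H.bad z (k + 2)) g) +
        125000 ^ 2 * H.avg k (H.bad z k) g ^ 2 := by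
    intro g
    have a0 := avg_nonneg (H := H) k (bad_nonneg (H := H) z (k + 1)) g
    have b0 := avg_nonneg (H := H) k (bad_nonneg (H := H) z (k + 2)) g
    have a1 := avg_bad_le_one (H := H) z k (k + 1) g
    have b1 := avg_bad_le_one (H := H) z k (k + 2) g
    set a := H.avg k (H.bad z (k + 1)) g
    set b := H.avg k (H.bad z (k + 2)) g
    rcases le_or_gt (125000 * H.avg k (H.bad z k) g) 1 with h | h
    · have h3 : a + b ≤ 1 / 8 := hz.avg_bad_le hd k g h
      nlinarith [sq_nonneg (a - b), sq_nonneg (H.avg k (H.bad z k) g)]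
    · have h4 : a * b ≤ 1 := mul_le_one₀ a1 b0 b1
      nlinarith
  have h3 := Finset.sum_le_sum fun g (_ : g ∈ Finset.univ) => hpt g
  rw [Finset.sum_add_distrib, ← Finset.mul_sum, ← Finset.mul_sum, Finset.sum_add_distrib, sum_avg,
    sum_avg] at h3
  set m₁ := ∑ g, H.bad z (k + 1) g
  set m₂ := ∑ g, H.bad z (k + 2) g
  have hm₁ : 0 ≤ m₁ := Finset.sum_nonneg fun _ _ => bad_nonneg _ _ _
  have hm₂ : 0 ≤ m₂ := Finset.sum_nonneg fun _ _ => bad_nonneg _ _ _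
  have h5 : Real.sqrt m₁ * Real.sqrt m₂ ≤ (m₁ + m₂) / 2 := by
    nlinarith [sq_nonneg (Real.sqrt m₁ - Real.sqrt m₂), Real.sq_sqrt hm₁, Real.sq_sqrt hm₂]
  have h6 := mul_le_mul_of_nonneg_left h5 (expansion_nonneg (F := F))
  linarith

/-- Summed over the types, the pairs of bad lines through a point are at least 3/8 of the badness by
the distance on lines, and at most 5/16 of it by expansion. The bounds on `q` and on the badness
make the error terms at most 1/16 and 1/8 of each type's share. -/
theorem IsLocallyMinimal.badness_eq_zero {d : ℕ} (hd : 4 * d < Fintype.card F)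
    (hq : 144 * 125000 ^ 2 ≤ Fintype.card F) {z : Fin 3 → Γ → F} (hz : H.IsLocallyMinimal d z)
    (hb : 8 * 125000 ^ 2 * H.badness z ≤ Fintype.card Γ) : H.badness z = 0 := by
  have hN : (0 : ℝ) < Fintype.card Γ := Nat.cast_pos.2 Fintype.card_pos
  have hqR : (144 * 125000 ^ 2 : ℝ) ≤ Fintype.card F := by exact_mod_cast hq
  have hq0 : (0 : ℝ) < Fintype.card F := by linarith
  have he2 := expansion_sq (F := F)
  have he0 := expansion_nonneg (F := F)
  have he2' : expansion F ^ 2 * (144 * 125000 ^ 2) ≤ 1 := by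
    rw [he2, inv_mul_le_iff₀ hq0, mul_one]
    exact hqR
  have hε : expansion F ≤ 1 / 16 := by
    by_contra! h
    nlinarith
  have hθ : globalExpansion F ≤ 2 * expansion F := by
    rw [globalExpansion, div_le_iff₀ (by linarith)]
    nlinarith
  have hθ0 := globalExpansion_nonneg (F := F)
  have hlam : 125000 ^ 2 * (globalExpansion F + expansion F) ^ 2 ≤ 1 / 16 := by
    have : (globalExpansion F + expansion F) ^ 2 ≤ (3 * expansion F) ^ 2 :=
      pow_le_pow_left₀ (by linarith) (by linarith) 2
    nlinarith
  set m : Fin 3 → ℝ := fun k => ∑ g, H.bad z k g with hm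
  have hm0 : ∀ k, 0 ≤ m k := fun k => Finset.sum_nonneg fun _ _ => bad_nonneg _ _ _
  have hM : H.badness z = m 0 + m 1 + m 2 := Fin.sum_univ_three _
  have hM0 := badness_nonneg (H := H) z
  set M := H.badness z with hMdef
  have hsq : ∀ k, 125000 ^ 2 * (m k ^ 2 / Fintype.card Γ) ≤ 1 / 8 * m k := by
    intro k
    have h1 : m k ≤ M := by
      rw [hM]
      have := hm0 0
      have := hm0 1
      have := hm0 2
      fin_cases k <;> simp <;> linarith
    rw [← mul_div_assoc, div_le_iff₀ hN]
    have h2 : m k * (8 * 125000 ^ 2 * M) ≤ m k * Fintype.card Γ :=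
      mul_le_mul_of_nonneg_left hb (hm0 k)
    have h3 : m k * m k ≤ m k * M := mul_le_mul_of_nonneg_left h1 (hm0 k)
    nlinarith
  have hc : ∀ k, ∑ g, H.bad z (k + 1) g * H.bad z (k + 2) g ≤
      1 / 16 * (m (k + 1) + m (k + 2)) + 3 / 16 * m k := by
    intro k
    have h1 := hz.sum_bad_mul_bad_le hd k
    have h2 := mul_le_mul_of_nonneg_right hlam (hm0 k)
    have h3 := hsq k
    have h4 : (1 / 32 + expansion F / 2) * (m (k + 1) + m (k + 2)) ≤
        1 / 16 * (m (k + 1) + m (k + 2)) :=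
      mul_le_mul_of_nonneg_right (by linarith) (add_nonneg (hm0 _) (hm0 _))
    have h5 : ∑ g, H.bad z (k + 1) g * H.bad z (k + 2) g ≤
      (1 / 32 + expansion F / 2) * (m (k + 1) + m (k + 2)) +
      125000 ^ 2 * (m k ^ 2 / Fintype.card Γ +
        (globalExpansion F + expansion F) ^ 2 * m k) := h1
    linarith
  have hs : ∀ k, 3 / 4 * m k ≤
      ∑ g, H.bad z k g * H.bad z (k + 1) g + ∑ g, H.bad z k g * H.bad z (k + 2) g :=
    three_quarters_mul_sum_bad_le hd hz.isLocalWord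
  have s0 := hs 0
  have s1 := hs 1
  have s2 := hs 2
  have c0 := hc 0
  have c1 := hc 1
  have c2 := hc 2
  simp only [show (0 : Fin 3) + 1 = 1 from rfl, show (0 : Fin 3) + 2 = 2 from rfl,
    show (1 : Fin 3) + 1 = 2 from rfl, show (1 : Fin 3) + 2 = 0 from rfl,
    show (2 : Fin 3) + 1 = 0 from rfl, show (2 : Fin 3) + 2 = 1 from rfl] at s0 s1 s2 c0 c1 c2
  simp only [mul_comm (H.bad z 1 _) (H.bad z 0 _), mul_comm (H.bad z 2 _) (H.bad z 0 _),
    mul_comm (H.bad z 2 _) (H.bad z 1 _)] at s0 s1 s2 c0 c1 c2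
  linarith

end HeisenbergTriple

/-! ### From few violated lines to a nearby codeword -/

namespace HeisenbergTriple

variable {F : Type*} [Field F] {Γ : Type*} [Group Γ] {H : HeisenbergTriple F Γ}

variable (H) in
/-- The cosets of type `i` that contain a line on which `f` violates the degree condition. -/
def ViolatedCoset (d : ℕ) (f : Γ → F) (i : Fin 3) (g : Γ) : Prop :=
  ∃ p : F × F × F, (fun α => f (g * H.k i p.1 p.2.1 p.2.2 * H.h (i + 1) α)) ∉ reedSolomon F d ∨
    (fun α => f (g * H.k i p.1 p.2.1 p.2.2 * H.h (i + 2) α)) ∉ reedSolomon F d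

theorem violatedCoset_isInv {d : ℕ} {f : Γ → F} {i j : Fin 3} (hj : j = i + 1 ∨ j = i + 2) :
    H.IsInv j (ind (H.ViolatedCoset d f i)) := by
  refine IsInv.ind fun g α ⟨p, hp⟩ => ?_
  rcases hj with rfl | rfl
  · refine ⟨(p.1 - α, p.2.1, p.2.2 - α * p.2.1), ?_⟩
    rwa [mul_assoc g, H.h_add_one_mul_k, sub_add_cancel, sub_add_cancel]
  · refine ⟨(p.1, p.2.1 - α, p.2.2), ?_⟩
    rwa [mul_assoc g, H.h_add_two_mul_k, sub_add_cancel]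

variable (H) in
open Classical in
/-- The word that agrees with `f` on the cosets of type `i` without violated lines and vanishes
on the others. -/
noncomputable def initialWord (d : ℕ) (f : Γ → F) (i : Fin 3) (g : Γ) : F :=
  if H.ViolatedCoset d f i g then 0 else f g

theorem initialWord_eq {d : ℕ} {f : Γ → F} {i : Fin 3} {g : Γ} (h : ¬ H.ViolatedCoset d f i g) :
    H.initialWord d f i g = f g := if_neg h

theorem violatedCoset_mul_h_iff {d : ℕ} {f : Γ → F} {i j : Fin 3} (hj : j = i + 1 ∨ j = i + 2)
    (g : Γ) (α : F) : H.ViolatedCoset d f i (g * H.h j α) ↔ H.ViolatedCoset d f i g := by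
  have h := violatedCoset_isInv (H := H) (d := d) (f := f) hj g α
  by_cases h1 : H.ViolatedCoset d f i g <;> by_cases h2 : H.ViolatedCoset d f i (g * H.h j α)
  · simp [h1, h2]
  · rw [ind_of h1, ind_of_not h2] at h
    exact absurd h zero_ne_one
  · rw [ind_of_not h1, ind_of h2] at h
    exact absurd h one_ne_zero
  · simp [h1, h2]

theorem isLocalWord_initialWord (d : ℕ) (f : Γ → F) (i : Fin 3) :
    H.IsLocalWord d i (H.initialWord d f i) := by
  intro j hj g
  have hiff := violatedCoset_mul_h_iff (H := H) (d := d) (f := f) hj g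
  by_cases h : H.ViolatedCoset d f i g
  · have h0 : (fun α => H.initialWord d f i (g * H.h j α)) = 0 :=
      funext fun α => if_pos ((hiff α).2 h)
    rw [h0]
    exact zero_mem _
  · have h0 : (fun α => H.initialWord d f i (g * H.h j α)) = fun α => f (g * H.h j α) :=
      funext fun α => if_neg fun h1 => h ((hiff α).1 h1)
    rw [h0]
    by_contra h1
    refine h ⟨(0, 0, 0), ?_⟩
    rw [H.k_zero, mul_one]
    rcases hj with rfl | rfl
    · exact Or.inl h1
    · exact Or.inr h1

/-- If neither of the two cosets through the line is violated, both words equal `f` on it. -/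
theorem bad_initialWord_le (d : ℕ) (f : Γ → F) (k : Fin 3) (g : Γ) :
    H.bad (H.initialWord d f) k g ≤
      ind (H.ViolatedCoset d f (k + 1)) g + ind (H.ViolatedCoset d f (k + 2)) g := by
  refine ind_le_of_imp (add_nonneg (ind_nonneg _ _) (ind_nonneg _ _)) fun ⟨α, h⟩ => ?_
  have h₁ := violatedCoset_mul_h_iff (H := H) (d := d) (f := f) (i := k + 1) (j := k)
    (Or.inr (fin_three_add_one_add_two k).symm) g α
  have h₂ := violatedCoset_mul_h_iff (H := H) (d := d) (f := f) (i := k + 2) (j := k)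
    (Or.inl (fin_three_add_two_add_one k).symm) g α
  by_cases h3 : H.ViolatedCoset d f (k + 1) g
  · rw [ind_of h3]
    linarith [ind_nonneg (H.ViolatedCoset d f (k + 2)) g]
  by_cases h4 : H.ViolatedCoset d f (k + 2) g
  · rw [ind_of h4]
    linarith [ind_nonneg (H.ViolatedCoset d f (k + 1)) g]
  rw [initialWord_eq (fun h5 => h3 (h₁.1 h5)), initialWord_eq (fun h5 => h4 (h₂.1 h5))] at h
  exact absurd rfl h

variable (H) in
/-- The lines of type `i` on which `f` violates the degree condition. -/
def ViolatedLine (d : ℕ) (f : Γ → F) (i : Fin 3) (g : Γ) : Prop :=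
  (fun α => f (g * H.h i α)) ∉ reedSolomon F d

variable [Fintype Γ]

/-- Without bad lines the three words coincide, and each family of lines is constrained by two of
them. -/
theorem isCodeword_of_badness_eq_zero {d : ℕ} {z : Fin 3 → Γ → F}
    (hz : ∀ i, H.IsLocalWord d i (z i)) (h : H.badness z = 0) : H.IsCodeword d (z 0) := by
  have h1 : ∀ k g, H.bad z k g = 0 := by
    intro k g
    have h2 := (Finset.sum_eq_zero_iff_of_nonneg fun k _ =>
      Finset.sum_nonneg fun g _ => bad_nonneg (H := H) z k g).1 h k (Finset.mem_univ k)
    exact (Finset.sum_eq_zero_iff_of_nonneg fun g _ => bad_nonneg (H := H) z k g).1 h2 g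
      (Finset.mem_univ g)
  have h3 : ∀ k, z (k + 1) = z (k + 2) := by
    intro k
    funext g
    by_contra h4
    have h5 : H.bad z k g = 1 := ind_of (differsOnLine_of_ne k h4)
    rw [h1] at h5
    exact zero_ne_one h5
  intro j g
  rcases eq_or_ne j 0 with rfl | hj
  · have : z 0 = z 1 := (h3 1).symm.trans (h3 0).symm
    rw [this]
    exact hz 1 0 (Or.inr rfl) g
  · refine hz 0 j ?_ g
    revert j
    decide

variable [Fintype F]

theorem sum_violatedCoset_le (d : ℕ) (f : Γ → F) (i : Fin 3) :
    ∑ g, ind (H.ViolatedCoset d f i) g ≤ (Fintype.card F : ℝ) ^ 3 *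
      (∑ g, ind (H.ViolatedLine d f (i + 1)) g + ∑ g, ind (H.ViolatedLine d f (i + 2)) g) := by
  rw [← Finset.sum_add_distrib, ← sum_sum_mul_k (H := H) i]
  refine Finset.sum_le_sum fun g _ => ?_
  have h0 : ∀ p : F × F × F, 0 ≤ ind (H.ViolatedLine d f (i + 1)) (g * H.k i p.1 p.2.1 p.2.2) +
      ind (H.ViolatedLine d f (i + 2)) (g * H.k i p.1 p.2.1 p.2.2) := fun p =>
    add_nonneg (ind_nonneg _ _) (ind_nonneg _ _)
  refine ind_le_of_imp (Finset.sum_nonneg fun p _ => h0 p) fun ⟨p, hp⟩ => ?_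
  refine le_trans ?_ (Finset.single_le_sum (fun p _ => h0 p) (Finset.mem_univ p))
  rcases hp with hp | hp
  · rw [ind_of (P := H.ViolatedLine d f (i + 1)) hp]
    linarith [ind_nonneg (H.ViolatedLine d f (i + 2)) (g * H.k i p.1 p.2.1 p.2.2)]
  · rw [ind_of (P := H.ViolatedLine d f (i + 2)) hp]
    linarith [ind_nonneg (H.ViolatedLine d f (i + 1)) (g * H.k i p.1 p.2.1 p.2.2)]

/-- A word that violates few of the degree conditions is close to a codeword. -/
theorem exists_isCodeword_near {d : ℕ} (hd : 4 * d < Fintype.card F)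
    (hq : 144 * 125000 ^ 2 ≤ Fintype.card F) (f : Γ → F)
    (hf : 32 * 125000 ^ 2 * (Fintype.card F : ℝ) ^ 3 * ∑ i, ∑ g, ind (H.ViolatedLine d f i) g ≤
      Fintype.card Γ) :
    ∃ w, H.IsCodeword d w ∧ ∑ g, ind (fun g => f g ≠ w g) g ≤
      9 * (Fintype.card F : ℝ) ^ 6 * ∑ i, ∑ g, ind (H.ViolatedLine d f i) g := by
  set n : ℝ := (Fintype.card F : ℝ) ^ 3 with hn
  have hn1 : 1 ≤ n := one_le_pow₀ (by exact_mod_cast Fintype.card_pos (α := F))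
  set l : Fin 3 → ℝ := fun i => ∑ g, ind (H.ViolatedLine d f i) g with hl
  have hl0 : ∀ i, 0 ≤ l i := fun i => Finset.sum_nonneg fun _ _ => ind_nonneg _ _
  set v := ∑ i, l i with hv
  have hv3 : v = l 0 + l 1 + l 2 := Fin.sum_univ_three l
  set t : Fin 3 → ℝ := fun i => ∑ g, ind (H.ViolatedCoset d f i) g with ht
  have htl : ∀ i, t i ≤ n * (l (i + 1) + l (i + 2)) := sum_violatedCoset_le d f
  -- Each type of coset is charged by two types of lines, and each type of line by two types of
  -- cosets.
  have hbad : H.badness (H.initialWord d f) ≤ 4 * n * v := by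
    have h1 : H.badness (H.initialWord d f) ≤ ∑ k : Fin 3, (t (k + 1) + t (k + 2)) := by
      refine Finset.sum_le_sum fun k _ => ?_
      rw [ht, ← Finset.sum_add_distrib]
      exact Finset.sum_le_sum fun g _ => bad_initialWord_le d f k g
    rw [Fin.sum_univ_three] at h1
    have t0 := htl 0
    have t1 := htl 1
    have t2 := htl 2
    simp only [show (0 : Fin 3) + 1 = 1 from rfl, show (0 : Fin 3) + 2 = 2 from rfl,
      show (1 : Fin 3) + 1 = 2 from rfl, show (1 : Fin 3) + 2 = 0 from rfl,
      show (2 : Fin 3) + 1 = 0 from rfl, show (2 : Fin 3) + 2 = 1 from rfl] at h1 t0 t1 t2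
    rw [hv3]
    linarith
  obtain ⟨z, hz, hzb, hzd⟩ := exists_isLocallyMinimal (isLocalWord_initialWord (H := H) d f)
  have hz0 : H.badness z = 0 := by
    refine hz.badness_eq_zero hd hq (le_trans ?_ hf)
    linarith
  refine ⟨z 0, isCodeword_of_badness_eq_zero hz.isLocalWord hz0, ?_⟩
  have h1 : ∑ g, ind (fun g => f g ≠ z 0 g) g ≤
      t 0 + ∑ g, ind (fun g => H.initialWord d f 0 g ≠ z 0 g) g := by
    rw [ht, ← Finset.sum_add_distrib]
    refine Finset.sum_le_sum fun g _ => ?_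
    by_cases h : H.ViolatedCoset d f 0 g
    · rw [ind_of h]
      linarith [ind_le_one (fun g => f g ≠ z 0 g) g,
        ind_nonneg (fun g => H.initialWord d f 0 g ≠ z 0 g) g]
    · rw [ind_of_not h, zero_add]
      refine (ind_congr ?_).le
      rw [initialWord_eq h]
  have h2 := hzd 0
  have h3 := htl 0
  have h4 : t 0 ≤ n * v := h3.trans (mul_le_mul_of_nonneg_left (by
    rw [hv3]
    change l 1 + l 2 ≤ _
    linarith [hl0 0]) (by linarith))
  have h5 : (n + 1) * H.badness (H.initialWord d f) ≤ (n + 1) * (4 * n * v) :=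
    mul_le_mul_of_nonneg_left hbad (by linarith)
  have hv0 : 0 ≤ v := Finset.sum_nonneg fun i _ => hl0 i
  have h6 : n * v ≤ n * v * n := le_mul_of_one_le_right (by positivity) hn1
  have h7 : (Fintype.card F : ℝ) ^ 6 = n * n := by
    rw [hn]
    ring
  rw [h7]
  linarith

end HeisenbergTriple

/-! ### The matrix group as a Heisenberg triple -/

section Concrete

variable {F : Type u} [Field F] (φ : F[X])

/-- The elements of the group `K i`, with the coordinates ordered such that the first two belong to
the lines of types `i + 1` and `i + 2`. -/
noncomputable def kMat (i : Fin 3) (a b c : F) : SL3 φ :=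
  let t : AdjoinRoot φ := AdjoinRoot.root φ
  (![⟨!![1, a • t, c • t ^ 2; 0, 1, b • t; 0, 0, 1], by simp [Matrix.det_fin_three]⟩,
    ⟨!![1, 0, 0; c • t ^ 2, 1, a • t; b • t, 0, 1], by simp [Matrix.det_fin_three]⟩,
    ⟨!![1, b • t, 0; 0, 1, 0; a • t, c • t ^ 2, 1], by simp [Matrix.det_fin_three]⟩] :
      Fin 3 → SL3 φ) i

theorem mem_K_iff (i : Fin 3) (g : SL3 φ) : g ∈ K φ i ↔ ∃ a b c, g = kMat φ i a b c := by
  fin_cases i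
  · exact ⟨fun ⟨a, b, c, h⟩ => ⟨a, b, c, Subtype.ext h⟩, fun ⟨a, b, c, h⟩ => ⟨a, b, c, by rw [h]; rfl⟩⟩
  · exact ⟨fun ⟨a, b, c, h⟩ => ⟨a, b, c, Subtype.ext h⟩, fun ⟨a, b, c, h⟩ => ⟨a, b, c, by rw [h]; rfl⟩⟩
  · exact ⟨fun ⟨a, b, c, h⟩ => ⟨b, a, c, Subtype.ext h⟩, fun ⟨a, b, c, h⟩ => ⟨b, a, c, by rw [h]; rfl⟩⟩

theorem kMat_mem (i : Fin 3) (a b c : F) : kMat φ i a b c ∈ G φ :=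
  Subgroup.subset_closure (Set.mem_iUnion.2 ⟨i, (mem_K_iff φ i _).2 ⟨a, b, c, rfl⟩⟩)

theorem kMat_zero (i : Fin 3) : kMat φ i 0 0 0 = 1 := by
  apply Subtype.ext
  fin_cases i <;> ext j k <;> fin_cases j <;> fin_cases k <;> simp [kMat]

theorem kMat_mul_h_add_one (i : Fin 3) (a b c α : F) :
    kMat φ i a b c * h φ (i + 1) α = kMat φ i (a + α) b c := by
  apply Subtype.ext
  rw [Matrix.SpecialLinearGroup.coe_mul]
  fin_cases i <;> ext j k <;> rw [Matrix.mul_apply, Fin.sum_univ_three] <;>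
    fin_cases j <;> fin_cases k <;>
    simp [kMat, h, Algebra.smul_def] <;> ring

theorem kMat_mul_h_add_two (i : Fin 3) (a b c β : F) :
    kMat φ i a b c * h φ (i + 2) β = kMat φ i a (b + β) (c + a * β) := by
  apply Subtype.ext
  rw [Matrix.SpecialLinearGroup.coe_mul]
  fin_cases i <;> ext j k <;> rw [Matrix.mul_apply, Fin.sum_univ_three] <;>
    fin_cases j <;> fin_cases k <;>
    simp [kMat, h, Algebra.smul_def] <;> ring

theorem h_add_one_mul_kMat (i : Fin 3) (a b c α : F) :
    h φ (i + 1) α * kMat φ i a b c = kMat φ i (a + α) b (c + α * b) := by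
  apply Subtype.ext
  rw [Matrix.SpecialLinearGroup.coe_mul]
  fin_cases i <;> ext j k <;> rw [Matrix.mul_apply, Fin.sum_univ_three] <;>
    fin_cases j <;> fin_cases k <;>
    simp [kMat, h, Algebra.smul_def] <;> ring

theorem h_add_two_mul_kMat (i : Fin 3) (a b c β : F) :
    h φ (i + 2) β * kMat φ i a b c = kMat φ i a (b + β) c := by
  apply Subtype.ext
  rw [Matrix.SpecialLinearGroup.coe_mul]
  fin_cases i <;> ext j k <;> rw [Matrix.mul_apply, Fin.sum_univ_three] <;>
    fin_cases j <;> fin_cases k <;>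
    simp [kMat, h, Algebra.smul_def] <;> ring

/-- The first four factors are a commutator that produces the central coordinate. Hence the elements
`h` alone generate the group. -/
theorem kMat_eq_h_mul (i : Fin 3) (a b c : F) :
    kMat φ i a b c = h φ (i + 1) c * (h φ (i + 2) 1 * (h φ (i + 1) (-c) * (h φ (i + 2) (-1) *
      (h φ (i + 2) b * h φ (i + 1) a)))) := by
  have h1 : h φ (i + 1) a = kMat φ i a 0 0 := by
    have := kMat_mul_h_add_one φ i 0 0 0 a
    rwa [kMat_zero, one_mul, zero_add] at this
  rw [h1, h_add_two_mul_kMat, h_add_two_mul_kMat, h_add_one_mul_kMat, h_add_two_mul_kMat,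
    h_add_one_mul_kMat]
  congr 1 <;> ring

theorem G_le_of_h_mem (S : Subgroup (SL3 φ)) (hS : ∀ i α, h φ i α ∈ S) : G φ ≤ S := by
  refine (Subgroup.closure_le S).2 fun g hg => ?_
  obtain ⟨i, hi⟩ := Set.mem_iUnion.1 hg
  obtain ⟨a, b, c, rfl⟩ := (mem_K_iff φ i g).1 hi
  rw [kMat_eq_h_mul]
  exact S.mul_mem (hS _ _) (S.mul_mem (hS _ _) (S.mul_mem (hS _ _) (S.mul_mem (hS _ _)
    (S.mul_mem (hS _ _) (hS _ _)))))

variable {φ}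

theorem embed_injective (hφ : IsPrimitivePoly φ) : Function.Injective (embed hφ.monic) := by
  intro g g' e
  have hinj : Function.Injective (AdjoinRoot.modByMonicHom hφ.monic) :=
    (AdjoinRoot.mk_leftInverse hφ.monic).injective
  apply Subtype.ext
  ext i j
  apply hinj
  ext n
  have hdeg : ∀ x, (AdjoinRoot.modByMonicHom hφ.monic x).degree < φ.degree := by
    intro x
    induction x using AdjoinRoot.induction_on with
    | ih p => 
      rw [AdjoinRoot.modByMonicHom_mk]
      exact degree_modByMonic_lt _ hφ.monic
  by_cases hn : n < φ.natDegree
  · exact congrFun e (i, j, ⟨n, hn⟩)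
  · have : φ.degree ≤ n := degree_le_of_natDegree_le (not_lt.1 hn)
    rw [coeff_eq_zero_of_degree_lt ((hdeg _).trans_le this),
      coeff_eq_zero_of_degree_lt ((hdeg _).trans_le this)]

variable [Finite F]

theorem IsPrimitivePoly.root_ne_zero (hφ : IsPrimitivePoly φ) : AdjoinRoot.root φ ≠ 0 := by
  have := Fact.mk hφ.irreducible
  intro h0
  have h1 := hφ.orderOf_root
  have h2 : 1 < Nat.card F ^ φ.natDegree :=
    Nat.one_lt_pow hφ.irreducible.natDegree_pos.ne' Finite.one_lt_card
  have h3 : (AdjoinRoot.root φ) ^ orderOf (AdjoinRoot.root φ) = 1 := pow_orderOf_eq_one _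
  rw [h0, zero_pow (by rw [← h0]; omega)] at h3
  exact zero_ne_one h3

theorem kMat_injective (hφ : IsPrimitivePoly φ) (i : Fin 3) (a b c a' b' c' : F)
    (e : kMat φ i a b c = kMat φ i a' b' c') : a = a' ∧ b = b' ∧ c = c' := by
  have := Fact.mk hφ.irreducible
  have ht := hφ.root_ne_zero
  have ht2 := pow_ne_zero 2 ht
  have e' : ∀ j k, (kMat φ i a b c).1 j k = (kMat φ i a' b' c').1 j k := by rw [e]; simp
  fin_cases i
  · exact ⟨smul_left_injective F ht (e' 0 1), smul_left_injective F ht (e' 1 2),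
      smul_left_injective F ht2 (e' 0 2)⟩
  · exact ⟨smul_left_injective F ht (e' 1 2), smul_left_injective F ht (e' 2 0),
      smul_left_injective F ht2 (e' 1 0)⟩
  · exact ⟨smul_left_injective F ht (e' 2 0), smul_left_injective F ht (e' 0 1),
      smul_left_injective F ht2 (e' 2 1)⟩

/-- The Heisenberg triple of the group `G φ`. -/
noncomputable def heisenbergTriple (hφ : IsPrimitivePoly φ) : HeisenbergTriple F (G φ) where
  h i α := ⟨h φ i α, h_mem φ i α⟩
  k i a b c := ⟨kMat φ i a b c, kMat_mem φ i a b c⟩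
  k_zero i := Subtype.ext (kMat_zero φ i)
  k_mul_h_add_one i a b c α := Subtype.ext (kMat_mul_h_add_one φ i a b c α)
  k_mul_h_add_two i a b c α := Subtype.ext (kMat_mul_h_add_two φ i a b c α)
  h_add_one_mul_k i a b c α := Subtype.ext (h_add_one_mul_kMat φ i a b c α)
  h_add_two_mul_k i a b c α := Subtype.ext (h_add_two_mul_kMat φ i a b c α)
  k_injective i a b c a' b' c' e := kMat_injective hφ i a b c a' b' c' (congrArg Subtype.val e)
  closure_eq_top S hS := by
    have := G_le_of_h_mem φ (S.map (G φ).subtype) fun i α => ⟨_, hS i α, rfl⟩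
    rw [eq_top_iff]
    rintro ⟨g, hg⟩ -
    obtain ⟨x, hx, rfl⟩ := this hg
    exact hx

theorem IsPrimitivePoly.finite_adjoinRoot (hφ : IsPrimitivePoly φ) : Finite (AdjoinRoot φ) := by
  have := hφ.monic.finite_adjoinRoot
  exact Module.finite_of_finite F

theorem IsPrimitivePoly.finite_G (hφ : IsPrimitivePoly φ) : Finite (G φ) := by
  have := hφ.finite_adjoinRoot
  infer_instance

/-- The points of the code are the elements of the group. -/
noncomputable def pointsEquiv (hφ : IsPrimitivePoly φ) : G φ ≃ points hφ.monic :=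
  Equiv.Set.image _ (G φ : Set (SL3 φ)) (embed_injective hφ)

theorem line_eq (hφ : IsPrimitivePoly φ) (i : Fin 3) (g : G φ) (α : F) :
    line hφ.monic i g α = pointsEquiv hφ (g * (heisenbergTriple hφ).h i α) := rfl

theorem mem_code_iff (hφ : IsPrimitivePoly φ) (d : ℕ) (f : points hφ.monic → F) :
    f ∈ code hφ.monic d ↔ (heisenbergTriple hφ).IsCodeword d (f ∘ pointsEquiv hφ) := by
  simp only [code, code₃, Submodule.mem_iInf, Submodule.mem_comap]
  rfl

end Concrete

/-! ### Distance, symmetry and parity checks for the concrete code -/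

theorem natCard_ne_eq_sum_ind {X Γ F : Type*} [Fintype Γ] (e : Γ ≃ X) (w w' : X → F) :
    (Nat.card {x // w x ≠ w' x} : ℝ) = ∑ g, ind (fun g => w (e g) ≠ w' (e g)) g := by
  classical
  rw [sum_ind, ← Fintype.card_subtype, ← Nat.card_eq_fintype_card,
    Nat.card_congr (e.subtypeEquiv (p := fun g => w (e g) ≠ w' (e g))
      (q := fun x => w x ≠ w' x) fun _ => Iff.rfl)]

theorem relDist_eq {X Γ F : Type*} [Fintype Γ] (e : Γ ≃ X) (w w' : X → F) :
    relDist w w' = (∑ g, ind (fun g => w (e g) ≠ w' (e g)) g) / Fintype.card Γ := by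
  rw [relDist, natCard_ne_eq_sum_ind e, ← Nat.card_congr e, Nat.card_eq_fintype_card]

/-- The relative distance of the code over a field with `q` elements. -/
noncomputable def distanceBound (q : ℕ) : ℝ :=
  if 25 < q then (4 * (√q)⁻¹ - (√q)⁻¹ / (1 - (√q)⁻¹)) / (q : ℝ) ^ 3 else 1

theorem distanceBound_pos (q : ℕ) : 0 < distanceBound q := by
  unfold distanceBound
  split_ifs with hq
  · have h5 : (5 : ℝ) < √q := by
      rw [Real.lt_sqrt (by norm_num)]
      have : (25 : ℝ) < q := by exact_mod_cast hq
      linarith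
    have h0 : 0 < √(q : ℝ) := by linarith
    have hq0 : (0 : ℝ) < q := Real.sqrt_pos.1 h0
    have h1 : (√(q : ℝ))⁻¹ < 1 / 5 := by
      rw [inv_eq_one_div]
      exact one_div_lt_one_div_of_lt (by norm_num) h5
    have h2 : 0 < (√(q : ℝ))⁻¹ := inv_pos.2 h0
    refine div_pos ?_ (by positivity)
    rw [sub_pos, div_lt_iff₀ (by linarith)]
    nlinarith
  · exact one_pos

section

variable {F : Type u} [Field F] {φ : F[X]} (hφ : IsPrimitivePoly φ)

/-- The permutations of the points that come from left translations of the group. -/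
noncomputable def translationHom : G φ →* Equiv.Perm (points hφ.monic) :=
  (pointsEquiv hφ).permCongrHom.toMonoidHom.comp (MulAction.toPermHom (G φ) (G φ))

theorem translationHom_apply (a g : G φ) :
    translationHom hφ a (pointsEquiv hφ g) = pointsEquiv hφ (a * g) := by
  simp [translationHom]

variable [Finite F]

theorem mul_mem_code {d₁ d₂ : ℕ} {w₁ w₂ : points hφ.monic → F} (h₁ : w₁ ∈ code hφ.monic d₁)
    (h₂ : w₂ ∈ code hφ.monic d₂) : w₁ * w₂ ∈ code hφ.monic (d₁ + d₂) := by
  rw [mem_code_iff hφ] at *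
  exact fun i g => mul_mem_reedSolomon (h₁ i g) (h₂ i g)

/-- Lines arise by right multiplication, so left translations permute the lines of each type
together with their parameters. -/
theorem exists_transitive_symmetry :
    ∃ S : Subgroup (Equiv.Perm (points hφ.monic)),
        (∀ x y, ∃ σ ∈ S, σ x = y) ∧
        ∀ d : ℕ, ∀ σ ∈ S, ∀ f : points hφ.monic → F,
          f ∈ code hφ.monic d → f ∘ σ ∈ code hφ.monic d := by
  refine ⟨(translationHom hφ).range, fun x y => ?_, ?_⟩
  · obtain ⟨g, rfl⟩ := (pointsEquiv hφ).surjective x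
    obtain ⟨g', rfl⟩ := (pointsEquiv hφ).surjective y
    exact ⟨_, ⟨g' * g⁻¹, rfl⟩, by rw [translationHom_apply hφ, inv_mul_cancel_right]⟩
  · rintro d _ ⟨a, rfl⟩ f hf
    rw [mem_code_iff hφ] at *
    intro i g
    have := hf i (a * g)
    simpa only [Function.comp_apply, translationHom_apply hφ, mul_assoc] using this

theorem distanceBound_le_relDist {d : ℕ}
    (hd : (d : ℝ) < (Nat.card F : ℝ) - 5 * √(Nat.card F)) {w w' : points hφ.monic → F}
    (hw : w ∈ code hφ.monic d) (hw' : w' ∈ code hφ.monic d) (hne : w ≠ w') :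
    distanceBound (Nat.card F) ≤ relDist w w' := by
  have := Fintype.ofFinite F
  have := hφ.finite_G
  have := Fintype.ofFinite (G φ)
  -- For `q ≤ 25`, `q - 5 * √q ≤ 0` and no `d` qualifies, so the default value of `distanceBound` is
  -- never needed.
  have hq : 25 < Nat.card F := by
    by_contra hle
    have h25 : (Nat.card F : ℝ) ≤ 5 ^ 2 := by exact_mod_cast (not_lt.1 hle).trans (by norm_num)
    have h1 : √(Nat.card F : ℝ) ≤ 5 := Real.sqrt_le_iff.2 ⟨by norm_num, h25⟩
    have h2 : √(Nat.card F : ℝ) * √(Nat.card F : ℝ) = Nat.card F :=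
      Real.mul_self_sqrt (Nat.cast_nonneg _)
    have h3 := Real.sqrt_nonneg (Nat.card F : ℝ)
    have h4 : (0 : ℝ) ≤ d := Nat.cast_nonneg _
    nlinarith
  have hc : (heisenbergTriple hφ).IsCodeword d ((w - w') ∘ pointsEquiv hφ) :=
    (mem_code_iff hφ d _).1 (Submodule.sub_mem _ hw hw')
  have h0 : (w - w') ∘ pointsEquiv hφ ≠ 0 := by
    intro h0
    apply hne
    funext x
    obtain ⟨g, rfl⟩ := (pointsEquiv hφ).surjective x
    exact sub_eq_zero.1 (congrFun h0 g)
  have key := HeisenbergTriple.card_le_sum_support hc h0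
    (by rw [← Nat.card_eq_fintype_card]; exact hd.le)
  rw [relDist_eq (pointsEquiv hφ), distanceBound, if_pos hq,
    le_div_iff₀ (by exact_mod_cast Fintype.card_pos), div_mul_eq_mul_div,
    div_le_iff₀ (by have := Nat.card_pos (α := F); positivity), mul_comm (Finset.sum _ _)]
  rw [HeisenbergTriple.globalExpansion, HeisenbergTriple.expansion, ← Nat.card_eq_fintype_card] at key
  refine key.trans (le_of_eq ?_)
  congr 1
  exact Finset.sum_congr rfl fun g _ => ind_congr (by simp [sub_eq_zero])

theorem line_injective (i : Fin 3) (g : G φ) : Function.Injective (line hφ.monic i g) := by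
  intro α β e
  rw [line_eq hφ, line_eq hφ] at e
  exact (heisenbergTriple hφ).h_injective i (mul_left_cancel ((pointsEquiv hφ).injective e))

/-- The parity check on the points with parameters in `s` of a line. -/
noncomputable def lineCheck (i : Fin 3) (g : G φ) (s : Finset F) : points hφ.monic → F :=
  open Classical in
  Function.extend (line hφ.monic i g) (fun α => if α ∈ s then Lagrange.nodalWeight s id α else 0) 0

theorem lineCheck_support (i : Fin 3) (g : G φ) (s : Finset F) :
    Function.support (lineCheck hφ i g s) = line hφ.monic i g '' s := by
  classical
  ext x
  rw [Function.mem_support, lineCheck]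
  by_cases hx : ∃ α, line hφ.monic i g α = x
  · obtain ⟨α, rfl⟩ := hx
    rw [(line_injective hφ i g).extend_apply, (line_injective hφ i g).mem_set_image]
    by_cases hα : α ∈ s
    · simp only [hα, if_true, Finset.mem_coe, iff_true]
      convert Lagrange.nodalWeight_ne_zero (Function.injective_id.injOn) hα
    · simp [hα]
  · rw [Function.extend_apply' _ _ _ hx]
    simp only [Pi.zero_apply, ne_eq, not_true_eq_false, false_iff]
    rintro ⟨α, -, rfl⟩
    exact hx ⟨α, rfl⟩

theorem natCard_lineCheck_ne_zero (i : Fin 3) (g : G φ) (s : Finset F) :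
    Nat.card {x // lineCheck hφ i g s x ≠ 0} = s.card := by
  change Nat.card (Function.support (lineCheck hφ i g s)) = _
  rw [lineCheck_support hφ, Nat.card_coe_set_eq,
    Set.ncard_image_of_injective _ (line_injective hφ i g), Set.ncard_coe_finset]

theorem finsum_lineCheck_mul [DecidableEq F] (i : Fin 3) (g : G φ) (s : Finset F)
    (f : points hφ.monic → F) :
    ∑ᶠ x, lineCheck hφ i g s x * f x =
      ∑ α ∈ s, Lagrange.nodalWeight s id α * f (line hφ.monic i g α) := by
  classical
  rw [finsum_eq_sum_of_support_subset (s := s.image (line hφ.monic i g)),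
    Finset.sum_image (line_injective hφ i g).injOn]
  · refine Finset.sum_congr rfl fun α hα => ?_
    rw [lineCheck, (line_injective hφ i g).extend_apply, if_pos hα]
    congr!
  · rw [Finset.coe_image, ← lineCheck_support hφ]
    exact fun x hx h0 => hx (by simp [h0])

/-- The checks are the divided differences on all sets of `d + 2` points of a line. Nodal weights do
not vanish, so each check involves exactly these points. For `d + 2 > q` there are none. -/
theorem exists_parity_checks (d : ℕ) :
    ∃ P : Set (points hφ.monic → F),
      (∀ y ∈ P, Nat.card {x // y x ≠ 0} = d + 2) ∧
      ∀ f : points hφ.monic → F, f ∈ code hφ.monic d ↔ ∀ y ∈ P, ∑ᶠ x, y x * f x = 0 := by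
  classical
  have := Fintype.ofFinite F
  refine ⟨{y | ∃ i g s, s.card = d + 2 ∧ y = lineCheck hφ i g s}, ?_, fun f => ?_⟩
  · rintro _ ⟨i, g, s, hs, rfl⟩
    rw [natCard_lineCheck_ne_zero hφ, hs]
  · rw [mem_code_iff hφ]
    constructor
    · rintro hf _ ⟨i, g, s, hs, rfl⟩
      rw [finsum_lineCheck_mul hφ]
      exact mem_reedSolomon_iff_divided_differences.1 (hf i g) s hs
    · intro hf i g
      refine mem_reedSolomon_iff_divided_differences.2 fun s hs => ?_
      have := hf _ ⟨i, g, s, hs, rfl⟩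
      rwa [finsum_lineCheck_mul hφ] at this

end

/-! ### The tester -/

theorem rejectProb_map_uniform {ι F Ω : Type*} {Q : ℕ} [Fintype Ω] [Nonempty Ω]
    (τ : Ω → QueryTest ι F Q) (f : ι → F) [DecidablePred fun ω => ¬ (τ ω).accept fun i => f i] :
    (rejectProb ((PMF.uniformOfFintype Ω).map τ) f : ℝ) =
      ((Finset.univ.filter fun ω => ¬ (τ ω).accept fun i => f i).card : ℝ) / Fintype.card Ω := by
  classical
  rw [rejectProb, PMF.toOuterMeasure_map_apply, PMF.toOuterMeasure_uniformOfFintype_apply,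
    ENNReal.toNNReal_div, NNReal.coe_div, ENNReal.toNNReal_natCast, ENNReal.toNNReal_natCast,
    NNReal.coe_natCast, NNReal.coe_natCast, Fintype.card_of_subtype]
  intro ω
  simp

section

variable {F : Type u} [Field F] {φ : F[X]} (hφ : IsPrimitivePoly φ)

/-- The test that evaluates the parity check on the points with parameters in `s` of a line. -/
noncomputable def lineTest (d : ℕ) (i : Fin 3) (g : G φ) (s : {s : Finset F // s.card = d + 2}) :
    QueryTest (points hφ.monic) F (d + 2) :=
  open Classical in
  { queries := s.1.image (line hφ.monic i g)
    card_le := Finset.card_image_le.trans_eq s.2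
    accept := fun r => ∑ α ∈ s.1.attach,
      Lagrange.nodalWeight s.1 id α.1 * r ⟨_, Finset.mem_image_of_mem _ α.2⟩ = 0 }

theorem lineTest_accept_iff [DecidableEq F] (d : ℕ) (i : Fin 3) (g : G φ)
    (s : {s : Finset F // s.card = d + 2}) (f : points hφ.monic → F) :
    ((lineTest hφ d i g s).accept fun x => f x) ↔
      ∑ α ∈ s.1, Lagrange.nodalWeight s.1 id α * f (line hφ.monic i g α) = 0 := by
  rw [← Finset.sum_attach]
  simp only [lineTest]
  congr!

/-- The soundness constant of the tester over a field with `q` elements. -/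
noncomputable def testerSlope (q : ℕ) : NNReal := 27 * (q : NNReal) ^ 6 * 2 ^ q

/-- The rejection probability up to which the tester over a field with `q` elements is sound. -/
noncomputable def testerThreshold (q : ℕ) : ℝ := (96 * 125000 ^ 2 * (q : ℝ) ^ 3 * 2 ^ q)⁻¹

variable [Finite F]

/-- The tester evaluates a divided difference on a random set of `d + 2` points of a random line. A
violated line fails at least one of at most `2 ^ q` checks, so the rejection probability controls
the fraction of violated lines up to this factor. -/
theorem isLocallyTestable_code {d : ℕ} (hd : 4 * d < Nat.card F)
    (hq : 144 * 125000 ^ 2 ≤ Nat.card F) :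
    IsLocallyTestable (code hφ.monic d : Set (points hφ.monic → F)) (d + 2)
      (testerThreshold (Nat.card F)) fun p => testerSlope (Nat.card F) * p := by
  classical
  have := Fintype.ofFinite F
  have := hφ.finite_G
  have := Fintype.ofFinite (G φ)
  have hqpos : 0 < Nat.card F := Nat.card_pos
  have hslope : 0 < testerSlope (Nat.card F) := by unfold testerSlope; positivity
  refine ⟨by unfold testerThreshold; positivity,
    fun a b hab => mul_lt_mul_of_pos_left hab hslope, mul_zero _, ?_⟩
  have hd2 : d + 2 ≤ Fintype.card F := by rw [← Nat.card_eq_fintype_card]; omega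
  obtain ⟨s₀, -, hs₀⟩ := Finset.exists_subset_card_eq (s := (Finset.univ : Finset F)) hd2
  have : Nonempty {s : Finset F // s.card = d + 2} := ⟨⟨s₀, hs₀⟩⟩
  let Ω := Fin 3 × G φ × {s : Finset F // s.card = d + 2}
  let τ : Ω → QueryTest (points hφ.monic) F (d + 2) := fun ω => lineTest hφ d ω.1 ω.2.1 ω.2.2
  refine ⟨(PMF.uniformOfFintype Ω).map τ, fun f hf => ?_, fun f hp => ?_⟩
  · rw [← NNReal.coe_eq_zero, rejectProb_map_uniform, Finset.filter_eq_empty_iff.2, Finset.card_empty,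
      Nat.cast_zero, zero_div]
    intro ω _
    rw [not_not, lineTest_accept_iff hφ]
    exact mem_reedSolomon_iff_divided_differences.1 ((mem_code_iff hφ d f).1 hf ω.1 ω.2.1) _ ω.2.2.2
  · set p : ℝ := (rejectProb ((PMF.uniformOfFintype Ω).map τ) f : ℝ) with hpdef
    set H := heisenbergTriple hφ
    set f' := f ∘ pointsEquiv hφ with hf'
    set v : ℝ := ∑ i, ∑ g, ind (H.ViolatedLine d f' i) g with hv
    set N : ℝ := (Fintype.card (G φ) : ℝ) with hN
    set q : ℝ := (Fintype.card F : ℝ) with hqdef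
    have hNpos : 0 < N := by rw [hN]; exact_mod_cast Fintype.card_pos
    have hqr : 0 < q := by rw [hqdef]; exact_mod_cast Fintype.card_pos
    have hviol : ∀ (i : Fin 3) (g : G φ), H.ViolatedLine d f' i g →
        ∃ s : {s : Finset F // s.card = d + 2}, ¬ (τ (i, g, s)).accept fun x => f x := by
      intro i g hig
      by_contra hcon
      push Not at hcon
      refine hig (mem_reedSolomon_iff_divided_differences.2 fun s hs => ?_)
      exact (lineTest_accept_iff hφ d i g ⟨s, hs⟩ f).1 (hcon ⟨s, hs⟩)
    -- One failing set is chosen per violated line, which embeds the violated lines into the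
    -- rejecting outcomes. The values of `σ` elsewhere are irrelevant.
    choose! σ hσ using hviol
    have hvle : v ≤ ((Finset.univ.filter fun ω : Ω => ¬ (τ ω).accept fun i => f i).card : ℝ) := by
      have e : v = ((Finset.univ.filter fun x : Fin 3 × G φ =>
          H.ViolatedLine d (f ∘ pointsEquiv hφ) x.1 x.2).card : ℝ) := by
        rw [hv, ← Fintype.sum_prod_type', ← sum_ind]
        rfl
      rw [e]
      exact_mod_cast Finset.card_le_card_of_injOn (fun x : Fin 3 × G φ => ((x.1, x.2, σ x.1 x.2) : Ω))
        (fun x hx => by simpa using hσ x.1 x.2 (by simpa using hx))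
        (fun x _ y _ hxy => by
          have h1 := congrArg Prod.fst hxy
          have h2 := congrArg (fun z : Ω => z.2.1) hxy
          exact Prod.ext h1 h2)
    have hΩ : (Fintype.card Ω : ℝ) ≤ 3 * N * 2 ^ Fintype.card F := by
      have h1 : Fintype.card {s : Finset F // s.card = d + 2} ≤ 2 ^ Fintype.card F := by
        rw [← Fintype.card_finset]
        exact Fintype.card_subtype_le _
      have h2 : (Fintype.card Ω : ℝ) =
          3 * N * Fintype.card {s : Finset F // s.card = d + 2} := by
        simp only [Ω, Fintype.card_prod, Fintype.card_fin, Nat.cast_mul, hN]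
        push_cast
        ring
      rw [h2]
      gcongr
      exact_mod_cast h1
    have hp0 : 0 ≤ p := NNReal.coe_nonneg _
    have hvp : v ≤ 3 * N * 2 ^ Fintype.card F * p := by
      have hΩ0 : (0 : ℝ) < Fintype.card Ω := by exact_mod_cast Fintype.card_pos
      have e : p = ((Finset.univ.filter fun ω : Ω => ¬ (τ ω).accept fun i => f i).card : ℝ) /
        Fintype.card Ω := rejectProb_map_uniform τ f
      rw [eq_div_iff hΩ0.ne'] at e
      calc v ≤ p * Fintype.card Ω := by rw [e]; exact hvle
        _ ≤ p * (3 * N * 2 ^ Fintype.card F) := by gcongr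
        _ = _ := by ring
    have hsmall : 32 * 125000 ^ 2 * q ^ 3 * v ≤ N := by
      have h1 : p * (96 * 125000 ^ 2 * q ^ 3 * 2 ^ Fintype.card F) ≤ 1 := by
        rw [testerThreshold, Nat.card_eq_fintype_card] at hp
        have := mul_le_mul_of_nonneg_right hp
          (show 0 ≤ 96 * 125000 ^ 2 * q ^ 3 * 2 ^ Fintype.card F by positivity)
        rwa [inv_mul_cancel₀ (by positivity)] at this
      calc 32 * 125000 ^ 2 * q ^ 3 * v
          ≤ 32 * 125000 ^ 2 * q ^ 3 * (3 * N * 2 ^ Fintype.card F * p) := by gcongr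
        _ = N * (p * (96 * 125000 ^ 2 * q ^ 3 * 2 ^ Fintype.card F)) := by ring
        _ ≤ N * 1 := by gcongr
        _ = N := mul_one N
    obtain ⟨w, hw, hdist⟩ := HeisenbergTriple.exists_isCodeword_near (H := H)
      (by rwa [← Nat.card_eq_fintype_card]) (by rwa [← Nat.card_eq_fintype_card]) f' hsmall
    refine ⟨w ∘ (pointsEquiv hφ).symm, ?_, ?_⟩
    · rw [SetLike.mem_coe, mem_code_iff hφ]
      simpa [Function.comp_assoc] using hw
    · rw [relDist_eq (pointsEquiv hφ), div_le_iff₀ hNpos, NNReal.coe_mul]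
      have e : ((testerSlope (Nat.card F) : NNReal) : ℝ) = 27 * q ^ 6 * 2 ^ Fintype.card F := by
        rw [testerSlope, Nat.card_eq_fintype_card]
        push_cast
        rfl
      rw [e]
      calc _ = ∑ g, ind (fun g => f' g ≠ w g) g := by
            refine Finset.sum_congr rfl fun g _ => ?_
            simp [hf', ind]
        _ ≤ 9 * q ^ 6 * v := hdist
        _ ≤ 9 * q ^ 6 * (3 * N * 2 ^ Fintype.card F * p) := by gcongr
        _ = _ := by ring

end

/-! ### Rate by counting constraints -/

theorem le_finrank_reedSolomon {F : Type u} [Field F] [Finite F] {d : ℕ} (hd : d < Nat.card F) :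
    d + 1 ≤ Module.finrank F (reedSolomon F d) := by
  have := Fintype.ofFinite F
  let L : degreeLT F (d + 1) →ₗ[F] reedSolomon F d :=
    ((LinearMap.pi fun a : F => leval a).comp (degreeLT F (d + 1)).subtype).codRestrict _
      fun P => Submodule.mem_map_of_mem <| by
        have := mem_degreeLT.1 P.2
        rw [mem_degreeLE]
        exact Order.le_of_lt_succ (by exact_mod_cast this)
  have hL : Function.Injective L := by
    rw [injective_iff_map_eq_zero]
    intro P hP
    apply Subtype.ext
    have hdeg : (P : F[X]).degree < Fintype.card F := by
      refine (mem_degreeLT.1 P.2).trans_le ?_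
      rw [← Nat.card_eq_fintype_card]
      exact_mod_cast hd
    exact eq_zero_of_degree_lt_of_eval_finset_eq_zero Finset.univ hdeg
      fun x _ => congrFun (congrArg Subtype.val hP) x
  have h1 := LinearMap.finrank_le_finrank_of_injective hL
  rwa [(degreeLTEquiv F (d + 1)).finrank_eq, Module.finrank_fin_fun] at h1

theorem finrank_add_finrank_le_finrank_inf_add {F V : Type*} [Field F] [AddCommGroup V] [Module F V]
    [FiniteDimensional F V] (A B : Submodule F V) :
    Module.finrank F A + Module.finrank F B ≤
      Module.finrank F (A ⊓ B : Submodule F V) + Module.finrank F V := by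
  have h1 := Submodule.finrank_sup_add_finrank_inf_eq A B
  have h2 := Submodule.finrank_le (A ⊔ B)
  omega

namespace HeisenbergTriple

variable {F : Type u} [Field F] {Γ : Type*} [Group Γ] (H : HeisenbergTriple F Γ)

/-- The subgroup of the elements `h i α`. -/
def lineSubgroup (i : Fin 3) : Subgroup Γ where
  carrier := Set.range (H.h i)
  mul_mem' := by
    rintro _ _ ⟨α, rfl⟩ ⟨β, rfl⟩
    exact ⟨α + β, (H.h_add i α β).symm⟩
  one_mem' := ⟨0, H.h_zero i⟩
  inv_mem' := by
    rintro _ ⟨α, rfl⟩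
    refine ⟨-α, eq_inv_of_mul_eq_one_left ?_⟩
    rw [H.h_add, neg_add_cancel, H.h_zero]

/-- The words that are in the Reed–Solomon code on all lines of type `i`. -/
noncomputable def lineCode (d : ℕ) (i : Fin 3) : Submodule F (Γ → F) :=
  ⨅ g : Γ, (reedSolomon F d).comap (LinearMap.funLeft F F fun α => g * H.h i α)

theorem mem_lineCode {d : ℕ} {i : Fin 3} {f : Γ → F} :
    f ∈ H.lineCode d i ↔ ∀ g, (fun α => f (g * H.h i α)) ∈ reedSolomon F d := by
  simp only [lineCode, Submodule.mem_iInf, Submodule.mem_comap]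
  rfl

variable [Finite F] [Finite Γ]

/-- The lines of one type partition the group, and a Reed–Solomon word can be chosen freely on each.
Another base point on a line shifts its parameter, under which the Reed–Solomon code is invariant.
-/
theorem natCard_mul_le_finrank_lineCode {d : ℕ} (hd : d < Nat.card F) (i : Fin 3) :
    Nat.card Γ * (d + 1) ≤ Nat.card F * Module.finrank F (H.lineCode d i) := by
  have := Fintype.ofFinite (Γ ⧸ H.lineSubgroup i)
  have hex : ∀ g : Γ, ∃ α, (g : Γ ⧸ H.lineSubgroup i).out * H.h i α = g := by
    intro g
    obtain ⟨⟨x, hx⟩, hα⟩ := QuotientGroup.mk_out_eq_mul (H.lineSubgroup i) g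
    obtain ⟨α, rfl⟩ := id hx
    refine ⟨-α, ?_⟩
    rw [hα, mul_assoc, H.h_add, add_neg_cancel, H.h_zero, mul_one]
  choose r hr using hex
  have hmk : ∀ (g : Γ) α, ((g * H.h i α : Γ) : Γ ⧸ H.lineSubgroup i) = g := fun g α =>
    QuotientGroup.mk_mul_of_mem _ ⟨α, rfl⟩
  have hr2 : ∀ g α, r (g * H.h i α) = r g + α := by
    intro g α
    apply H.h_injective i
    have h1 := hr (g * H.h i α)
    rw [hmk] at h1
    rw [← H.h_add]
    apply mul_left_cancel (a := (g : Γ ⧸ H.lineSubgroup i).out)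
    rw [h1, ← mul_assoc, hr]
  let L : ((Γ ⧸ H.lineSubgroup i) → reedSolomon F d) →ₗ[F] H.lineCode d i :=
    { toFun := fun u => ⟨fun g => (u g : F → F) (r g), H.mem_lineCode.2 fun g => by
        simp only [hmk, hr2]
        exact comp_add_mem_reedSolomon (u g).2 (r g)⟩
      map_add' := fun u v => rfl
      map_smul' := fun c u => rfl }
  have hL : Function.Injective L := by
    intro u v huv
    funext x
    apply Subtype.ext
    funext α
    obtain ⟨g, rfl⟩ := QuotientGroup.mk_surjective x
    have h1 := congrFun (congrArg Subtype.val huv) (g * H.h i (α - r g))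
    change (u ((g * H.h i (α - r g) : Γ) : Γ ⧸ H.lineSubgroup i) : F → F) (r (g * H.h i (α - r g)))
      = (v ((g * H.h i (α - r g) : Γ) : Γ ⧸ H.lineSubgroup i) : F → F) (r (g * H.h i (α - r g))) at h1
    rwa [hr2, hmk, add_sub_cancel] at h1
  have h1 := LinearMap.finrank_le_finrank_of_injective hL
  rw [Module.finrank_pi_fintype, Finset.sum_const, Finset.card_univ, smul_eq_mul,
    ← Nat.card_eq_fintype_card] at h1
  have h2 : Nat.card (H.lineSubgroup i) = Nat.card F :=
    (Nat.card_congr (Equiv.ofInjective (H.h i) (H.h_injective i))).symm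
  rw [Subgroup.card_eq_card_quotient_mul_card_subgroup (H.lineSubgroup i), h2,
    mul_comm _ (Nat.card F), mul_assoc]
  exact Nat.mul_le_mul_left _ ((Nat.mul_le_mul_left _ (le_finrank_reedSolomon hd)).trans h1)

theorem natCard_le_finrank_iInf_lineCode {d : ℕ} (hd : d < Nat.card F)
    (hd' : 2 * Nat.card F < 3 * d) :
    Nat.card Γ ≤ Nat.card F * Module.finrank F (⨅ i, H.lineCode d i : Submodule F (Γ → F)) := by
  have := Fintype.ofFinite Γ
  have e : (⨅ i, H.lineCode d i) = (H.lineCode d 0 ⊓ H.lineCode d 1) ⊓ H.lineCode d 2 := by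
    apply le_antisymm
    · exact le_inf (le_inf (iInf_le _ _) (iInf_le _ _)) (iInf_le _ _)
    · refine le_iInf fun i => ?_
      fin_cases i
      · exact inf_le_left.trans inf_le_left
      · exact inf_le_left.trans inf_le_right
      · exact inf_le_right
  rw [e]
  have h0 := H.natCard_mul_le_finrank_lineCode hd 0
  have h1 := H.natCard_mul_le_finrank_lineCode hd 1
  have h2 := H.natCard_mul_le_finrank_lineCode hd 2
  have h3 := finrank_add_finrank_le_finrank_inf_add (H.lineCode d 0) (H.lineCode d 1)
  have h4 := finrank_add_finrank_le_finrank_inf_add (H.lineCode d 0 ⊓ H.lineCode d 1) (H.lineCode d 2)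
  have h5 : Module.finrank F (Γ → F) = Nat.card Γ := by
    rw [Module.finrank_fintype_fun_eq_card, Nat.card_eq_fintype_card]
  rw [h5] at h3 h4
  -- The intersection has dimension at least `card Γ * (3 * (d + 1) - 2 * q) / q`, and the bracket
  -- is positive.
  nlinarith [Nat.zero_le (Nat.card Γ)]

end HeisenbergTriple

section

variable {F : Type u} [Field F] {φ : F[X]}

theorem kMat_mul (i : Fin 3) (a b c a' b' c' : F) :
    kMat φ i a b c * kMat φ i a' b' c' = kMat φ i (a + a') (b + b') (c + c' + a * b') := by
  rw [kMat_eq_h_mul φ i a' b' c']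
  simp only [← mul_assoc, kMat_mul_h_add_one, kMat_mul_h_add_two]
  congr 1 <;> ring

theorem image_mul_K_eq {g x : SL3 φ} {i : Fin 3} (hx : x ∈ (fun k => g * k) '' K φ i) :
    (fun k => g * k) '' K φ i = (fun k => x * k) '' K φ i := by
  obtain ⟨k, hk, rfl⟩ := hx
  obtain ⟨a, b, c, rfl⟩ := (mem_K_iff φ i k).1 hk
  ext y
  constructor
  · rintro ⟨l, hl, rfl⟩
    obtain ⟨a', b', c', rfl⟩ := (mem_K_iff φ i l).1 hl
    refine ⟨kMat φ i (a' - a) (b' - b) (c' - c - a * (b' - b)),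
      (mem_K_iff φ i _).2 ⟨_, _, _, rfl⟩, ?_⟩
    simp only [mul_assoc, kMat_mul]
    congr 2 <;> ring
  · rintro ⟨l, hl, rfl⟩
    obtain ⟨a', b', c', rfl⟩ := (mem_K_iff φ i l).1 hl
    exact ⟨kMat φ i a b c * kMat φ i a' b' c', (mem_K_iff φ i _).2 ⟨_, _, _, kMat_mul _ _ _ _ _ _ _⟩,
      (mul_assoc _ _ _).symm⟩

variable [Finite F]

/-- A triangle is determined by any common element of its three cosets. -/
theorem natCard_triangles_le (hφ : IsPrimitivePoly φ) :
    Nat.card (triangles φ) ≤ Nat.card (G φ) := by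
  have := hφ.finite_G
  have hsub : triangles φ ⊆ Set.range fun (x : G φ) i => (fun k => (x : SL3 φ) * k) '' K φ i := by
    rintro v ⟨hv, x, hx⟩
    have hxi : ∀ i, x ∈ v i := Set.mem_iInter.1 hx
    have hxG : x ∈ G φ := by
      obtain ⟨g, hg, e⟩ := hv 0
      have := hxi 0
      rw [e] at this
      obtain ⟨k, hk, rfl⟩ := this
      exact mul_mem hg (Subgroup.subset_closure (Set.mem_iUnion.2 ⟨0, hk⟩))
    refine ⟨⟨x, hxG⟩, funext fun i => ?_⟩
    obtain ⟨g, -, e⟩ := hv i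
    rw [e, image_mul_K_eq (e ▸ hxi i)]
  refine (Nat.card_mono (Set.finite_range _) hsub).trans ?_
  exact Nat.card_le_card_of_surjective _ Set.rangeFactorization_surjective

/-- The code, as a space of functions on the group. -/
noncomputable def codeEquiv (hφ : IsPrimitivePoly φ) (d : ℕ) :
    code hφ.monic d ≃ₗ[F] (⨅ i, (heisenbergTriple hφ).lineCode d i : Submodule F (G φ → F)) :=
  (LinearEquiv.funCongrLeft F F (pointsEquiv hφ)).ofSubmodules _ _ <| by
    ext f
    rw [Submodule.mem_map_equiv, mem_code_iff hφ, Submodule.mem_iInf]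
    refine forall_congr' fun i => ?_
    rw [HeisenbergTriple.mem_lineCode]
    refine forall_congr' fun g => ?_
    simp [LinearEquiv.funCongrLeft_symm, LinearEquiv.funCongrLeft_apply, LinearMap.funLeft_apply]

theorem inv_mul_natCard_triangles_le (hφ : IsPrimitivePoly φ) {d : ℕ} (hd : d < Nat.card F)
    (hd' : 2 * Nat.card F < 3 * d) :
    (Nat.card F : ℝ)⁻¹ * (Nat.card (triangles φ) : ℝ) ≤
      (Module.finrank F (code hφ.monic d) : ℝ) := by
  have := hφ.finite_G
  have h1 := (heisenbergTriple hφ).natCard_le_finrank_iInf_lineCode hd hd'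
  rw [← (codeEquiv hφ d).finrank_eq] at h1
  rw [inv_mul_le_iff₀ (by exact_mod_cast Nat.card_pos)]
  exact_mod_cast (natCard_triangles_le hφ).trans h1

end

/-! ### Transvections in the group -/

open Matrix.SpecialLinearGroup in
theorem transvection_commutator {n R : Type*} [Fintype n] [DecidableEq n] [CommRing R] {i j k : n}
    (hij : i ≠ j) (hjk : j ≠ k) (hik : i ≠ k) (a b : R) :
    transvection hij a * transvection hjk b * transvection hij (-a) * transvection hjk (-b) =
      transvection hik (a * b) := by
  apply Subtype.ext
  simp [transvection_coe, mul_add, add_mul, Matrix.single_mul_single_of_ne _ _ _ _ hij.symm,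
    Matrix.single_mul_single_of_ne _ _ _ _ hjk.symm,
    Matrix.single_mul_single_of_ne _ _ _ _ hik.symm, ← Matrix.single_neg]
  abel

/-- A group that contains all transvections of a three-dimensional space acts transitively on the
non-zero row vectors. -/
theorem exists_mem_row_eq {R : Type*} [Field R]
    (S : Subgroup (Matrix.SpecialLinearGroup (Fin 3) R))
    (hS : ∀ (i j : Fin 3) (hij : i ≠ j) (s : R), Matrix.SpecialLinearGroup.transvection hij s ∈ S)
    (v : Fin 3 → R) (hv : v ≠ 0) : ∃ g ∈ S, ∀ j, g.1 0 j = v j := by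
  have step : ∀ (w : Fin 3 → R) (i j : Fin 3) (_ : i ≠ j) (s : R),
      (∃ g ∈ S, ∀ j, g.1 0 j = w j) → ∃ g ∈ S, ∀ k, g.1 0 k =
        Function.update w j (w j + s * w i) k := by
    rintro w i j hij s ⟨g, hg, hgw⟩
    refine ⟨g * Matrix.SpecialLinearGroup.transvection hij s, S.mul_mem hg (hS i j hij s),
      fun k => ?_⟩
    change (g.1 * Matrix.transvection i j s) 0 k = _
    by_cases hk : k = j
    · subst hk
      rw [Matrix.mul_transvection_apply_same, Function.update_self, hgw, hgw]
    · rw [Matrix.mul_transvection_apply_of_ne _ _ _ _ hk, Function.update_of_ne hk, hgw]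
  have h1 : ∃ g ∈ S, ∀ j, g.1 0 j = (![1, 0, 0] : Fin 3 → R) j :=
    ⟨1, S.one_mem, fun j => by fin_cases j <;> simp⟩
  have key : ∀ w : Fin 3 → R, (∃ g ∈ S, ∀ j, g.1 0 j = w j) → w = v →
      ∃ g ∈ S, ∀ j, g.1 0 j = v j := fun w h e => e ▸ h
  by_cases hz : v 2 = 0
  · by_cases hy : v 1 = 0
    · have hx : v 0 ≠ 0 := by
        intro hx
        apply hv
        funext j
        fin_cases j <;> assumption
      -- A transvection cannot rescale the only nonzero entry, so the path is (1,0,0), (1,1,0),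
      -- (x,1,0), (x,0,0).
      refine key _ (step _ 0 1 (by decide) (-(v 0)⁻¹) (step _ 1 0 (by decide) (v 0 - 1)
        (step _ 0 1 (by decide) 1 h1))) ?_
      funext j
      fin_cases j <;> simp [hy, hz, hx, Function.update]
    · refine key _ (step _ 1 2 (by decide) (v 2 * (v 1)⁻¹) (step _ 1 0 (by decide)
        ((v 0 - 1) * (v 1)⁻¹) (step _ 0 1 (by decide) (v 1) h1))) ?_
      funext j
      fin_cases j <;> simp [hy, Function.update]
  · refine key _ (step _ 2 1 (by decide) (v 1 * (v 2)⁻¹) (step _ 2 0 (by decide)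
        ((v 0 - 1) * (v 2)⁻¹) (step _ 0 2 (by decide) (v 2) h1))) ?_
    funext j
    fin_cases j <;> simp [hz, Function.update]

section

variable {F : Type u} [Field F] {φ : F[X]}

theorem h_add_one_eq_transvection (i : Fin 3) (α : F) :
    h φ (i + 1) α =
      Matrix.SpecialLinearGroup.transvection (fin_three_add_one_ne i).symm
        (AdjoinRoot.root φ * algebraMap F _ α) := by
  apply Subtype.ext
  rw [Matrix.SpecialLinearGroup.transvection_coe]
  fin_cases i <;> ext j k <;> fin_cases j <;> fin_cases k <;>
    simp [h, Matrix.single, Algebra.smul_def, mul_comm]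

/-- Transvections with entries in `t F[t³]` are in the group. -/
theorem transvection_mem_G (i : Fin 3) (s : AdjoinRoot φ)
    (hs : s ∈ Algebra.adjoin F {AdjoinRoot.root φ ^ 3}) :
    Matrix.SpecialLinearGroup.transvection (fin_three_add_one_ne i).symm (AdjoinRoot.root φ * s)
      ∈ G φ := by
  set t := AdjoinRoot.root φ with ht
  have hcomm : ∀ {i j k : Fin 3} (hij : i ≠ j) (hjk : j ≠ k) (hik : i ≠ k) {a b : AdjoinRoot φ},
      Matrix.SpecialLinearGroup.transvection hij a ∈ G φ →
      Matrix.SpecialLinearGroup.transvection hjk b ∈ G φ →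
      Matrix.SpecialLinearGroup.transvection hik (a * b) ∈ G φ := by
    intro i j k hij hjk hik a b ha hb
    rw [← transvection_commutator hij hjk hik, ← Matrix.SpecialLinearGroup.transvection_inv,
      ← Matrix.SpecialLinearGroup.transvection_inv]
    exact mul_mem (mul_mem (mul_mem ha hb) (inv_mem ha)) (inv_mem hb)
  have hbase : ∀ (i j : Fin 3) (hij : i ≠ j), j = i + 1 → ∀ α : F,
      Matrix.SpecialLinearGroup.transvection hij (t * algebraMap F _ α) ∈ G φ := by
    rintro i _ hij rfl α
    rw [← h_add_one_eq_transvection]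
    exact h_mem φ _ α
  -- Three nested commutators, along `i → i + 1 → i + 2 → i → i + 1`, return to the same position
  -- and multiply the entry by `t ^ 3`.
  have hpow : ∀ (n : ℕ) (α : F) (i j : Fin 3) (hij : i ≠ j), j = i + 1 →
      Matrix.SpecialLinearGroup.transvection hij (t * (algebraMap F _ α * (t ^ 3) ^ n)) ∈ G φ := by
    intro n α
    induction n with
    | zero => simpa using fun i j hij hj => hbase i j hij hj α
    | succ n ih =>
      intro i j hij hj
      have hi2 : i ≠ i + 2 := (fin_three_add_two_ne i).symm
      have hij2 : i + 2 ≠ j := by rw [hj]; fin_cases i <;> decide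
      have h1 := hcomm (i := i) (j := i + 1) (k := i + 2) (fin_three_add_one_ne i).symm
        (by fin_cases i <;> decide) hi2 (ih i (i + 1) _ rfl)
        (hbase (i + 1) (i + 2) _ (by fin_cases i <;> decide) 1)
      have h2 := hcomm (i := i + 2) (j := i) (k := j) hi2.symm hij hij2
        (hbase (i + 2) i _ (by fin_cases i <;> decide) 1) (hbase i j _ hj 1)
      have h3 := hcomm hi2 hij2 hij h1 h2
      convert h3 using 2
      simp only [map_one]
      ring
  rw [Algebra.adjoin_singleton_eq_range_aeval] at hs
  obtain ⟨p, rfl⟩ := hs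
  change Matrix.SpecialLinearGroup.transvection _ (t * aeval (t ^ 3) p) ∈ G φ
  induction p using Polynomial.induction_on' with
  | add p r hp hr =>
    rw [map_add, mul_add, Matrix.SpecialLinearGroup.transvection_add]
    exact mul_mem hp hr
  | monomial n a =>
    rw [aeval_monomial]
    exact hpow n a i _ _ rfl

theorem transvection_mem_G_of_adjoin_eq_top (hφ : IsPrimitivePoly φ) [Finite F]
    (htop : Algebra.adjoin F {AdjoinRoot.root φ ^ 3} = ⊤) (i j : Fin 3) (hij : i ≠ j)
    (s : AdjoinRoot φ) : Matrix.SpecialLinearGroup.transvection hij s ∈ G φ := by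
  have := Fact.mk hφ.irreducible
  have ht := hφ.root_ne_zero
  have h1 : ∀ (i j : Fin 3) (hij : i ≠ j), j = i + 1 → ∀ s : AdjoinRoot φ,
      Matrix.SpecialLinearGroup.transvection hij s ∈ G φ := by
    rintro i _ hij rfl s
    have := transvection_mem_G (φ := φ) i ((AdjoinRoot.root φ)⁻¹ * s) (by rw [htop]; trivial)
    rwa [mul_inv_cancel_left₀ ht] at this
  by_cases hj : j = i + 1
  · exact h1 i j hij hj s
  · have hj1 : i + 1 ≠ j := fun h => hj h.symm
    have hj2 : j = i + 1 + 1 := by revert i j; decide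
    rw [← mul_one s, ← transvection_commutator (fin_three_add_one_ne i).symm hj1 hij,
      ← Matrix.SpecialLinearGroup.transvection_inv, ← Matrix.SpecialLinearGroup.transvection_inv]
    have ha := h1 i (i + 1) (fin_three_add_one_ne i).symm rfl s
    have hb := h1 (i + 1) j hj1 hj2 1
    exact mul_mem (mul_mem (mul_mem ha hb) (inv_mem ha)) (inv_mem hb)

end

/-! ### The Reed–Muller lower bound -/

section

variable {F : Type u} [Field F] {φ : F[X]}

theorem natCard_adjoinRoot (hφ : φ.Monic) :
    Nat.card (AdjoinRoot φ) = Nat.card F ^ φ.natDegree := by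
  have := hφ.finite_adjoinRoot
  rw [Module.natCard_eq_pow_finrank (K := F), (AdjoinRoot.powerBasis' hφ).finrank]
  rfl

theorem exists_pow_root_eq [Finite F] (hφ : IsPrimitivePoly φ) {x : AdjoinRoot φ} (hx : x ≠ 0) :
    ∃ n : ℕ, AdjoinRoot.root φ ^ n = x := by
  have := Fact.mk hφ.irreducible
  have := hφ.finite_adjoinRoot
  have hord : orderOf (Units.mk0 _ hφ.root_ne_zero) = Nat.card (AdjoinRoot φ)ˣ := by
    rw [← orderOf_units, Units.val_mk0, hφ.orderOf_root, Nat.card_units, natCard_adjoinRoot hφ.monic]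
  have htop := Subgroup.eq_top_of_card_eq (Subgroup.zpowers (Units.mk0 _ hφ.root_ne_zero))
    (by rw [Nat.card_zpowers, hord])
  have hmem : Units.mk0 x hx ∈ Subgroup.zpowers (Units.mk0 _ hφ.root_ne_zero) := by
    rw [htop]; trivial
  rw [← mem_powers_iff_mem_zpowers] at hmem
  obtain ⟨n, hn⟩ := hmem
  exact ⟨n, by simpa using congrArg Units.val hn⟩

/-- The subalgebra `A` generated by `t ^ 3` is a field. If `t ∉ A`, then `|A| ^ 2 ≤ |R|`. Every unit
is one of `1, t, t ^ 2` times a power of `t ^ 3`, so `|R| - 1 ≤ 3 * (|A| - 1)`. Together these force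
`|A| = 2` and `|R| = 4`. -/
theorem adjoin_root_pow_three_eq_top_or [Finite F] (hφ : IsPrimitivePoly φ) :
    Algebra.adjoin F {AdjoinRoot.root φ ^ 3} = ⊤ ∨ (Nat.card F = 2 ∧ φ.natDegree = 2) := by
  have := Fact.mk hφ.irreducible
  have := hφ.finite_adjoinRoot
  set t := AdjoinRoot.root φ with ht
  set A := Algebra.adjoin F {t ^ 3} with hA
  by_cases htA : t ∈ A
  · left
    rw [eq_top_iff, ← AdjoinRoot.adjoinRoot_eq_top]
    exact Algebra.adjoin_le (by simpa using htA)
  right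
  have hinv : ∀ x ∈ A, x⁻¹ ∈ A := by
    intro x hx
    by_cases hx0 : x = 0
    · rw [hx0, inv_zero]; exact A.zero_mem
    have := Fintype.ofFinite (AdjoinRoot φ)
    have h1 := FiniteField.pow_card_sub_one_eq_one x hx0
    have h2 : Fintype.card (AdjoinRoot φ) - 1 = (Fintype.card (AdjoinRoot φ) - 2) + 1 := by
      have := Fintype.one_lt_card (α := AdjoinRoot φ)
      omega
    rw [h2, pow_succ] at h1
    rw [← eq_inv_of_mul_eq_one_left h1]
    exact A.pow_mem hx _
  have h1 : Nat.card A * Nat.card A ≤ Nat.card (AdjoinRoot φ) := by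
    rw [← Nat.card_prod]
    refine Nat.card_le_card_of_injective (fun x : A × A => (x.1 + x.2 * t : AdjoinRoot φ)) ?_
    rintro ⟨x, y⟩ ⟨x', y'⟩ (e : (x + y * t : AdjoinRoot φ) = x' + y' * t)
    by_cases hy : y = y'
    · subst hy
      rw [add_left_inj] at e
      rw [Subtype.ext e]
    · exfalso
      have hy' : (y - y' : AdjoinRoot φ) ≠ 0 := sub_ne_zero.2 fun h => hy (Subtype.ext h)
      have : t = (x' - x) * (y - y' : AdjoinRoot φ)⁻¹ := by
        rw [eq_mul_inv_iff_mul_eq₀ hy']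
        linear_combination e
      rw [this] at htA
      exact htA (A.mul_mem (A.sub_mem x'.2 x.2) (hinv _ (A.sub_mem y.2 y'.2)))
  have h2 : Nat.card (AdjoinRoot φ)ˣ ≤ 3 * Nat.card {x : A // x ≠ 0} := by
    rw [← Nat.card_fin 3, ← Nat.card_prod]
    have hmem : ∀ n : ℕ, (t ^ 3) ^ n ∈ A := fun n =>
      A.pow_mem (Algebra.subset_adjoin (Set.mem_singleton _)) n
    have hex : ∀ u : (AdjoinRoot φ)ˣ, ∃ z : Fin 3 × {x : A // x ≠ 0},
        (u : AdjoinRoot φ) = t ^ (z.1 : ℕ) * (z.2.1 : AdjoinRoot φ) := by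
      intro u
      obtain ⟨n, hn⟩ := exists_pow_root_eq hφ u.ne_zero
      refine ⟨(⟨n % 3, Nat.mod_lt _ (by norm_num)⟩, ⟨⟨(t ^ 3) ^ (n / 3), hmem _⟩, ?_⟩), ?_⟩
      · intro h0
        exact pow_ne_zero _ (pow_ne_zero _ hφ.root_ne_zero) (congrArg Subtype.val h0)
      · change _ = t ^ (n % 3) * (t ^ 3) ^ (n / 3)
        rw [← hn, ← pow_mul, ← pow_add, Nat.mod_add_div]
    choose z hz using hex
    refine Nat.card_le_card_of_injective z fun u v e => Units.ext ?_
    rw [hz u, hz v, e]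
  have h3 : Nat.card {x : A // x ≠ 0} + 1 = Nat.card A := by
    have := Fintype.ofFinite A
    classical
    rw [Nat.card_eq_fintype_card, Fintype.card_subtype_compl, Fintype.card_subtype_eq,
      Nat.card_eq_fintype_card]
    exact Nat.sub_add_cancel Fintype.card_pos
  have h4 : Nat.card F ≤ Nat.card A :=
    Nat.card_le_card_of_injective _ (algebraMap F A).injective
  have h5 : 2 ≤ Nat.card F := Finite.one_lt_card
  rw [Nat.card_units] at h2
  have h6 : Nat.card A = 2 := by
    obtain ⟨a, ha⟩ : ∃ a, Nat.card A = a + 2 := ⟨Nat.card A - 2, by omega⟩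
    rw [ha] at h1 h3 ⊢
    have : (a + 2) * (a + 2) ≤ 3 * (a + 2) - 2 := by omega
    have : (a + 2) * (a + 2) = a * a + 4 * a + 4 := by ring
    have := Nat.zero_le (a * a)
    omega
  rw [h6] at h1 h3 h4
  have h7 : Nat.card F = 2 := le_antisymm h4 h5
  refine ⟨h7, ?_⟩
  have h8 : 2 ^ φ.natDegree = 2 ^ 2 := by
    rw [← h7, ← natCard_adjoinRoot hφ.monic, h7]
    omega
  exact Nat.pow_right_injective le_rfl h8

theorem comp_line_mem_reedSolomon {k d : ℕ} {u : (Fin k → F) → F} (hu : u ∈ reedMuller F k d)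
    (y z : Fin k → F) : (fun α => u (y + α • z)) ∈ reedSolomon F d := by
  obtain ⟨P, hP, rfl⟩ := hu
  have hP' : P.totalDegree ≤ d := (MvPolynomial.mem_restrictTotalDegree _ _ _).1 hP
  refine mem_reedSolomon_iff.2 ⟨MvPolynomial.aeval (fun l => C (y l) + C (z l) * X) P, ?_, ?_⟩
  · rw [← mul_one d]
    exact MvPolynomial.aeval_natDegree_le P hP' _ fun l => by
      rw [add_comm]; exact natDegree_linear_le
  · intro α
    change MvPolynomial.aeval (y + α • z) P = _
    rw [← coe_evalRingHom, ← coe_aeval_eq_evalRingHom]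
    change _ = aeval α _
    rw [MvPolynomial.comp_aeval_apply]
    congr 2
    funext l
    rw [Pi.add_apply, Pi.smul_apply, smul_eq_mul, coe_aeval_eq_eval, eval_add, eval_C, eval_mul,
      eval_C, eval_X, mul_comm]

/-- The coordinates of a row vector over `R = F[t] / φ`. -/
noncomputable def rowCoordinates (hφ : IsPrimitivePoly φ) :
    (Fin 3 → AdjoinRoot φ) →ₗ[F] (Fin (3 * φ.natDegree) → F) :=
  LinearMap.pi fun l => (LinearMap.proj (finProdFinEquiv.symm l).2).comp
    ((AdjoinRoot.powerBasisAux' hφ.monic).equivFun.toLinearMap.comp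
      (LinearMap.proj (finProdFinEquiv.symm l).1))

theorem rowCoordinates_surjective (hφ : IsPrimitivePoly φ) :
    Function.Surjective (rowCoordinates hφ) := by
  intro z
  refine ⟨fun c => (AdjoinRoot.powerBasisAux' hφ.monic).equivFun.symm
    fun k => z (finProdFinEquiv (c, k)), funext fun l => ?_⟩
  simp only [rowCoordinates, LinearMap.pi_apply, LinearMap.comp_apply, LinearMap.proj_apply,
    LinearEquiv.coe_coe, LinearEquiv.apply_symm_apply]
  rw [Prod.mk.eta, Equiv.apply_symm_apply]

/-- The first row of the matrix of a point. -/
noncomputable def firstRow (hφ : IsPrimitivePoly φ) (g : G φ) : Fin (3 * φ.natDegree) → F :=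
  rowCoordinates hφ ((g : SL3 φ).1 0)

/-- Matrix entries are thus affine in the line parameter, so polynomials in them of total degree `d`
restrict to degree at most `d` on lines. -/
theorem h_coe_eq (i : Fin 3) (α : F) : (h φ i α).1 = 1 + α • ((h φ i 1).1 - 1) := by
  fin_cases i <;> ext j k <;> fin_cases j <;> fin_cases k <;> simp [h]

theorem firstRow_mul_h [Finite F] (hφ : IsPrimitivePoly φ) (i : Fin 3) (g : G φ) (α : F) :
    firstRow hφ (g * (heisenbergTriple hφ).h i α) = firstRow hφ g +
      α • (firstRow hφ (g * (heisenbergTriple hφ).h i 1) - firstRow hφ g) := by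
  simp only [firstRow]
  rw [← map_sub, ← map_smul, ← map_add]
  congr 1
  have : ((g : SL3 φ) * h φ i α).1 =
      (g : SL3 φ).1 + α • (((g : SL3 φ) * h φ i 1).1 - (g : SL3 φ).1) := by
    change (g : SL3 φ).1 * (h φ i α).1 =
      (g : SL3 φ).1 + α • ((g : SL3 φ).1 * (h φ i 1).1 - (g : SL3 φ).1)
    rw [h_coe_eq, mul_add, mul_one, mul_smul_comm, mul_sub, mul_one]
  exact congrFun this 0

/-- Polynomials in the coordinates of the first row, as codewords. -/
noncomputable def reedMullerToCode [Finite F] (hφ : IsPrimitivePoly φ) (d : ℕ) :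
    reedMuller F (3 * φ.natDegree) d →ₗ[F] code hφ.monic d :=
  ((LinearMap.funLeft F F fun x => firstRow hφ ((pointsEquiv hφ).symm x)).comp
    (reedMuller F (3 * φ.natDegree) d).subtype).codRestrict _ fun u => by
      rw [mem_code_iff hφ]
      intro i g
      have := comp_line_mem_reedSolomon u.2 (firstRow hφ g)
        (firstRow hφ (g * (heisenbergTriple hφ).h i 1) - firstRow hφ g)
      simp only [← firstRow_mul_h] at this
      simpa [LinearMap.funLeft_apply] using this

theorem reedMullerToCode_apply [Finite F] (hφ : IsPrimitivePoly φ) (d : ℕ)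
    (u : reedMuller F (3 * φ.natDegree) d) (g : G φ) :
    (reedMullerToCode hφ d u).1 (pointsEquiv hφ g) = u.1 (firstRow hφ g) := by
  change u.1 (firstRow hφ ((pointsEquiv hφ).symm (pointsEquiv hφ g))) = _
  rw [Equiv.symm_apply_apply]

/-- First rows of group elements are all the nonzero vectors, so a polynomial that maps to zero
vanishes outside the origin. Its values over the whole space sum to zero, because the total degree
is below `(q - 1) * 3 * m`, hence it vanishes at the origin too. -/
theorem reedMullerToCode_injective [Finite F] (hφ : IsPrimitivePoly φ)
    (htop : Algebra.adjoin F {AdjoinRoot.root φ ^ 3} = ⊤) {d : ℕ} (hd : d < Nat.card F) :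
    Function.Injective (reedMullerToCode hφ d) := by
  have := Fact.mk hφ.irreducible
  have := Fintype.ofFinite F
  rw [injective_iff_map_eq_zero]
  intro u hu
  have hne : ∀ z, z ≠ 0 → u.1 z = 0 := by
    intro z hz
    obtain ⟨v, rfl⟩ := rowCoordinates_surjective hφ z
    obtain ⟨g, hg, hgv⟩ := exists_mem_row_eq (G φ)
      (transvection_mem_G_of_adjoin_eq_top hφ htop) v (by rintro rfl; exact hz (map_zero _))
    have h1 := reedMullerToCode_apply hφ d u ⟨g, hg⟩
    rw [hu] at h1
    rw [← show g.1 0 = v from funext hgv]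
    exact h1.symm
  have hsum : ∑ z, u.1 z = 0 := by
    obtain ⟨P, hP, hPu⟩ := u.2
    have hP' : P.totalDegree ≤ d := (MvPolynomial.mem_restrictTotalDegree _ _ _).1 hP
    rw [← hPu]
    refine MvPolynomial.sum_eval_eq_zero P ?_
    rw [Fintype.card_fin, ← Nat.card_eq_fintype_card]
    have h1 : 2 ≤ Nat.card F := Finite.one_lt_card
    have h2 : 0 < φ.natDegree := hφ.irreducible.natDegree_pos
    calc P.totalDegree ≤ Nat.card F - 1 := by omega
      _ < (Nat.card F - 1) * 3 := by omega
      _ ≤ (Nat.card F - 1) * (3 * φ.natDegree) := Nat.mul_le_mul_left _ (by omega)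
  rw [Fintype.sum_eq_single 0 hne] at hsum
  apply Subtype.ext
  funext z
  by_cases hz : z = 0
  · rw [hz]; exact hsum
  · exact hne z hz

theorem reedMullerToCode_zero_injective [Finite F] (hφ : IsPrimitivePoly φ) :
    Function.Injective (reedMullerToCode hφ 0) := by
  rw [injective_iff_map_eq_zero]
  intro u hu
  have h1 := reedMullerToCode_apply hφ 0 u 1
  obtain ⟨P, hP, hPu⟩ := u.2
  have hP' : P.totalDegree ≤ 0 := (MvPolynomial.mem_restrictTotalDegree _ _ _).1 hP
  have hPC := MvPolynomial.totalDegree_eq_zero_iff_eq_C.1 (Nat.le_zero.1 hP')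
  have hconst : ∀ z, u.1 z = P.coeff 0 := by
    intro z
    rw [← hPu]
    change MvPolynomial.aeval z P = _
    rw [hPC]
    simp
  rw [hu, hconst] at h1
  apply Subtype.ext
  funext z
  rw [hconst, ← h1]
  rfl

theorem finrank_reedMuller_one_le (k : ℕ) : Module.finrank F (reedMuller F k 1) ≤ k + 1 := by
  refine (Submodule.finrank_map_le _ _).trans ?_
  rw [MvPolynomial.restrictTotalDegree,
    Module.finrank_eq_nat_card_basis (MvPolynomial.basisRestrictSupport F _)]
  have hsub : {n : Fin k →₀ ℕ | (n.sum fun _ e => e) ≤ 1} ⊆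
      Set.range fun o : Option (Fin k) => o.elim 0 fun l => Finsupp.single l 1 := by
    intro n hn
    by_cases h0 : n = 0
    · exact ⟨none, h0.symm⟩
    obtain ⟨l, hl⟩ := Finsupp.ne_iff.1 h0
    refine ⟨some l, ?_⟩
    have hn' : ∑ j, n j ≤ 1 := by
      rwa [Set.mem_ofPred_eq, Finsupp.sum_fintype _ _ fun _ => rfl] at hn
    have hl' : 1 ≤ n l := Nat.one_le_iff_ne_zero.2 hl
    rw [← Finset.add_sum_erase _ _ (Finset.mem_univ l)] at hn'
    ext j
    by_cases hj : j = l
    · subst hj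
      simp
      omega
    · have : n j ≤ ∑ j ∈ Finset.univ.erase l, n j :=
        Finset.single_le_sum (fun _ _ => Nat.zero_le _) (Finset.mem_erase.2 ⟨hj, Finset.mem_univ j⟩)
      simp [hj]
      omega
  refine (Nat.card_mono (Set.finite_range _) hsub).trans ?_
  refine (Nat.card_le_card_of_surjective _ Set.rangeFactorization_surjective).trans ?_
  simp

theorem finrank_reedMuller_le [Finite F] (hφ : IsPrimitivePoly φ) {d : ℕ} (hd : d < Nat.card F) :
    Module.finrank F (reedMuller F (3 * φ.natDegree) d) ≤ Module.finrank F (code hφ.monic d) := by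
  have := hφ.finite_G
  have := Fintype.ofFinite F
  have : Finite (points hφ.monic) := Finite.of_equiv _ (pointsEquiv hφ)
  have := Fintype.ofFinite (points hφ.monic)
  rcases adjoin_root_pow_three_eq_top_or hφ with htop | ⟨hq, hm⟩
  · exact LinearMap.finrank_le_finrank_of_injective (reedMullerToCode_injective hφ htop hd)
  rcases Nat.eq_zero_or_pos d with rfl | hd0
  · exact LinearMap.finrank_le_finrank_of_injective (reedMullerToCode_zero_injective hφ)
  obtain rfl : d = 1 := by omega
  -- For `q = 2` and `d = 1` the line conditions are void. The code has dimension at least 8, the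
  -- size of one Heisenberg coset, against at most 7 for the Reed–Muller code in 6 variables.
  refine (finrank_reedMuller_one_le _).trans ?_
  have htop : code hφ.monic 1 = ⊤ := by
    refine eq_top_iff.2 fun f _ => (mem_code_iff hφ 1 f).2 fun i g => ?_
    exact mem_reedSolomon_of_card_le (by rw [← Nat.card_eq_fintype_card, hq]) _
  rw [htop, finrank_top, Module.finrank_fintype_fun_eq_card, ← Nat.card_eq_fintype_card,
    ← Nat.card_congr (pointsEquiv hφ), hm]
  have h8 : Nat.card (F × F × F) ≤ Nat.card (G φ) :=
    Nat.card_le_card_of_injective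
      (fun x : F × F × F => (heisenbergTriple hφ).k 0 x.1 x.2.1 x.2.2) fun x y e => by
        obtain ⟨h1, h2, h3⟩ := (heisenbergTriple hφ).k_injective 0 _ _ _ _ _ _ e
        exact Prod.ext h1 (Prod.ext h2 h3)
  rw [Nat.card_prod, Nat.card_prod, hq] at h8
  omega

end

end HDXCode

open HDXCode in
theorem theorem1p3 :
    -- absolute constants
    ∃ A : ℝ, 0 < A ∧ ∃ q₀ : ℕ,
    ∀ q : ℕ, IsPrimePow q →
    -- constants that depend only on `q`
    ∃ c : ℝ, 0 < c ∧ ∃ δ : ℝ, 0 < δ ∧ ∃ ε : ℝ, 0 < ε ∧ ∃ κ : NNReal, 0 < κ ∧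
    ∀ (F : Type u) [Field F] [Finite F], Nat.card F = q →
    ∀ (φ : Polynomial F) (hφ : IsPrimitivePoly φ),
      (∀ d : ℕ, d < q →
        -- rate
        (Module.finrank F (reedMuller F (3 * φ.natDegree) d) ≤
          Module.finrank F (code hφ.monic d)) ∧
        (2 * q < 3 * d →
          c * (Nat.card (triangles φ) : ℝ) ≤ (Module.finrank F (code hφ.monic d) : ℝ)) ∧
        -- distance
        ((d : ℝ) < (q : ℝ) - A * Real.sqrt q →
          ∀ w ∈ code hφ.monic d, ∀ w' ∈ code hφ.monic d, w ≠ w' → δ ≤ relDist w w') ∧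
        -- parity checks of length `d + 2`
        (∃ P : Set (points hφ.monic → F),
          (∀ y ∈ P, Nat.card {x // y x ≠ 0} = d + 2) ∧
          ∀ f : points hφ.monic → F,
            f ∈ code hφ.monic d ↔ ∀ y ∈ P, ∑ᶠ x, y x * f x = 0) ∧
        -- local testability with `d + 2` queries
        (q.Prime → q₀ ≤ q → 4 * d < q →
          IsLocallyTestable (code hφ.monic d : Set (points hφ.monic → F)) (d + 2) ε
            fun p => κ * p)) ∧
      -- multiplication
      (∀ d₁ d₂ : ℕ, ∀ w₁ ∈ code hφ.monic d₁, ∀ w₂ ∈ code hφ.monic d₂,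
        w₁ * w₂ ∈ code hφ.monic (d₁ + d₂)) ∧
      -- symmetry
      (∃ S : Subgroup (Equiv.Perm (points hφ.monic)),
        (∀ x y, ∃ σ ∈ S, σ x = y) ∧
        ∀ d : ℕ, ∀ σ ∈ S, ∀ f : points hφ.monic → F,
          f ∈ code hφ.monic d → f ∘ σ ∈ code hφ.monic d) := by
  refine ⟨5, by norm_num, 144 * 125000 ^ 2, fun q hq => ?_⟩
  have hq0 : 0 < q := hq.pos
  refine ⟨(q : ℝ)⁻¹, by positivity, distanceBound q, distanceBound_pos q, testerThreshold q,
    by unfold testerThreshold; positivity, testerSlope q, by unfold testerSlope; positivity, ?_⟩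
  rintro F _ _ rfl φ hφ
  refine ⟨fun d hd => ⟨finrank_reedMuller_le hφ hd, inv_mul_natCard_triangles_le hφ hd,
    fun hd' w hw w' hw' hne => distanceBound_le_relDist hφ hd' hw hw' hne,
    exists_parity_checks hφ d, fun _ hq₀ hd' => isLocallyTestable_code hφ hd' hq₀⟩,
    fun d₁ d₂ w₁ h₁ w₂ h₂ => mul_mem_code hφ h₁ h₂, exists_transitive_symmetry hφ⟩
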